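/- We work over $\mathbb{C}$. For a closed subvariety $W\subset\mathbb{P}^n$, two distinct singular points of $W$ are called *associated* if the line joining them is contained in $W$; the *configuration* of the singular points is the graph whose vertices are the singular points and whose edges join associated points. The singular points of $W$ are *similar* if they all have the same multiplicity, they all have the same tangent cone (up to an invertible linear change of coordinates), and there is an $m$ such that each of them is associated with exactly $m$ others. **Genus 8.** Let $Q=q_{00}x_0^2+q_{11}x_1^2+q_{22}x_2^2+q_{33}x_3^2+q_{01}x_0x_1+q_{23}x_2x_3$ and $R=r_{00}x_0^2+r_{11}x_1^2+r_{22}x_2^2+r_{33}x_3^2+r_{01}x_0x_1+r_{23}x_2x_3$, where the quadric surface $\{Q=0\}\subset\mathbb{P}^3$ is smooth and $R$ vanishes at none of the points of $\{Q=0\}$ on the lines $x_0=x_1=0$ and $x_2=x_3=0$ (this holds in particular whenever the curve $C=\{Q=R=0\}$ is a smooth complete intersection). Let $Y=\{Q=0\}\subset\mathbb{P}^4$ be the cone over this quadric with vertex $v=[0:0:0:0:1]$, let $X$ be the blow-up of $Y$ at $v$ and along $C\subset\{x_4=0\}$ (a smooth Fano threefold if $C$ is smooth), and let $\sigma$ be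 the involution of $X$ induced by $$[x_0:\dots:x_4]\mapsto[x_4x_0:x_4x_1:-x_4x_2:-x_4x_3:R],$$ which has eight fixed points. The quotient $W^8_{BS}=X/\sigma$ is realized as the closure of the image of the rational map $\varphi:Y\dashrightarrow\mathbb{P}^9$ with coordinates $$x_0(x_4^2+R),\;x_1(x_4^2+R),\;x_2(x_4^2-R),\;x_3(x_4^2-R),\;x_4x_0^2,\;x_4x_1^2,\;x_4x_2^2,\;x_4x_3^2,\;x_4x_0x_1,\;x_4x_2x_3,$$ which lies in the hyperplane $H_8=\{q_{00}Z_4+q_{11}Z_5+q_{22}Z_6+q_{33}Z_7+q_{01}Z_8+q_{23}Z_9=0\}\cong\mathbb{P}^8$. **Genus 10.** Let $S_6\subset\mathbb{P}^6$ be the sextic Del Pezzo surface which is the closure of the image of $[u_0:u_1:u_2]\mapsto[u_1^2u_2:u_1u_2^2:u_0^2u_2:u_0u_2^2:u_0^2u_1:u_0u_1^2:u_0u_1u_2]$, let $X=\mathbb{P}^1\times S_6$, and let $\sigma$ be the involution $$([y_0:y_1],[x_0:\dots:x_6])\mapsto([y_0:-y_1],[x_2:x_4:x_0:x_5:x_1:x_3:x_6]).$$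 The quotient $W^{10}_{BS}=X/\sigma$ is realized in $\mathbb{P}^{10}$ as the image of $X$ under the map with coordinates $$y_0^2x_6,\;y_0^2(x_0+x_2),\;y_0^2(x_1+x_4),\;y_0^2(x_3+x_5),\;y_1^2x_6,\;y_1^2(x_0+x_2),\;y_1^2(x_1+x_4),\;y_1^2(x_3+x_5),$$ $$y_0y_1(x_0-x_2),\;y_0y_1(x_1-x_4),\;y_0y_1(x_3-x_5).$$ **Theorem.** (a) The homogeneous ideal of $W^8_{BS}\subset H_8\cong\mathbb{P}^8$ and the homogeneous ideal of $W^{10}_{BS}\subset\mathbb{P}^{10}$ are generated by quadrics and cubics, that is, by their homogeneous elements of degrees $2$ and $3$. (b) $W^{10}_{BS}$ has exactly eight singular points, they are similar, and each of them is associated with exactly $4$ others. They can be labelled $P_1,\dots,P_4,P_1',\dots,P_4'$ in such a way that $P_i,P_j$ are associated and $P_i',P_j'$ are associated for all $i\ne j$, while $P_i,P_j'$ are associated if and only if $i=j$. In particular there exist three mutually associated singular points, although the genus $10$ is greater than $7$, contrary to an assertion of Fano. -/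

import Mathlib

open MvPolynomial Filter
open scoped ENNReal

noncomputable section

namespace EnriquesFano

/-! ### Projective space, ideals, generation by quadrics and cubics -/

/-- Complex projective space of dimension `n`. -/
abbrev ProjSpace (n : ℕ) : Type := Projectivization ℂ (Fin (n + 1) → ℂ)

/-- The affine cone (without requiring the origin) over a subset of projective space. -/
def affineCone {n : ℕ} (W : Set (ProjSpace n)) : Set (Fin (n + 1) → ℂ) :=
  {x | ∃ h : x ≠ 0, Projectivization.mk ℂ x h ∈ W}

/-- The homogeneous ideal of a subset of projective space: all polynomials which vanish on all
homogeneous coordinate vectors of all points of `W`. -/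
def projIdeal {n : ℕ} (W : Set (ProjSpace n)) : Ideal (MvPolynomial (Fin (n + 1)) ℂ) :=
  vanishingIdeal ℂ (affineCone W)

/-- The Zariski closure of a subset of projective space. -/
def zariskiClosure {n : ℕ} (W : Set (ProjSpace n)) : Set (ProjSpace n) :=
  {P | ∀ F ∈ projIdeal W, eval P.rep F = 0}

/-- The image of a set `Y` of vectors under the map to projective space with coordinate
functions `f`; vectors at which all coordinate functions vanish are discarded. -/
def projImage {V : Type} {n : ℕ} (f : V → Fin (n + 1) → ℂ) (Y : Set V) : Set (ProjSpace n) :=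
  {P | ∃ v ∈ Y, ∃ h : f v ≠ 0, P = Projectivization.mk ℂ (f v) h}

/-- An ideal is generated by quadrics and cubics if it is generated by the homogeneous
polynomials of degree two and three which it contains. -/
def GeneratedByQuadricsAndCubics {n : ℕ} (I : Ideal (MvPolynomial (Fin (n + 1)) ℂ)) : Prop :=
  I = Ideal.span {F | F ∈ I ∧ (F.IsHomogeneous 2 ∨ F.IsHomogeneous 3)}

/-! ### Singular points, multiplicity, tangent cone -/

/-- The dimension of a (nonempty, closed) subset of projective space: the Krull dimension of the
homogeneous coordinate ring minus one. -/
def projDim {n : ℕ} (W : Set (ProjSpace n)) : ℕ :=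
  ((ringKrullDim (MvPolynomial (Fin (n + 1)) ℂ ⧸ projIdeal W)).unbotD 0).toNat - 1

/-- The vector space whose projectivization is the embedded projective tangent space of `W` at
`P`: the common kernel of the differentials at `P` of all polynomials in the ideal of `W`. -/
def tangentSpace {n : ℕ} (W : Set (ProjSpace n)) (P : ProjSpace n) :
    Submodule ℂ (Fin (n + 1) → ℂ) where
  carrier := {v | ∀ F ∈ projIdeal W, ∑ i, eval P.rep (pderiv i F) * v i = 0}
  zero_mem' := by intro F _; simp
  add_mem' := by
    intro a b ha hb F hF
    simp [mul_add, Finset.sum_add_distrib, ha F hF, hb F hF]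
  smul_mem' := by
    intro c a ha F hF
    have h : ∑ i, eval P.rep (pderiv i F) * (c • a) i
        = c * ∑ i, eval P.rep (pderiv i F) * a i := by
      rw [Finset.mul_sum]
      refine Finset.sum_congr rfl fun i _ => ?_
      simp only [Pi.smul_apply, smul_eq_mul]
      ring
    rw [h, ha F hF, mul_zero]

/-- The singular points of an irreducible projective variety `W`: the points of `W` at which the
projective tangent space has dimension greater than the dimension of `W`. -/
def singularPoints {n : ℕ} (W : Set (ProjSpace n)) : Set (ProjSpace n) :=
  {P | P ∈ W ∧ projDim W + 1 < Module.finrank ℂ (tangentSpace W P)}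

/-- The least index of a nonzero coordinate of `P`. -/
def pivot {n : ℕ} (P : ProjSpace n) : Fin (n + 1) := sInf {j | P.rep j ≠ 0}

/-- The part of `W` in the standard affine chart on which the coordinate with index `pivot P` is
nonzero, in the affine coordinates of this chart translated so that `P` is the origin. -/
def affineChart {n : ℕ} (W : Set (ProjSpace n)) (P : ProjSpace n) : Set (Fin n → ℂ) :=
  {x | (pivot P).insertNth (1 : ℂ)
      (fun i => P.rep ((pivot P).succAbove i) / P.rep (pivot P) + x i) ∈ affineCone W}

/-- The ideal of the affine variety `affineChart W P`, in which `P` is the origin. -/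
def affineIdeal {n : ℕ} (W : Set (ProjSpace n)) (P : ProjSpace n) :
    Ideal (MvPolynomial (Fin n) ℂ) :=
  vanishingIdeal ℂ (affineChart W P)

/-- The Hilbert-Samuel function of the local ring of `W` at `P`: with `A` the affine coordinate
ring and `m` the maximal ideal of the origin, `k ↦ dim (A / m ^ k)`. -/
def hilbertSamuel {n : ℕ} (W : Set (ProjSpace n)) (P : ProjSpace n) (k : ℕ) : ℕ :=
  Module.finrank ℂ (MvPolynomial (Fin n) ℂ ⧸
    (affineIdeal W P ⊔ Ideal.span (Set.range (X : Fin n → MvPolynomial (Fin n) ℂ)) ^ k))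

/-- The multiplicity of an irreducible variety `W` of dimension `d` at its point `P`: the limit of
`d! * dim (A / m ^ k) / k ^ d`. The upper limit is used because it is always defined; the limit
exists, so it is equal to it. -/
def multiplicity {n : ℕ} (W : Set (ProjSpace n)) (P : ProjSpace n) : ℝ≥0∞ :=
  limsup (fun k : ℕ => ((Nat.factorial (projDim W) * hilbertSamuel W P k : ℕ) : ℝ≥0∞)
    / ((k : ℝ≥0∞) ^ projDim W)) atTop

/-- The ideal of the tangent cone of `W` at `P`: it is generated by the homogeneous parts of
minimal degree of the polynomials in the ideal of the affine chart with origin `P`. -/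
def tangentConeIdeal {n : ℕ} (W : Set (ProjSpace n)) (P : ProjSpace n) :
    Ideal (MvPolynomial (Fin n) ℂ) :=
  Ideal.span {G | ∃ F ∈ affineIdeal W P, ∃ k : ℕ,
    (∀ i < k, homogeneousComponent i F = 0) ∧ G = homogeneousComponent k F}

/-- The linear substitution of variables with matrix `M`. -/
def linearSubst {n : ℕ} (M : Matrix (Fin n) (Fin n) ℂ) :
    MvPolynomial (Fin n) ℂ →ₐ[ℂ] MvPolynomial (Fin n) ℂ :=
  aeval fun i => ∑ j, C (M i j) * X j

/-- The tangent cones of `W` at `P` and at `Q` are the same, as cones in affine space up to an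
invertible linear change of coordinates. -/
def SameTangentCone {n : ℕ} (W : Set (ProjSpace n)) (P Q : ProjSpace n) : Prop :=
  ∃ M : Matrix (Fin n) (Fin n) ℂ, IsUnit M.det ∧
    (tangentConeIdeal W P).map (linearSubst M) = tangentConeIdeal W Q

/-! ### Associated singular points, configuration, similarity -/

/-- Two distinct points are associated if the line joining them is contained in `W`. -/
def AssociatedPoints {n : ℕ} (W : Set (ProjSpace n)) (P Q : ProjSpace n) : Prop :=
  P ≠ Q ∧ ∀ R : ProjSpace n, R.submodule ≤ P.submodule ⊔ Q.submodule → R ∈ W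

/-- The configuration of the singular points of `W`: the graph on the singular points in which
two of them are adjacent when they are associated. -/
def configuration {n : ℕ} (W : Set (ProjSpace n)) : SimpleGraph (singularPoints W) where
  Adj P Q := AssociatedPoints W P.1 Q.1
  symm := ⟨fun P Q h => ⟨h.1.symm, fun R hR => h.2 R (by rwa [sup_comm])⟩⟩
  loopless := ⟨fun _ h => h.1 rfl⟩

/-- The singular points of `W` are similar: they have the same multiplicity and the same tangent
cone, and for some `m` each of them is associated with exactly `m` other singular points. -/
structure SingularPointsSimilar {n : ℕ} (W : Set (ProjSpace n)) : Prop where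
  same_multiplicity : ∀ P ∈ singularPoints W, ∀ Q ∈ singularPoints W,
    multiplicity W P = multiplicity W Q
  same_tangentCone : ∀ P ∈ singularPoints W, ∀ Q ∈ singularPoints W, SameTangentCone W P Q
  same_associated : ∃ m : ℕ, ∀ P ∈ singularPoints W,
    {Q | Q ∈ singularPoints W ∧ AssociatedPoints W P Q}.encard = m

/-! ### The threefold of genus 8 -/

/-- The coefficients of a quadratic form
`c₀₀ x₀² + c₁₁ x₁² + c₂₂ x₂² + c₃₃ x₃² + c₀₁ x₀ x₁ + c₂₃ x₂ x₃`. -/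
structure BlockQuadric where
  c00 : ℂ
  c11 : ℂ
  c22 : ℂ
  c33 : ℂ
  c01 : ℂ
  c23 : ℂ

/-- The quadratic form with the given coefficients. -/
def BlockQuadric.poly (q : BlockQuadric) : MvPolynomial (Fin 4) ℂ :=
  C q.c00 * X 0 ^ 2 + C q.c11 * X 1 ^ 2 + C q.c22 * X 2 ^ 2 + C q.c33 * X 3 ^ 2
    + C q.c01 * (X 0 * X 1) + C q.c23 * (X 2 * X 3)

/-- The quadric surface is smooth: the partial derivatives have no common nontrivial zero. -/
def BlockQuadric.Smooth (q : BlockQuadric) : Prop :=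
  ∀ x : Fin 4 → ℂ, (∀ i, eval x (pderiv i q.poly) = 0) → x = 0

/-- The involution `σ` attached to `Q` and `R` has eight distinct fixed points. The fixed points
are the points of the cone over `Q` with `x₂ = x₃ = 0`, `x₄² = R`, or with `x₀ = x₁ = 0`,
`x₄² = - R`; if `Q` is smooth, there are two points of `Q` on each of the lines `x₂ = x₃ = 0` and
`x₀ = x₁ = 0`, so that there are eight fixed points exactly if `R` vanishes at none of these four
points. This is the case whenever the curve `Q = R = 0` is smooth. -/
def EightFixedPoints (q r : BlockQuadric) : Prop :=
  ∀ x : Fin 4 → ℂ, x ≠ 0 → eval x q.poly = 0 →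
    ((x 2 = 0 ∧ x 3 = 0) ∨ (x 0 = 0 ∧ x 1 = 0)) → eval x r.poly ≠ 0

/-- The first four of five coordinates. -/
def firstFour (x : Fin 5 → ℂ) : Fin 4 → ℂ := fun i => x i.castSucc

/-- The coordinate vectors of the points of the cone `Y ⊂ ℙ⁴` over the quadric `Q` with vertex
`[0 : 0 : 0 : 0 : 1]`. -/
def quadricCone (q : BlockQuadric) : Set (Fin 5 → ℂ) :=
  {x | x ≠ 0 ∧ eval (firstFour x) q.poly = 0}

/-- The invariant cubics which define the rational map `φ : Y ⇢ ℙ⁹`. -/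
def phi8 (r : BlockQuadric) (x : Fin 5 → ℂ) : Fin 10 → ℂ :=
  let R := eval (firstFour x) r.poly
  ![x 4 ^ 2 * x 0 + x 0 * R, x 4 ^ 2 * x 1 + x 1 * R,
    x 4 ^ 2 * x 2 - x 2 * R, x 4 ^ 2 * x 3 - x 3 * R,
    x 4 * x 0 ^ 2, x 4 * x 1 ^ 2, x 4 * x 2 ^ 2, x 4 * x 3 ^ 2,
    x 4 * x 0 * x 1, x 4 * x 2 * x 3]

/-- The threefold `φ(Y) ⊂ ℙ⁹`, that is the image of the quotient of the blow-up of `Y` by `σ`. -/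
def W8InP9 (q r : BlockQuadric) : Set (ProjSpace 9) :=
  zariskiClosure (projImage (phi8 r) (quadricCone q))

/-- The hyperplane `H₈` of `ℙ⁹` that contains `φ(Y)`, as a linear form. -/
def hyperplaneForm (q : BlockQuadric) (Z : Fin 10 → ℂ) : ℂ :=
  q.c00 * Z 4 + q.c11 * Z 5 + q.c22 * Z 6 + q.c33 * Z 7 + q.c01 * Z 8 + q.c23 * Z 9

/-- The threefold of genus 8 in `ℙ⁸`, where `ℙ⁸` is identified with the hyperplane `H₈` by means
of an injective linear map `ι` with image `H₈`. -/
def W8 (q r : BlockQuadric) (ι : (Fin 9 → ℂ) →ₗ[ℂ] (Fin 10 → ℂ)) (hι : Function.Injective ι) :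
    Set (ProjSpace 8) :=
  {P | Projectivization.map ι hι P ∈ W8InP9 q r}

/-! ### The threefold of genus 10 -/

/-- The plane cubics through the three coordinate points. -/
def cubicMap (u : Fin 3 → ℂ) : Fin 7 → ℂ :=
  ![u 1 ^ 2 * u 2, u 1 * u 2 ^ 2, u 0 ^ 2 * u 2, u 0 * u 2 ^ 2, u 0 ^ 2 * u 1, u 0 * u 1 ^ 2,
    u 0 * u 1 * u 2]

/-- The sextic Del Pezzo surface `S₆ ⊂ ℙ⁶`, the image of the plane under the rational map defined
by the cubics through three points. -/
def delPezzo6 : Set (ProjSpace 6) := zariskiClosure (projImage cubicMap Set.univ)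

/-- The map on `ℙ¹ × ℙ⁶` defined by the forms of bidegree `(2, 1)` which are invariant under
`([y₀ : y₁], [x₀ : … : x₆]) ↦ ([y₀ : -y₁], [x₂ : x₄ : x₀ : x₅ : x₁ : x₃ : x₆])`. -/
def phi10 (v : (Fin 2 → ℂ) × (Fin 7 → ℂ)) : Fin 11 → ℂ :=
  let y := v.1
  let x := v.2
  ![y 0 ^ 2 * x 6, y 0 ^ 2 * (x 0 + x 2), y 0 ^ 2 * (x 1 + x 4), y 0 ^ 2 * (x 3 + x 5),
    y 1 ^ 2 * x 6, y 1 ^ 2 * (x 0 + x 2), y 1 ^ 2 * (x 1 + x 4), y 1 ^ 2 * (x 3 + x 5),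
    y 0 * y 1 * (x 0 - x 2), y 0 * y 1 * (x 1 - x 4), y 0 * y 1 * (x 3 - x 5)]

/-- The threefold of genus 10 in `ℙ¹⁰`: the image of `ℙ¹ × S₆`, that is the quotient of `ℙ¹ × S₆`
by the involution described above. -/
def W10 : Set (ProjSpace 10) :=
  projImage phi10 {v | v.1 ≠ 0 ∧ v.2 ∈ affineCone delPezzo6}

end EnriquesFano

end

/-!
**Ideals.** For both threefolds a finite list of quadrics and cubics in the ideal is written as a
list of rewriting rules `lead → tail` which decrease a weight, so that modulo these polynomials
every polynomial is a combination of reduced monomials (`exists_reduced`). It then suffices that no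
nonzero combination of reduced monomials lies in the ideal (`eq_span_rules`).

For genus 8, a linear change of coordinates brings `Q` into the form `x₀ x₁ - x₂ x₃`, and the
threefold is parametrized by the Segre parametrization of this quadric and the coordinate `y = x₄`
(`exists_normal_coordinates`). The leading terms in `y` of the nine coordinates are monomials, and
reduced monomials have distinct leading terms (`reduced8_injective`), so that their images are
linearly independent. Smoothness of `Q` is used in the form of the two nonzero discriminants.

For genus 10, let `A` and `O` be the invariant and the anti-invariant coordinates of the Del Pezzo
surface under the involution. The threefold is the set of the vectors `(y₀² A, y₁² A, y₀ y₁ O)`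
(`mem_W10_iff`). The point `A` moves on the Cayley cubic (`exists_evenOddEqs`), and the coordinate
ring of the Del Pezzo surface is free over `ℂ[A₁, A₂, A₃]` with basis `1, A₀, A₀², O₀, O₁, O₂`
(`basisCoeff_eval_eq_zero`). Again reduced monomials have independent images
(`eq_zero_of_mem_projIdeal_W10`).

**Singular points.** The threefold of genus 10 has dimension three, because its coordinate ring is
integral over a polynomial ring in four parameters (`projDim_W10`). As generators of the ideal are
known, the tangent spaces are explicit. If `y₀ y₁ ≠ 0`, the smoothness of `ℙ¹` and of the Del Pezzo
surface bounds the dimension of the tangent space of the cone by four; if `y₀ y₁ = 0` and `O ≠ 0`,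
the same bound follows because the gradient of the Cayley cubic is given by the products of the odd
coordinates (`finrank_tangentSpace_W10_le_four`). There remain the points with `y₀ y₁ = 0` and `O =
0`, that is the four nodes of the Cayley cubic in each of the two blocks of coordinates; there the
tangent space has dimension at least five (`mem_singularPoints_W10`).

**Configuration.** The six lines which join the nodes of the Cayley cubic are contained in it, and a
node of one block is joined within the threefold to the same node of the other block only
(`associatedPoints_node_iff`).

**Similarity.** Exchanging the two blocks and changing signs of coordinates are automorphisms of the
cone over the threefold which act transitively on the nodes and are compatible with the affine
charts (`chartEquiv_node`). A linear isomorphism of affine charts preserves the Hilbert–Samuel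
function and the tangent cone.
-/

noncomputable section

namespace EnriquesFano

/-! ### Projective varieties and their homogeneous ideals -/

theorem mem_projIdeal {n : ℕ} {W : Set (ProjSpace n)} {F : MvPolynomial (Fin (n + 1)) ℂ} :
    F ∈ projIdeal W ↔
      ∀ (x : Fin (n + 1) → ℂ) (h : x ≠ 0), Projectivization.mk ℂ x h ∈ W → eval x F = 0 := by
  unfold projIdeal affineCone
  simp only [mem_vanishingIdeal_iff, Set.mem_ofPred_eq, forall_exists_index]
  rfl

theorem smul_mem_affineCone {n : ℕ} {W : Set (ProjSpace n)} {x : Fin (n + 1) → ℂ}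
    (hx : x ∈ affineCone W) {c : ℂ} (hc : c ≠ 0) : c • x ∈ affineCone W := by
  obtain ⟨h, hW⟩ := hx
  refine ⟨smul_ne_zero hc h, ?_⟩
  have : Projectivization.mk ℂ (c • x) (smul_ne_zero hc h) = Projectivization.mk ℂ x h := by
    rw [Projectivization.mk_eq_mk_iff']
    exact ⟨c, rfl⟩
  rwa [this]

theorem mk_mem_iff {n : ℕ} {W : Set (ProjSpace n)} {x : Fin (n + 1) → ℂ} (h : x ≠ 0) :
    Projectivization.mk ℂ x h ∈ W ↔ x ∈ affineCone W :=
  ⟨fun hW => ⟨h, hW⟩, fun ⟨_, hW⟩ => hW⟩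

theorem rep_mem_affineCone {n : ℕ} {W : Set (ProjSpace n)} {P : ProjSpace n} :
    P.rep ∈ affineCone W ↔ P ∈ W := by
  rw [← mk_mem_iff P.rep_nonzero, P.mk_rep]

theorem eval_smul_eq {n : ℕ} (F : MvPolynomial (Fin n) ℂ) (c : ℂ) (x : Fin n → ℂ) :
    eval (c • x) F = eval x (aeval (fun i => C c * X i) F) := by
  rw [← MvPolynomial.coe_aeval_eq_eval, ← MvPolynomial.coe_aeval_eq_eval, RingHom.coe_coe,
    RingHom.coe_coe, comp_aeval_apply]
  simp [Pi.smul_def]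

theorem mk_mem_zariskiClosure {n : ℕ} {W : Set (ProjSpace n)} {x : Fin (n + 1) → ℂ}
    (h : x ≠ 0) :
    Projectivization.mk ℂ x h ∈ zariskiClosure W ↔ ∀ F ∈ projIdeal W, eval x F = 0 := by
  have key : ∀ (y : Fin (n + 1) → ℂ) (c : ℂ), c ≠ 0 → (∀ F ∈ projIdeal W, eval y F = 0) →
      ∀ F ∈ projIdeal W, eval (c • y) F = 0 := by
    intro y c hc hy F hF
    rw [eval_smul_eq]
    refine hy _ (mem_projIdeal.2 fun z hz hzW => ?_)
    rw [← eval_smul_eq]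
    obtain ⟨h', hW'⟩ := smul_mem_affineCone ((mk_mem_iff hz).1 hzW) hc
    exact mem_projIdeal.1 hF _ h' hW'
  obtain ⟨a, ha⟩ := Projectivization.exists_smul_eq_mk_rep ℂ x h
  constructor
  · intro hP
    have := key _ ((a⁻¹ : ℂˣ) : ℂ) (Units.ne_zero _) hP
    rw [← ha] at this
    simpa [Units.smul_def] using this
  · intro hx F hF
    rw [← ha]
    exact key x a a.ne_zero hx F hF

theorem mem_affineCone_zariskiClosure {n : ℕ} {W : Set (ProjSpace n)} {x : Fin (n + 1) → ℂ}
    (h : x ≠ 0) : x ∈ affineCone (zariskiClosure W) ↔ ∀ F ∈ projIdeal W, eval x F = 0 := by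
  rw [← mk_mem_iff h, mk_mem_zariskiClosure]

/-- If the image is closed under scaling, the cone over it consists of the nonzero values. -/
theorem mem_affineCone_projImage {V : Type} {n : ℕ} {f : V → Fin (n + 1) → ℂ} {Y : Set V}
    (hY : ∀ v ∈ Y, ∀ c : ℂ, c ≠ 0 → ∃ w ∈ Y, f w = c • f v) {x : Fin (n + 1) → ℂ} :
    x ∈ affineCone (projImage f Y) ↔ x ≠ 0 ∧ ∃ v ∈ Y, f v = x := by
  constructor
  · rintro ⟨h, v, hv, hf, hP⟩
    obtain ⟨c, hc⟩ := (Projectivization.mk_eq_mk_iff' ℂ _ _ _ _).1 hP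
    have hc0 : c ≠ 0 := by
      rintro rfl
      exact h (by rw [← hc, zero_smul])
    obtain ⟨w, hw, hfw⟩ := hY v hv c hc0
    exact ⟨h, w, hw, hfw.trans hc⟩
  · rintro ⟨h, v, hv, rfl⟩
    exact ⟨h, v, hv, h, rfl⟩

theorem mem_projIdeal_projImage {V : Type} {n : ℕ} {f : V → Fin (n + 1) → ℂ} {Y : Set V}
    (hY : ∀ v ∈ Y, ∀ c : ℂ, c ≠ 0 → ∃ w ∈ Y, f w = c • f v)
    {F : MvPolynomial (Fin (n + 1)) ℂ} :
    F ∈ projIdeal (projImage f Y) ↔ ∀ v ∈ Y, f v ≠ 0 → eval (f v) F = 0 := by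
  rw [mem_projIdeal]
  constructor
  · intro hF v hv h
    exact hF _ h ⟨v, hv, h, rfl⟩
  · intro hF x h hx
    obtain ⟨_, v, hv, rfl⟩ := (mem_affineCone_projImage hY).1 ((mk_mem_iff h).1 hx)
    exact hF v hv h

/-- Generation by quadrics and cubics does not depend on the choice of linear coordinates. -/
theorem GeneratedByQuadricsAndCubics.comap {n : ℕ} {I : Ideal (MvPolynomial (Fin (n + 1)) ℂ)}
    (hI : GeneratedByQuadricsAndCubics I)
    (e e' : MvPolynomial (Fin (n + 1)) ℂ →ₐ[ℂ] MvPolynomial (Fin (n + 1)) ℂ)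
    (h₁ : ∀ F, e (e' F) = F) (h₂ : ∀ F, e' (e F) = F)
    (he' : ∀ i, (e' (X i)).IsHomogeneous 1) :
    GeneratedByQuadricsAndCubics (I.comap e) := by
  have hom : ∀ (F : MvPolynomial (Fin (n + 1)) ℂ) (d : ℕ), F.IsHomogeneous d →
      (e' F).IsHomogeneous d := by
    intro F d hF
    have := hF.aeval (fun i => e' (X i)) he'
    rw [one_mul] at this
    convert this using 1
    exact DFunLike.congr_fun (aeval_unique e') F
  refine le_antisymm ?_ (Ideal.span_le.2 fun F hF => hF.1)
  intro F hF
  have hF' : e F ∈ I := hF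
  rw [hI] at hF'
  have := Ideal.mem_map_of_mem e' hF'
  rw [h₂, Ideal.map_span] at this
  refine Ideal.span_mono ?_ this
  rintro _ ⟨G, ⟨hG, hd⟩, rfl⟩
  refine ⟨?_, hd.imp (hom _ _) (hom _ _)⟩
  rw [Ideal.mem_comap, h₁]
  exact hG

/-! ### Reduction of polynomials by rewriting rules -/

/-- The monomial which is the product of the variables in a list. -/
def listMonomial {n : ℕ} (l : List (Fin n)) : MvPolynomial (Fin n) ℂ := (l.map X).prod

/-- The exponent vector of the monomial which is the product of the variables in a list. -/
def listExponent {n : ℕ} (l : List (Fin n)) : Fin n →₀ ℕ :=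
  (l.map fun i => Finsupp.single i 1).sum

/-- A rewriting rule replaces a leading monomial by a linear combination of other monomials, the
tail. Monomials are encoded as lists of variables. -/
structure Rule (n : ℕ) where
  lead : List (Fin n)
  tail : List (ℂ × List (Fin n))

/-- The polynomial `lead - tail` of a rewriting rule. -/
def Rule.poly {n : ℕ} (ρ : Rule n) : MvPolynomial (Fin n) ℂ :=
  listMonomial ρ.lead - (ρ.tail.map fun t => C t.1 * listMonomial t.2).sum

theorem eval_listMonomial {n : ℕ} (x : Fin n → ℂ) (l : List (Fin n)) :
    eval x (listMonomial l) = (l.map x).prod := by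
  induction l with
  | nil => simp [listMonomial]
  | cons i l ih =>
    simp only [listMonomial, List.map_cons, List.prod_cons, map_mul, eval_X] at ih ⊢
    rw [ih]

theorem Rule.eval_poly {n : ℕ} (ρ : Rule n) (x : Fin n → ℂ) :
    eval x ρ.poly = (ρ.lead.map x).prod - (ρ.tail.map fun t => t.1 * (t.2.map x).prod).sum := by
  rw [Rule.poly, map_sub, eval_listMonomial, map_list_sum, List.map_map]
  congr 3
  funext t
  simp [eval_listMonomial]

theorem listMonomial_eq {n : ℕ} (l : List (Fin n)) :
    listMonomial l = monomial (listExponent l) 1 := by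
  induction l with
  | nil => simp [listMonomial, listExponent]
  | cons i l ih =>
    simp only [listMonomial, listExponent, List.map_cons, List.prod_cons, List.sum_cons] at ih ⊢
    rw [ih, X, monomial_mul, one_mul]

theorem listMonomial_isHomogeneous {n : ℕ} (l : List (Fin n)) :
    (listMonomial l).IsHomogeneous l.length := by
  induction l with
  | nil => simpa [listMonomial] using isHomogeneous_one (Fin n) ℂ
  | cons i l ih =>
    simp only [listMonomial, List.map_cons, List.prod_cons, List.length_cons] at ih ⊢
    rw [add_comm]
    exact (isHomogeneous_X ℂ i).mul ih

theorem Rule.poly_isHomogeneous {n : ℕ} (ρ : Rule n)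
    (h : ∀ t ∈ ρ.tail, t.2.length = ρ.lead.length) : ρ.poly.IsHomogeneous ρ.lead.length := by
  refine (listMonomial_isHomogeneous _).sub ?_
  have : ∀ L : List (ℂ × List (Fin n)), (∀ t ∈ L, t.2.length = ρ.lead.length) →
      ((L.map fun t => C t.1 * listMonomial t.2).sum : MvPolynomial (Fin n) ℂ).IsHomogeneous
        ρ.lead.length := by
    intro L
    induction L with
    | nil => intro _; simpa using isHomogeneous_zero _ _ _
    | cons t L ih =>
      intro hL
      simp only [List.map_cons, List.sum_cons]
      refine IsHomogeneous.add ?_ (ih fun s hs => hL s (List.mem_cons_of_mem _ hs))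
      have := (isHomogeneous_C (Fin n) t.1).mul (listMonomial_isHomogeneous t.2)
      rwa [zero_add, hL t List.mem_cons_self] at this
  exact this _ h

/-- An exponent vector is reduced if no leading monomial of a rule divides the monomial. -/
def Reduced {n : ℕ} (rules : List (Rule n)) (m : Fin n →₀ ℕ) : Prop :=
  ∀ ρ ∈ rules, ¬ listExponent ρ.lead ≤ m

theorem weight_listExponent {n : ℕ} (wt : Fin n → ℕ) (l : List (Fin n)) :
    Finsupp.weight wt (listExponent l) = (l.map wt).sum := by
  induction l with
  | nil => simp [listExponent]
  | cons i l ih =>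
    simp only [listExponent, List.map_cons, List.sum_cons, map_add] at ih ⊢
    rw [ih, Finsupp.weight_single]
    simp

/-- If all rules decrease a weight, every polynomial is congruent to a combination of reduced
monomials modulo the polynomials of the rules. -/
theorem exists_reduced {n : ℕ} (rules : List (Rule n)) (wt : Fin n → ℕ)
    (hwt : ∀ ρ ∈ rules, ∀ t ∈ ρ.tail, (t.2.map wt).sum < (ρ.lead.map wt).sum)
    (I : Ideal (MvPolynomial (Fin n) ℂ)) (hI : ∀ ρ ∈ rules, ρ.poly ∈ I)
    (F : MvPolynomial (Fin n) ℂ) :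
    ∃ G, F - G ∈ I ∧ ∀ m ∈ G.support, Reduced rules m := by
  set V : Submodule ℂ (MvPolynomial (Fin n) ℂ) :=
    I.restrictScalars ℂ ⊔ restrictSupport ℂ {m | Reduced rules m} with hV
  have hmono : ∀ (k : ℕ) (m : Fin n →₀ ℕ), Finsupp.weight wt m = k → ∀ c, monomial m c ∈ V := by
    intro k
    induction k using Nat.strong_induction_on with
    | _ k ih =>
      intro m hm c
      by_cases hred : Reduced rules m
      · refine Submodule.mem_sup_right ?_
        rw [mem_restrictSupport_iff]
        intro m' hm'
        rw [Finset.mem_coe, mem_support_iff, coeff_monomial] at hm'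
        have : m = m' := by
          by_contra hne
          simp [hne] at hm'
        exact this ▸ hred
      · simp only [Reduced, not_forall, not_not] at hred
        obtain ⟨ρ, hρ, hle⟩ := hred
        obtain ⟨m₁, rfl⟩ := exists_add_of_le hle
        have e1 : monomial (listExponent ρ.lead + m₁) c =
            monomial m₁ c * ρ.poly
              + (ρ.tail.map fun t => monomial (m₁ + listExponent t.2) (c * t.1)).sum := by
          have e2 : (ρ.tail.map fun t => monomial (m₁ + listExponent t.2) (c * t.1)).sum
              = monomial m₁ c * (ρ.tail.map fun t => C t.1 * listMonomial t.2).sum := by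
            rw [← List.sum_map_mul_left]
            congr 1
            refine List.map_congr_left fun t _ => ?_
            rw [listMonomial_eq, C_mul_monomial, monomial_mul, mul_one]
          rw [e2, Rule.poly, listMonomial_eq, mul_sub, sub_add_cancel, monomial_mul, mul_one,
            add_comm]
        rw [e1]
        refine add_mem (Submodule.mem_sup_left ?_) ?_
        · exact I.mul_mem_left _ (hI ρ hρ)
        · refine list_sum_mem ?_
          intro x hx
          obtain ⟨t, ht, rfl⟩ := List.mem_map.1 hx
          refine ih _ ?_ _ rfl _
          rw [← hm, map_add, map_add, weight_listExponent, weight_listExponent]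
          have := hwt ρ hρ t ht
          omega
  have hF : F ∈ V := by
    rw [F.as_sum]
    exact sum_mem fun m _ => hmono _ m rfl _
  obtain ⟨A, hA, G, hG, rfl⟩ := Submodule.mem_sup.1 hF
  refine ⟨G, ?_, fun m hm => ?_⟩
  · rw [add_sub_cancel_right]
    exact hA
  · exact (mem_restrictSupport_iff ℂ).1 hG (Finset.mem_coe.2 hm)

/-- A criterion for an ideal to be the span of the polynomials of a family of rewriting rules: the
ideal contains them, and it contains no nonzero combination of reduced monomials. -/
theorem eq_span_rules {n : ℕ} (rules : List (Rule n)) (wt : Fin n → ℕ)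
    (hwt : ∀ ρ ∈ rules, ∀ t ∈ ρ.tail, (t.2.map wt).sum < (ρ.lead.map wt).sum)
    (I : Ideal (MvPolynomial (Fin n) ℂ)) (hI : ∀ ρ ∈ rules, ρ.poly ∈ I)
    (hred : ∀ G ∈ I, (∀ m ∈ G.support, Reduced rules m) → G = 0) :
    I = Ideal.span {F | ∃ ρ ∈ rules, F = ρ.poly} := by
  refine le_antisymm (fun F hF => ?_) (Ideal.span_le.2 ?_)
  · obtain ⟨G, hFG, hG⟩ := exists_reduced rules wt hwt (Ideal.span {F | ∃ ρ ∈ rules, F = ρ.poly})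
      (fun ρ hρ => Ideal.subset_span ⟨ρ, hρ, rfl⟩) F
    have hle : Ideal.span {F | ∃ ρ ∈ rules, F = ρ.poly} ≤ I := by
      refine Ideal.span_le.2 ?_
      rintro _ ⟨ρ, hρ, rfl⟩
      exact hI ρ hρ
    have hGI : G ∈ I := by
      have := I.sub_mem hF (hle hFG)
      rwa [sub_sub_cancel] at this
    rw [hred G hGI hG, sub_zero] at hFG
    exact hFG
  · rintro _ ⟨ρ, hρ, rfl⟩
    exact hI ρ hρ

theorem generatedByQuadricsAndCubics_of_eq_span_rules {n : ℕ} {rules : List (Rule (n + 1))}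
    {I : Ideal (MvPolynomial (Fin (n + 1)) ℂ)}
    (hI : I = Ideal.span {F | ∃ ρ ∈ rules, F = ρ.poly})
    (hdeg : ∀ ρ ∈ rules, ∀ t ∈ ρ.tail, t.2.length = ρ.lead.length)
    (hdeg' : ∀ ρ ∈ rules, ρ.lead.length = 2 ∨ ρ.lead.length = 3) :
    GeneratedByQuadricsAndCubics I := by
  refine le_antisymm ?_ (Ideal.span_le.2 fun F hF => hF.1)
  conv_lhs => rw [hI]
  refine Ideal.span_mono ?_
  rintro _ ⟨ρ, hρ, rfl⟩
  refine ⟨hI ▸ Ideal.subset_span ⟨ρ, hρ, rfl⟩, ?_⟩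
  have := ρ.poly_isHomogeneous (hdeg ρ hρ)
  rcases hdeg' ρ hρ with h | h
  · exact Or.inl (h ▸ this)
  · exact Or.inr (h ▸ this)

/-- A reduced monomial has some exponent which is too small for division by a leading monomial. -/
theorem Reduced.exists_lt {n : ℕ} {rules : List (Rule n)} {m : Fin n →₀ ℕ}
    (h : Reduced rules m) {ρ : Rule n} (hρ : ρ ∈ rules) : ∃ i, m i < ρ.lead.count i := by
  have := h ρ hρ
  simp only [Finsupp.le_def, not_forall, not_le] at this
  obtain ⟨i, hi⟩ := this
  refine ⟨i, lt_of_lt_of_eq hi ?_⟩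
  have key : ∀ l : List (Fin n), listExponent l i = l.count i := by
    intro l
    induction l with
    | nil => simp [listExponent]
    | cons j l ih =>
      simp only [listExponent, List.map_cons, List.sum_cons, Finsupp.add_apply] at ih ⊢
      rw [ih, List.count_cons, Finsupp.single_apply, add_comm]
      simp
  exact key _

/-! ### Krull dimension and integral extensions -/

/-- An integral extension has the same Krull dimension, by lying over, going up and
incomparability. -/
theorem ringKrullDim_eq_of_isIntegral {R S : Type*} [CommRing R] [CommRing S] [Algebra R S]
    [Algebra.IsIntegral R S] (hinj : Function.Injective (algebraMap R S)) :
    ringKrullDim S = ringKrullDim R := by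
  refine le_antisymm ?_ ?_
  · refine Order.krullDim_le_of_strictMono (PrimeSpectrum.comap (algebraMap R S)) ?_
    intro I J hIJ
    have := I.isPrime
    exact Ideal.IsIntegral.comap_lt_comap (R := R) (I := I.asIdeal) (J := J.asIdeal) hIJ
  · have key : ∀ l : LTSeries (PrimeSpectrum R), ∃ l' : LTSeries (PrimeSpectrum S),
        l'.length = l.length ∧ PrimeSpectrum.comap (algebraMap R S) l'.last = l.last := by
      intro l
      induction l using RelSeries.inductionOn' with
      | singleton p =>
        obtain ⟨Q, hQ, hQp⟩ := Ideal.exists_ideal_over_prime_of_isIntegral (S := S) p.asIdeal ⊥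
          (by
            intro x hx
            have : x = 0 := hinj (by simpa using hx)
            rw [this]
            exact zero_mem _)
        refine ⟨RelSeries.singleton _ ⟨Q, hQp.1⟩, rfl, ?_⟩
        ext1
        exact hQp.2
      | snoc l p hlp ih =>
        obtain ⟨l', hlen, hlast⟩ := ih
        have hlt : l.last < p := hlp
        have := l'.last.isPrime
        obtain ⟨Q, hQ, hQp⟩ := Ideal.exists_ideal_over_prime_of_isIntegral (S := S) p.asIdeal
          l'.last.asIdeal (by
            have h2 : l.last.asIdeal ≤ p.asIdeal := hlt.le
            rw [← hlast] at h2
            exact h2)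
        have hcomap : PrimeSpectrum.comap (algebraMap R S) ⟨Q, hQp.1⟩ = p := by
          ext1
          exact hQp.2
        refine ⟨l'.snoc ⟨Q, hQp.1⟩ ?_, ?_, ?_⟩
        · refine lt_of_le_of_ne hQ ?_
          intro heq
          have heq' : l'.last = ⟨Q, hQp.1⟩ := PrimeSpectrum.ext heq
          rw [heq', hcomap] at hlast
          exact hlt.ne hlast.symm
        · simp [hlen]
        · simpa using hcomap
    refine iSup_le fun l => ?_
    obtain ⟨l', hlen, _⟩ := key l
    rw [← hlen]
    exact Order.LTSeries.length_le_krullDim l'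

/-! ### The threefold of genus 8 in normal coordinates -/

/-- The quadratic form which corresponds to `R` on the Segre quadric: with `x₀ = s u`, `x₁ = t v`,
`x₂ = s v`, `x₃ = t u` it is `ℓ₀ x₀² + ℓ₁ x₁² + ℓ₂ x₂² + ℓ₃ x₃² + ℓ₄ x₀ x₁`. -/
def segreForm (ℓ : Fin 5 → ℂ) (p : Fin 4 → ℂ) : ℂ :=
  ℓ 0 * (p 0 * p 2) ^ 2 + ℓ 1 * (p 1 * p 3) ^ 2 + ℓ 2 * (p 0 * p 3) ^ 2 + ℓ 3 * (p 1 * p 2) ^ 2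
    + ℓ 4 * (p 0 * p 1 * p 2 * p 3)

/-- The parametrization of the threefold of genus 8 in coordinates in which `Q = x₀ x₁ - x₂ x₃`;
the variables `p` parametrize the quadric, and `y` is the coordinate `x₄`. -/
def normalMap (ℓ : Fin 5 → ℂ) (p : Fin 4 → ℂ) (y : ℂ) : Fin 9 → ℂ :=
  ![p 0 * p 2 * (y ^ 2 + segreForm ℓ p), p 1 * p 3 * (y ^ 2 + segreForm ℓ p),
    p 0 * p 3 * (y ^ 2 - segreForm ℓ p), p 1 * p 2 * (y ^ 2 - segreForm ℓ p),
    y * (p 0 * p 2) ^ 2, y * (p 1 * p 3) ^ 2, y * (p 0 * p 3) ^ 2, y * (p 1 * p 2) ^ 2,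
    y * (p 0 * p 1 * p 2 * p 3)]

/-- The rewriting rules for the ideal of the threefold of genus 8, whose variables `0, …, 8` stand
for the coordinates of `normalMap`. Up to the terms with factor `4`
these are the relations between the leading terms in `y` of the coordinates of `normalMap`, and
these leading terms are monomials. -/
def rules8 (ℓ : Fin 5 → ℂ) : List (Rule 9) :=
  [⟨[0, 1], [(1, [2, 3]), (4 * ℓ 0, [8, 4]), (4 * ℓ 1, [8, 5]), (4 * ℓ 2, [8, 6]),
      (4 * ℓ 3, [8, 7]), (4 * ℓ 4, [8, 8])]⟩,
    ⟨[0, 5], [(1, [1, 8])]⟩,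
    ⟨[1, 4], [(1, [0, 8])]⟩,
    ⟨[2, 7], [(1, [3, 8])]⟩,
    ⟨[3, 6], [(1, [2, 8])]⟩,
    ⟨[4, 5], [(1, [8, 8])]⟩,
    ⟨[6, 7], [(1, [8, 8])]⟩,
    ⟨[0, 0, 6], [(1, [2, 2, 4]), (4 * ℓ 0, [4, 6, 4]), (4 * ℓ 1, [4, 6, 5]), (4 * ℓ 2, [4, 6, 6]),
      (4 * ℓ 3, [4, 6, 7]), (4 * ℓ 4, [4, 6, 8])]⟩,
    ⟨[0, 0, 7], [(1, [3, 3, 4]), (4 * ℓ 0, [4, 7, 4]), (4 * ℓ 1, [4, 7, 5]), (4 * ℓ 2, [4, 7, 6]),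
      (4 * ℓ 3, [4, 7, 7]), (4 * ℓ 4, [4, 7, 8])]⟩,
    ⟨[0, 0, 8], [(1, [2, 3, 4]), (4 * ℓ 0, [4, 8, 4]), (4 * ℓ 1, [4, 8, 5]), (4 * ℓ 2, [4, 8, 6]),
      (4 * ℓ 3, [4, 8, 7]), (4 * ℓ 4, [4, 8, 8])]⟩,
    ⟨[1, 1, 8], [(1, [2, 3, 5]), (4 * ℓ 0, [5, 8, 4]), (4 * ℓ 1, [5, 8, 5]), (4 * ℓ 2, [5, 8, 6]),
      (4 * ℓ 3, [5, 8, 7]), (4 * ℓ 4, [5, 8, 8])]⟩,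
    ⟨[1, 1, 6], [(1, [2, 2, 5]), (4 * ℓ 0, [5, 6, 4]), (4 * ℓ 1, [5, 6, 5]), (4 * ℓ 2, [5, 6, 6]),
      (4 * ℓ 3, [5, 6, 7]), (4 * ℓ 4, [5, 6, 8])]⟩,
    ⟨[1, 1, 7], [(1, [3, 3, 5]), (4 * ℓ 0, [5, 7, 4]), (4 * ℓ 1, [5, 7, 5]), (4 * ℓ 2, [5, 7, 6]),
      (4 * ℓ 3, [5, 7, 7]), (4 * ℓ 4, [5, 7, 8])]⟩]

/-- A weight which is decreased by the rules for genus 8; any such weight would do. -/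
def weight8 : Fin 9 → ℕ := ![90, 88, 80, 86, 50, 43, 46, 51, 40]

theorem rules8_weight (ℓ : Fin 5 → ℂ) : ∀ ρ ∈ rules8 ℓ, ∀ t ∈ ρ.tail,
    (t.2.map weight8).sum < (ρ.lead.map weight8).sum := by
  simp only [rules8, List.forall_mem_cons]
  simp [weight8]

theorem rules8_length (ℓ : Fin 5 → ℂ) : ∀ ρ ∈ rules8 ℓ, ∀ t ∈ ρ.tail,
    t.2.length = ρ.lead.length := by
  simp only [rules8, List.forall_mem_cons]
  simp

theorem rules8_length' (ℓ : Fin 5 → ℂ) : ∀ ρ ∈ rules8 ℓ,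
    ρ.lead.length = 2 ∨ ρ.lead.length = 3 := by
  simp [rules8]

theorem eval_rules8 (ℓ : Fin 5 → ℂ) (p : Fin 4 → ℂ) (y : ℂ) :
    ∀ ρ ∈ rules8 ℓ, eval (normalMap ℓ p y) ρ.poly = 0 := by
  simp only [Rule.eval_poly]
  simp [rules8, normalMap, segreForm]
  refine ⟨?_, ?_, ?_, ?_, ?_, ?_, ?_, ?_, ?_, ?_, ?_, ?_, ?_⟩ <;> ring

/-- The exponents of the variables `p` in the leading terms in `y` of the coordinates of
`normalMap`. -/
def leadExponent8 : Fin 9 → Fin 4 → ℕ :=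
  ![![1, 0, 1, 0], ![0, 1, 0, 1], ![1, 0, 0, 1], ![0, 1, 1, 0],
    ![2, 0, 2, 0], ![0, 2, 0, 2], ![2, 0, 0, 2], ![0, 2, 2, 0], ![1, 1, 1, 1]]

/-- The degrees in `y` of the coordinates of `normalMap`. -/
def leadDegree8 : Fin 9 → ℕ := ![2, 2, 2, 2, 1, 1, 1, 1, 1]

theorem reduced8_signs (x₀ x₁ a b : ℕ) (h₀ : x₀ = 0 ∨ x₁ = 0) (h₁ : x₀ = 0 ∨ b = 0)
    (h₂ : x₁ = 0 ∨ a = 0) (h₃ : a = 0 ∨ b = 0) : (x₁ = 0 ∧ b = 0) ∨ (x₀ = 0 ∧ a = 0) := by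
  omega

theorem reduced8_signs' (p q c d p' q' c' d' : ℕ) (h₁ : p = 0 ∨ d = 0) (h₂ : q = 0 ∨ c = 0)
    (h₃ : c = 0 ∨ d = 0) (g₁ : p' = 0 ∨ d' = 0) (g₂ : q' = 0 ∨ c' = 0) (g₃ : c' = 0 ∨ d' = 0)
    (e : p + 2 * c + q' + 2 * d' = p' + 2 * c' + q + 2 * d) :
    d = 0 ∧ d' = 0 ∨ c = 0 ∧ c' = 0 := by
  rcases h₃ with rfl | rfl <;> rcases g₃ with rfl | rfl <;> omega

theorem reduced8_unique_of_signs (x p q a c w y p' q' a' c' w' : ℕ) (h₁ : q = 0 ∨ c = 0)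
    (h₂ : x ≤ 1 ∨ c = 0) (h₃ : x ≤ 1 ∨ w = 0) (g₁ : q' = 0 ∨ c' = 0) (g₂ : y ≤ 1 ∨ c' = 0)
    (g₃ : y ≤ 1 ∨ w' = 0) (e₁ : x + 2 * a = y + 2 * a')
    (e₂ : p + 2 * c + q' = p' + 2 * c' + q) (e₃ : x + p + q = y + p' + q')
    (e₄ : a + c + w = a' + c' + w') :
    x = y ∧ p = p' ∧ q = q' ∧ a = a' ∧ c = c' ∧ w = w' := by
  have : x = y := by
    clear h₁ g₁ e₂ e₃
    omega
  have : c = c' := by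
    clear h₂ h₃ g₂ g₃
    omega
  omega

/-- The exponents of a reduced monomial can be recovered from the exponents of its leading
monomial: the differences of the exponents of the variables `p` in a pair show which one of the two
complementary coordinates can occur, and the remaining exponents are found by parity. -/
theorem reduced8_unique
    (x0 x1 x2 x3 a b c d w y0 y1 y2 y3 a' b' c' d' w' : ℕ)
    (h : (x0 = 0 ∨ x1 = 0) ∧ (x0 = 0 ∨ b = 0) ∧ (x1 = 0 ∨ a = 0) ∧ (x2 = 0 ∨ d = 0) ∧
      (x3 = 0 ∨ c = 0) ∧ (a = 0 ∨ b = 0) ∧ (c = 0 ∨ d = 0) ∧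
      (x0 ≤ 1 ∨ c = 0) ∧ (x0 ≤ 1 ∨ d = 0) ∧ (x0 ≤ 1 ∨ w = 0) ∧
      (x1 ≤ 1 ∨ w = 0) ∧ (x1 ≤ 1 ∨ c = 0) ∧ (x1 ≤ 1 ∨ d = 0))
    (h' : (y0 = 0 ∨ y1 = 0) ∧ (y0 = 0 ∨ b' = 0) ∧ (y1 = 0 ∨ a' = 0) ∧ (y2 = 0 ∨ d' = 0) ∧
      (y3 = 0 ∨ c' = 0) ∧ (a' = 0 ∨ b' = 0) ∧ (c' = 0 ∨ d' = 0) ∧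
      (y0 ≤ 1 ∨ c' = 0) ∧ (y0 ≤ 1 ∨ d' = 0) ∧ (y0 ≤ 1 ∨ w' = 0) ∧
      (y1 ≤ 1 ∨ w' = 0) ∧ (y1 ≤ 1 ∨ c' = 0) ∧ (y1 ≤ 1 ∨ d' = 0))
    (e1 : 2 * x0 + 2 * x1 + 2 * x2 + 2 * x3 + a + b + c + d + w =
      2 * y0 + 2 * y1 + 2 * y2 + 2 * y3 + a' + b' + c' + d' + w')
    (e2 : x0 + x2 + 2 * a + 2 * c + w = y0 + y2 + 2 * a' + 2 * c' + w')
    (e3 : x1 + x3 + 2 * b + 2 * d + w = y1 + y3 + 2 * b' + 2 * d' + w')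
    (e4 : x0 + x3 + 2 * a + 2 * d + w = y0 + y3 + 2 * a' + 2 * d' + w') :
    x0 = y0 ∧ x1 = y1 ∧ x2 = y2 ∧ x3 = y3 ∧ a = a' ∧ b = b' ∧ c = c' ∧ d = d' ∧ w = w' := by
  obtain ⟨h1, h2, h3, h4, h5, h6, h7, h8, h9, h10, h11, h12, h13⟩ := h
  obtain ⟨g1, g2, g3, g4, g5, g6, g7, g8, g9, g10, g11, g12, g13⟩ := h'
  have f1 : x0 + 2 * a + y1 + 2 * b' = y0 + 2 * a' + x1 + 2 * b := by omega
  have f2 : x2 + 2 * c + y3 + 2 * d' = y2 + 2 * c' + x3 + 2 * d := by omega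
  have f3 : x0 + x1 + x2 + x3 = y0 + y1 + y2 + y3 := by omega
  have f4 : a + b + c + d + w = a' + b' + c' + d' + w' := by omega
  clear e1 e2 e3 e4
  have s1 : (x1 = 0 ∧ b = 0) ∧ (y1 = 0 ∧ b' = 0) ∨ (x0 = 0 ∧ a = 0) ∧ (y0 = 0 ∧ a' = 0) := by
    have := reduced8_signs x0 x1 a b h1 h2 h3 h6
    have := reduced8_signs y0 y1 a' b' g1 g2 g3 g6
    clear h1 h2 h3 h4 h5 h6 h7 h8 h9 h10 h11 h12 h13
    clear g1 g2 g3 g4 g5 g6 g7 g8 g9 g10 g11 g12 g13 f2 f3 f4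
    omega
  have s2 : d = 0 ∧ d' = 0 ∨ c = 0 ∧ c' = 0 :=
    reduced8_signs' _ _ _ _ _ _ _ _ h4 h5 h7 g4 g5 g7 f2
  rcases s1 with ⟨⟨rfl, rfl⟩, rfl, rfl⟩ | ⟨⟨rfl, rfl⟩, rfl, rfl⟩ <;>
    rcases s2 with ⟨rfl, rfl⟩ | ⟨rfl, rfl⟩
  · obtain ⟨k1, k2, k3, k4, k5, k6⟩ := reduced8_unique_of_signs x0 x2 x3 a c w y0 y2 y3 a' c' w'
      h5 h8 h10 g5 g8 g10 (by omega) (by omega) (by omega) (by omega)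
    exact ⟨k1, rfl, k2, k3, k4, rfl, k5, rfl, k6⟩
  · obtain ⟨k1, k2, k3, k4, k5, k6⟩ := reduced8_unique_of_signs x0 x3 x2 a d w y0 y3 y2 a' d' w'
      h4 h9 h10 g4 g9 g10 (by omega) (by omega) (by omega) (by omega)
    exact ⟨k1, rfl, k3, k2, k4, rfl, rfl, k5, k6⟩
  · obtain ⟨k1, k2, k3, k4, k5, k6⟩ := reduced8_unique_of_signs x1 x2 x3 b c w y1 y2 y3 b' c' w'
      h5 h12 h11 g5 g12 g11 (by omega) (by omega) (by omega) (by omega)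
    exact ⟨rfl, k1, k2, k3, rfl, k4, k5, rfl, k6⟩
  · obtain ⟨k1, k2, k3, k4, k5, k6⟩ := reduced8_unique_of_signs x1 x3 x2 b d w y1 y3 y2 b' d' w'
      h4 h13 h11 g4 g13 g11 (by omega) (by omega) (by omega) (by omega)
    exact ⟨rfl, k1, k3, k2, rfl, k4, rfl, k5, k6⟩

/-- The leading monomials of reduced monomials are distinct. -/
theorem reduced8_injective (ℓ : Fin 5 → ℂ) {m m' : Fin 9 →₀ ℕ} (hm : Reduced (rules8 ℓ) m)
    (hm' : Reduced (rules8 ℓ) m') (hd : ∑ i, m i * leadDegree8 i = ∑ i, m' i * leadDegree8 i)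
    (he : ∀ j, ∑ i, m i * leadExponent8 i j = ∑ i, m' i * leadExponent8 i j) : m = m' := by
  have red : ∀ {m : Fin 9 →₀ ℕ}, Reduced (rules8 ℓ) m →
      (m 0 = 0 ∨ m 1 = 0) ∧ (m 0 = 0 ∨ m 5 = 0) ∧ (m 1 = 0 ∨ m 4 = 0) ∧ (m 2 = 0 ∨ m 7 = 0) ∧
      (m 3 = 0 ∨ m 6 = 0) ∧ (m 4 = 0 ∨ m 5 = 0) ∧ (m 6 = 0 ∨ m 7 = 0) ∧
      (m 0 ≤ 1 ∨ m 6 = 0) ∧ (m 0 ≤ 1 ∨ m 7 = 0) ∧ (m 0 ≤ 1 ∨ m 8 = 0) ∧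
      (m 1 ≤ 1 ∨ m 8 = 0) ∧ (m 1 ≤ 1 ∨ m 6 = 0) ∧ (m 1 ≤ 1 ∨ m 7 = 0) := by
    intro m hm
    have h : ∀ ρ ∈ rules8 ℓ, ∃ i, m i < ρ.lead.count i := fun ρ hρ => hm.exists_lt hρ
    simp only [rules8, List.forall_mem_cons, Fin.exists_fin_succ] at h
    simp [List.count_cons] at h
    refine ⟨?_, ?_, ?_, ?_, ?_, ?_, ?_, ?_, ?_, ?_, ?_, ?_, ?_⟩ <;> omega
  have h := red hm
  have h' := red hm'
  have e0 := he 0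
  have e1 := he 1
  have e2 := he 2
  simp [Fin.sum_univ_succ, leadExponent8, leadDegree8] at hd e0 e1 e2
  have key := reduced8_unique _ _ _ _ _ _ _ _ _ _ _ _ _ _ _ _ _ _ h h' (by omega) (by omega)
    (by omega) (by omega)
  obtain ⟨k0, k1, k2, k3, k4, k5, k6, k7, k8⟩ := key
  ext i
  fin_cases i <;> assumption

/-- The polynomial which induces `segreForm`. -/
def segrePoly (ℓ : Fin 5 → ℂ) : MvPolynomial (Fin 4) ℂ :=
  C (ℓ 0) * (X 0 * X 2) ^ 2 + C (ℓ 1) * (X 1 * X 3) ^ 2 + C (ℓ 2) * (X 0 * X 3) ^ 2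
    + C (ℓ 3) * (X 1 * X 2) ^ 2 + C (ℓ 4) * (X 0 * X 1 * X 2 * X 3)

/-- The coordinates of `normalMap` are the products of a monomial in the variables `p` and of one
of these monic polynomials in `y`. -/
def normalFactor (ℓ : Fin 5 → ℂ) : Fin 9 → Polynomial (MvPolynomial (Fin 4) ℂ) :=
  ![Polynomial.X ^ 2 + Polynomial.C (segrePoly ℓ), Polynomial.X ^ 2 + Polynomial.C (segrePoly ℓ),
    Polynomial.X ^ 2 - Polynomial.C (segrePoly ℓ), Polynomial.X ^ 2 - Polynomial.C (segrePoly ℓ),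
    Polynomial.X, Polynomial.X, Polynomial.X, Polynomial.X, Polynomial.X]

/-- The homomorphism of coordinate rings defined by `normalMap`. -/
def normalHom (ℓ : Fin 5 → ℂ) :
    MvPolynomial (Fin 9) ℂ →ₐ[ℂ] Polynomial (MvPolynomial (Fin 4) ℂ) :=
  aeval fun i => Polynomial.C (∏ j, X j ^ leadExponent8 i j) * normalFactor ℓ i

theorem eval_normalHom (ℓ : Fin 5 → ℂ) (p : Fin 4 → ℂ) (y : ℂ) (F : MvPolynomial (Fin 9) ℂ) :
    Polynomial.eval y ((normalHom ℓ F).map (eval p)) = eval (normalMap ℓ p y) F := by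
  have h : ((Polynomial.evalRingHom y).comp ((Polynomial.mapRingHom (eval p)).comp
      (normalHom ℓ).toRingHom)) = eval (normalMap ℓ p y) := by
    refine MvPolynomial.ringHom_ext (fun c => ?_) (fun i => ?_)
    · simp only [AlgHom.toRingHom_eq_coe, RingHom.comp_apply, RingHom.coe_coe, algHom_C, eval_C]
      simp [Polynomial.algebraMap_apply, algebraMap_eq]
    · simp only [AlgHom.toRingHom_eq_coe, RingHom.comp_apply, RingHom.coe_coe, eval_X, normalHom,
        aeval_X]
      fin_cases i <;>
        simp [normalMap, normalFactor, leadExponent8, segreForm, segrePoly, Fin.prod_univ_succ] <;>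
        ring
  exact DFunLike.congr_fun h F

/-- A polynomial which vanishes at the nonzero values of the parametrization is in the kernel; the
factor `X 4` takes care of the zero vector, at which the polynomial need not vanish. -/
theorem normalHom_eq_zero {ℓ : Fin 5 → ℂ} {F : MvPolynomial (Fin 9) ℂ}
    (hF : ∀ p y, normalMap ℓ p y ≠ 0 → eval (normalMap ℓ p y) F = 0) : normalHom ℓ F = 0 := by
  have key : ∀ G : MvPolynomial (Fin 9) ℂ, (∀ p y, eval (normalMap ℓ p y) G = 0) →
      normalHom ℓ G = 0 := by
    intro G hG
    ext1 k
    refine MvPolynomial.funext fun p => ?_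
    have : (normalHom ℓ G).map (eval p) = 0 := by
      refine Polynomial.funext fun y => ?_
      rw [eval_normalHom, hG, Polynomial.eval_zero]
    rw [← Polynomial.coeff_map, this]
    simp
  have h : normalHom ℓ (F * X 4) = 0 := by
    refine key _ fun p y => ?_
    by_cases h0 : normalMap ℓ p y = 0
    · simp [h0]
    · rw [map_mul, hF p y h0, zero_mul]
  rw [map_mul, mul_eq_zero] at h
  refine h.resolve_right ?_
  simp only [normalHom, aeval_X]
  refine mul_ne_zero ?_ (Polynomial.X_ne_zero)
  rw [Ne, Polynomial.C_eq_zero, Finset.prod_eq_zero_iff]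
  rintro ⟨j, _, hj⟩
  exact pow_ne_zero _ (X_ne_zero j) hj

theorem natDegree_normalFactor (ℓ : Fin 5 → ℂ) (i : Fin 9) :
    (normalFactor ℓ i).natDegree ≤ leadDegree8 i ∧
      (normalFactor ℓ i).coeff (leadDegree8 i) = 1 := by
  fin_cases i <;>
    simp [normalFactor, leadDegree8, Polynomial.natDegree_sub_C]

theorem coeff_prod_sum_of_natDegree_le {R ι : Type*} [CommSemiring R] (s : Finset ι)
    (f : ι → Polynomial R) (d : ι → ℕ) (h : ∀ i ∈ s, (f i).natDegree ≤ d i) :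
    (∏ i ∈ s, f i).coeff (∑ i ∈ s, d i) = ∏ i ∈ s, (f i).coeff (d i) := by
  classical
  induction s using Finset.induction_on with
  | empty => simp
  | insert a s ha ih =>
    have h' : ∀ i ∈ s, (f i).natDegree ≤ d i := fun i hi => h i (Finset.mem_insert_of_mem hi)
    rw [Finset.prod_insert ha, Finset.sum_insert ha, Finset.prod_insert ha,
      Polynomial.coeff_mul_add_eq_of_natDegree_le (h a (Finset.mem_insert_self a s))
        ((Polynomial.natDegree_prod_le _ _).trans (Finset.sum_le_sum h')), ih h']

/-- The leading term in `y` of the image of a monomial is a monomial. -/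
theorem normalHom_monomial (ℓ : Fin 5 → ℂ) (m : Fin 9 →₀ ℕ) :
    (normalHom ℓ (monomial m 1)).natDegree ≤ ∑ i, m i * leadDegree8 i ∧
      (normalHom ℓ (monomial m 1)).coeff (∑ i, m i * leadDegree8 i) =
        ∏ j, X j ^ (∑ i, m i * leadExponent8 i j) := by
  have hb : ∀ i, (Polynomial.C (∏ j, X j ^ leadExponent8 i j : MvPolynomial (Fin 4) ℂ) *
      normalFactor ℓ i).natDegree ≤ leadDegree8 i := fun i =>
    (Polynomial.natDegree_C_mul_le _ _).trans (natDegree_normalFactor ℓ i).1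
  have e : normalHom ℓ (monomial m 1) = ∏ i, (Polynomial.C (∏ j, X j ^ leadExponent8 i j) *
      normalFactor ℓ i) ^ m i := by
    rw [normalHom, aeval_monomial, map_one, one_mul, Finsupp.prod_fintype]
    simp
  rw [e]
  constructor
  · refine (Polynomial.natDegree_prod_le _ _).trans (Finset.sum_le_sum fun i _ => ?_)
    exact Polynomial.natDegree_pow_le_of_le _ (hb i)
  · rw [coeff_prod_sum_of_natDegree_le]
    · simp_rw [Polynomial.coeff_pow_of_natDegree_le (hb _), Polynomial.coeff_C_mul,
        (natDegree_normalFactor ℓ _).2, mul_one, ← Finset.prod_pow, ← pow_mul]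
      rw [Finset.prod_comm]
      refine Finset.prod_congr rfl fun j _ => ?_
      rw [Finset.prod_pow_eq_pow_sum]
      simp_rw [mul_comm]
    · exact fun i _ => Polynomial.natDegree_pow_le_of_le _ (hb i)

/-- The kernel contains no nonzero combination of reduced monomials, because the leading monomials
of their images are distinct. -/
theorem eq_zero_of_normalHom_eq_zero {ℓ : Fin 5 → ℂ} {G : MvPolynomial (Fin 9) ℂ}
    (hred : ∀ m ∈ G.support, Reduced (rules8 ℓ) m) (hG : normalHom ℓ G = 0) : G = 0 := by
  by_contra hne
  obtain ⟨m₀, hm₀, hmax⟩ := G.support.exists_max_image (fun m => ∑ i, m i * leadDegree8 i)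
    (support_nonempty.2 hne)
  -- The coefficient of the leading monomial of `m₀` in the image of `G` is that of `m₀` in `G`.
  have h1 : ∑ m ∈ G.support, C (coeff m G) *
      (normalHom ℓ (monomial m 1)).coeff (∑ i, m₀ i * leadDegree8 i) = 0 := by
    have : normalHom ℓ G =
        ∑ m ∈ G.support, Polynomial.C (C (coeff m G)) * normalHom ℓ (monomial m 1) := by
      conv_lhs => rw [G.as_sum, map_sum]
      refine Finset.sum_congr rfl fun m _ => ?_
      rw [← mul_one (coeff m G), ← C_mul_monomial, map_mul, mul_one]
      congr 1
      rw [algHom_C]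
      rfl
    rw [hG] at this
    have h2 := congrArg (fun H => H.coeff (∑ i, m₀ i * leadDegree8 i)) this.symm
    simpa [Polynomial.finsetSum_coeff] using h2
  have h3 := congrArg (coeff (Finsupp.equivFunOnFinite.symm
    fun j => ∑ i, m₀ i * leadExponent8 i j)) h1
  have hmon : ∀ f : Fin 4 → ℕ, (∏ j, X j ^ f j : MvPolynomial (Fin 4) ℂ) =
      monomial (Finsupp.equivFunOnFinite.symm f) 1 := by
    intro f
    rw [monomial_eq, C_1, one_mul, Finsupp.prod_fintype _ _ (by simp)]
    rfl
  rw [coeff_sum, Finset.sum_eq_single m₀] at h3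
  · rw [coeff_C_mul, (normalHom_monomial ℓ m₀).2, hmon, coeff_monomial, if_pos rfl, mul_one,
      coeff_zero] at h3
    exact mem_support_iff.1 hm₀ h3
  · intro m hm hmne
    rw [coeff_C_mul]
    rcases (hmax m hm).lt_or_eq with hlt | heq
    · rw [Polynomial.coeff_eq_zero_of_natDegree_lt
        (lt_of_le_of_lt (normalHom_monomial ℓ m).1 hlt), coeff_zero, mul_zero]
    · rw [← heq, (normalHom_monomial ℓ m).2, hmon, coeff_monomial, if_neg, mul_zero]
      intro he
      refine hmne (reduced8_injective ℓ (hred m hm) (hred m₀ hm₀) heq fun j => ?_)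
      exact DFunLike.congr_fun he j
  · exact fun h => absurd hm₀ h

theorem generated_normal8 (ℓ : Fin 5 → ℂ) (J : Ideal (MvPolynomial (Fin 9) ℂ))
    (hJ : ∀ F, F ∈ J ↔ ∀ p y, normalMap ℓ p y ≠ 0 → eval (normalMap ℓ p y) F = 0) :
    GeneratedByQuadricsAndCubics (n := 8) J :=
  generatedByQuadricsAndCubics_of_eq_span_rules
    (eq_span_rules (rules8 ℓ) weight8 (rules8_weight ℓ) J
      (fun ρ hρ => (hJ _).2 fun p y _ => eval_rules8 ℓ p y ρ hρ)
      (fun G hG hred => eq_zero_of_normalHom_eq_zero hred (normalHom_eq_zero ((hJ G).1 hG))))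
    (rules8_length ℓ) (rules8_length' ℓ)

/-! ### Linear substitutions -/

/-- The homomorphism of polynomial rings which corresponds to a linear map of affine spaces. -/
def substLin {n m : ℕ} (A : (Fin n → ℂ) →ₗ[ℂ] (Fin m → ℂ)) :
    MvPolynomial (Fin m) ℂ →ₐ[ℂ] MvPolynomial (Fin n) ℂ :=
  aeval fun i => ∑ j, C (A (Pi.single j 1) i) * X j

theorem eval_substLin {n m : ℕ} (A : (Fin n → ℂ) →ₗ[ℂ] (Fin m → ℂ)) (x : Fin n → ℂ)
    (F : MvPolynomial (Fin m) ℂ) : eval x (substLin A F) = eval (A x) F := by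
  rw [← MvPolynomial.coe_aeval_eq_eval, ← MvPolynomial.coe_aeval_eq_eval, RingHom.coe_coe,
    RingHom.coe_coe, substLin, comp_aeval_apply]
  congr 2
  funext i
  conv_rhs => rw [LinearMap.pi_apply_eq_sum_univ A x]
  simp only [map_sum, map_mul, aeval_C, aeval_X, Finset.sum_apply, Pi.smul_apply, smul_eq_mul,
    Algebra.algebraMap_self, RingHom.id_apply]
  refine Finset.sum_congr rfl fun j _ => ?_
  rw [mul_comm]
  have : (Pi.single j 1 : Fin n → ℂ) = fun k => if j = k then 1 else 0 := by
    funext k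
    simp [Pi.single_apply, eq_comm]
  rw [this]

theorem substLin_comp {n m k : ℕ} (A : (Fin n → ℂ) →ₗ[ℂ] (Fin m → ℂ))
    (B : (Fin k → ℂ) →ₗ[ℂ] (Fin n → ℂ)) (F : MvPolynomial (Fin m) ℂ) :
    substLin B (substLin A F) = substLin (A ∘ₗ B) F := by
  refine MvPolynomial.funext fun x => ?_
  rw [eval_substLin, eval_substLin, eval_substLin, LinearMap.comp_apply]

theorem substLin_id {n : ℕ} (F : MvPolynomial (Fin n) ℂ) :
    substLin LinearMap.id F = F := by
  refine MvPolynomial.funext fun x => ?_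
  rw [eval_substLin, LinearMap.id_apply]

theorem substLin_X_isHomogeneous {n m : ℕ} (A : (Fin n → ℂ) →ₗ[ℂ] (Fin m → ℂ)) (i : Fin m) :
    (substLin A (X i)).IsHomogeneous 1 := by
  rw [substLin, aeval_X]
  refine IsHomogeneous.sum _ _ _ fun j _ => ?_
  have := (isHomogeneous_C (Fin n) (A (Pi.single j 1) i)).mul (isHomogeneous_X ℂ j)
  rwa [zero_add] at this

/-! ### Reduction of genus 8 to normal coordinates -/

/-- A nondegenerate binary quadratic form is the product of two coordinates; the coordinate change
and its inverse have matrices `m` and `k`. -/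
theorem exists_binary_factorization {a b c : ℂ} (h : c ^ 2 - 4 * a * b ≠ 0) :
    ∃ m₀₀ m₀₁ m₁₀ m₁₁ k₀₀ k₀₁ k₁₀ k₁₁ : ℂ,
      (k₀₀ * m₀₀ + k₀₁ * m₁₀ = 1 ∧ k₀₀ * m₀₁ + k₀₁ * m₁₁ = 0 ∧ k₁₀ * m₀₀ + k₁₁ * m₁₀ = 0 ∧
        k₁₀ * m₀₁ + k₁₁ * m₁₁ = 1) ∧
      (m₀₀ * k₀₀ + m₀₁ * k₁₀ = 1 ∧ m₀₀ * k₀₁ + m₀₁ * k₁₁ = 0 ∧ m₁₀ * k₀₀ + m₁₁ * k₁₀ = 0 ∧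
        m₁₀ * k₀₁ + m₁₁ * k₁₁ = 1) ∧
      (a * m₀₀ ^ 2 + b * m₁₀ ^ 2 + c * (m₀₀ * m₁₀) = 0 ∧
        a * m₀₁ ^ 2 + b * m₁₁ ^ 2 + c * (m₀₁ * m₁₁) = 0 ∧
        2 * a * m₀₀ * m₀₁ + 2 * b * m₁₀ * m₁₁ + c * (m₀₀ * m₁₁ + m₀₁ * m₁₀) = 1) := by
  -- It is enough to factor the form into independent linear forms.
  suffices H : ∃ k₀₀ k₀₁ k₁₀ k₁₁ : ℂ, k₀₀ * k₁₁ - k₀₁ * k₁₀ ≠ 0 ∧ a = k₀₀ * k₁₀ ∧ b = k₀₁ * k₁₁ ∧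
      c = k₀₀ * k₁₁ + k₀₁ * k₁₀ by
    obtain ⟨k₀₀, k₀₁, k₁₀, k₁₁, hd, rfl, rfl, rfl⟩ := H
    set d := k₀₀ * k₁₁ - k₀₁ * k₁₀ with hd'
    refine ⟨k₁₁ / d, -k₀₁ / d, -k₁₀ / d, k₀₀ / d, k₀₀, k₀₁, k₁₀, k₁₁, ⟨?_, ?_, ?_, ?_⟩,
      ⟨?_, ?_, ?_, ?_⟩, ?_, ?_, ?_⟩ <;> field_simp <;> rw [hd'] <;> ring
  by_cases ha : a = 0
  · subst ha
    refine ⟨0, 1, c, b, ?_, by ring, by ring, by ring⟩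
    intro h0
    refine h ?_
    linear_combination (-c) * h0
  · obtain ⟨d, hd⟩ := IsAlgClosed.exists_pow_nat_eq (c ^ 2 - 4 * a * b) (n := 2) (by norm_num)
    have hd0 : d ≠ 0 := by
      rintro rfl
      exact h (by rw [← hd]; ring)
    refine ⟨a, (c - d) / 2, 1, (c + d) / (2 * a), ?_, by ring, ?_, ?_⟩
    · field_simp
      ring_nf
      exact hd0
    · field_simp
      linear_combination hd
    · field_simp
      ring

theorem BlockQuadric.eval_poly (q : BlockQuadric) (x : Fin 4 → ℂ) : eval x q.poly =
    q.c00 * x 0 ^ 2 + q.c11 * x 1 ^ 2 + q.c22 * x 2 ^ 2 + q.c33 * x 3 ^ 2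
      + q.c01 * (x 0 * x 1) + q.c23 * (x 2 * x 3) := by
  simp [BlockQuadric.poly]

theorem exists_binary_kernel {a b c : ℂ} (h : c ^ 2 - 4 * a * b = 0) :
    ∃ x y : ℂ, (x ≠ 0 ∨ y ≠ 0) ∧ 2 * a * x + c * y = 0 ∧ c * x + 2 * b * y = 0 := by
  by_cases hc : c = 0 ∧ a = 0
  · obtain ⟨rfl, rfl⟩ := hc
    exact ⟨1, 0, Or.inl one_ne_zero, by ring, by ring⟩
  · refine ⟨c, -(2 * a), ?_, by ring, by linear_combination h⟩
    by_contra hcon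
    push Not at hcon
    exact hc ⟨hcon.1, by simpa using hcon.2⟩

/-- A common zero of the derivatives of a binary form with zero discriminant would be a singular
point of the quadric. -/
theorem BlockQuadric.Smooth.discr_ne_zero {q : BlockQuadric} (h : q.Smooth) :
    q.c01 ^ 2 - 4 * q.c00 * q.c11 ≠ 0 ∧ q.c23 ^ 2 - 4 * q.c22 * q.c33 ≠ 0 := by
  constructor
  · intro h0
    obtain ⟨x, y, hxy, h1, h2⟩ := exists_binary_kernel h0
    have := h ![x, y, 0, 0] (by
      intro i
      fin_cases i
      · simp [BlockQuadric.poly, pderiv_X]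
        linear_combination h1
      · simp [BlockQuadric.poly, pderiv_X]
        linear_combination h2
      · simp [BlockQuadric.poly, pderiv_X]
      · simp [BlockQuadric.poly, pderiv_X])
    rcases hxy with hx | hy
    · exact hx (congrFun this 0)
    · exact hy (congrFun this 1)
  · intro h0
    obtain ⟨x, y, hxy, h1, h2⟩ := exists_binary_kernel h0
    have := h ![0, 0, x, y] (by
      intro i
      fin_cases i
      · simp [BlockQuadric.poly, pderiv_X]
      · simp [BlockQuadric.poly, pderiv_X]
      · simp [BlockQuadric.poly, pderiv_X]
        linear_combination h1
      · simp [BlockQuadric.poly, pderiv_X]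
        linear_combination h2)
    rcases hxy with hx | hy
    · exact hx (congrFun this 2)
    · exact hy (congrFun this 3)

/-- The Segre parametrization of a smooth quadric surface is surjective on the affine cone. -/
theorem exists_segre {x₀ x₁ x₂ x₃ : ℂ} (h : x₀ * x₁ = x₂ * x₃) :
    ∃ p : Fin 4 → ℂ, p 0 * p 2 = x₀ ∧ p 1 * p 3 = x₁ ∧ p 0 * p 3 = x₂ ∧ p 1 * p 2 = x₃ := by
  by_cases h0 : x₀ = 0
  · subst h0
    rcases mul_eq_zero.1 (h.symm.trans (zero_mul _)) with rfl | rfl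
    · exact ⟨![0, 1, x₃, x₁], by simp⟩
    · exact ⟨![x₂, x₁, 0, 1], by simp⟩
  · refine ⟨![x₀, x₃, 1, x₂ / x₀], by simp, ?_, ?_, by simp⟩
    · simp
      field_simp
      linear_combination -h
    · simp
      field_simp

/-- The symmetric square of an invertible matrix is injective. -/
theorem eq_zero_of_symmetricSquare_eq_zero {m₀₀ m₀₁ m₁₀ m₁₁ k₀₀ k₀₁ k₁₀ k₁₁ : ℂ} (u v w : ℂ)
    (a1 : k₀₀ * m₀₀ + k₀₁ * m₁₀ = 1) (a2 : k₀₀ * m₀₁ + k₀₁ * m₁₁ = 0)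
    (a3 : k₁₀ * m₀₀ + k₁₁ * m₁₀ = 0) (a4 : k₁₀ * m₀₁ + k₁₁ * m₁₁ = 1)
    (s1 : m₀₀ ^ 2 * u + m₀₁ ^ 2 * v + 2 * m₀₀ * m₀₁ * w = 0)
    (s2 : m₁₀ ^ 2 * u + m₁₁ ^ 2 * v + 2 * m₁₀ * m₁₁ * w = 0)
    (s3 : m₀₀ * m₁₀ * u + m₀₁ * m₁₁ * v + (m₀₀ * m₁₁ + m₀₁ * m₁₀) * w = 0) :
    u = 0 ∧ v = 0 ∧ w = 0 := by
  have t1 : (k₀₀ * m₀₀ + k₀₁ * m₁₀) ^ 2 * u + (k₀₀ * m₀₁ + k₀₁ * m₁₁) ^ 2 * v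
      + 2 * (k₀₀ * m₀₀ + k₀₁ * m₁₀) * (k₀₀ * m₀₁ + k₀₁ * m₁₁) * w = 0 := by
    linear_combination k₀₀ ^ 2 * s1 + k₀₁ ^ 2 * s2 + 2 * k₀₀ * k₀₁ * s3
  have t2 : (k₁₀ * m₀₀ + k₁₁ * m₁₀) ^ 2 * u + (k₁₀ * m₀₁ + k₁₁ * m₁₁) ^ 2 * v
      + 2 * (k₁₀ * m₀₀ + k₁₁ * m₁₀) * (k₁₀ * m₀₁ + k₁₁ * m₁₁) * w = 0 := by
    linear_combination k₁₀ ^ 2 * s1 + k₁₁ ^ 2 * s2 + 2 * k₁₀ * k₁₁ * s3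
  have t3 : (k₀₀ * m₀₀ + k₀₁ * m₁₀) * (k₁₀ * m₀₀ + k₁₁ * m₁₀) * u
      + (k₀₀ * m₀₁ + k₀₁ * m₁₁) * (k₁₀ * m₀₁ + k₁₁ * m₁₁) * v
      + ((k₀₀ * m₀₀ + k₀₁ * m₁₀) * (k₁₀ * m₀₁ + k₁₁ * m₁₁)
        + (k₀₀ * m₀₁ + k₀₁ * m₁₁) * (k₁₀ * m₀₀ + k₁₁ * m₁₀)) * w = 0 := by
    linear_combination k₀₀ * k₁₀ * s1 + k₀₁ * k₁₁ * s2 + (k₀₀ * k₁₁ + k₀₁ * k₁₀) * s3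
  rw [a1, a2] at t1
  rw [a3, a4] at t2
  rw [a1, a2, a3, a4] at t3
  exact ⟨by linear_combination t1, by linear_combination t2, by linear_combination t3⟩

set_option maxHeartbeats 1000000 in
/-- In suitable linear coordinates of the hyperplane `H₈` the image of the cone is parametrized by
`normalMap`. -/
theorem exists_normal_coordinates (q r : BlockQuadric) (hq : q.Smooth) :
    ∃ (ℓ : Fin 5 → ℂ) (L : (Fin 9 → ℂ) →ₗ[ℂ] (Fin 10 → ℂ)), Function.Injective L ∧
      (∀ z, hyperplaneForm q (L z) = 0) ∧
      (∀ p y, ∃ x : Fin 5 → ℂ, eval (firstFour x) q.poly = 0 ∧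
        phi8 r x = L (normalMap ℓ p y)) ∧
      (∀ x : Fin 5 → ℂ, eval (firstFour x) q.poly = 0 →
        ∃ p y, phi8 r x = L (normalMap ℓ p y)) := by
  obtain ⟨h1, h2⟩ := hq.discr_ne_zero
  obtain ⟨m₀₀, m₀₁, m₁₀, m₁₁, k₀₀, k₀₁, k₁₀, k₁₁, ⟨a1, a2, a3, a4⟩, ⟨b1, b2, b3, b4⟩,
    c1, c2, c3⟩ := exists_binary_factorization h1
  -- On `x₂, x₃` the form `-Q` is factored, so that `Q` becomes `x₀ x₁ - x₂ x₃`.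
  obtain ⟨n₀₀, n₀₁, n₁₀, n₁₁, l₀₀, l₀₁, l₁₀, l₁₁, ⟨d1, d2, d3, d4⟩, ⟨e1, e2, e3, e4⟩,
    f1, f2, f3⟩ := exists_binary_factorization (a := -q.c22) (b := -q.c33) (c := -q.c23)
      (fun h => h2 (by linear_combination h))
  set L : (Fin 9 → ℂ) →ₗ[ℂ] (Fin 10 → ℂ) :=
    { toFun := fun z => ![m₀₀ * z 0 + m₀₁ * z 1, m₁₀ * z 0 + m₁₁ * z 1,
        n₀₀ * z 2 + n₀₁ * z 3, n₁₀ * z 2 + n₁₁ * z 3,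
        m₀₀ ^ 2 * z 4 + m₀₁ ^ 2 * z 5 + 2 * m₀₀ * m₀₁ * z 8,
        m₁₀ ^ 2 * z 4 + m₁₁ ^ 2 * z 5 + 2 * m₁₀ * m₁₁ * z 8,
        n₀₀ ^ 2 * z 6 + n₀₁ ^ 2 * z 7 + 2 * n₀₀ * n₀₁ * z 8,
        n₁₀ ^ 2 * z 6 + n₁₁ ^ 2 * z 7 + 2 * n₁₀ * n₁₁ * z 8,
        m₀₀ * m₁₀ * z 4 + m₀₁ * m₁₁ * z 5 + (m₀₀ * m₁₁ + m₀₁ * m₁₀) * z 8,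
        n₀₀ * n₁₀ * z 6 + n₀₁ * n₁₁ * z 7 + (n₀₀ * n₁₁ + n₀₁ * n₁₀) * z 8]
      map_add' := by
        intro a b
        ext i
        fin_cases i <;> simp <;> ring
      map_smul' := by
        intro a b
        ext i
        fin_cases i <;> simp <;> ring } with hL
  set ℓ : Fin 5 → ℂ := ![r.c00 * m₀₀ ^ 2 + r.c11 * m₁₀ ^ 2 + r.c01 * (m₀₀ * m₁₀),
    r.c00 * m₀₁ ^ 2 + r.c11 * m₁₁ ^ 2 + r.c01 * (m₀₁ * m₁₁),
    r.c22 * n₀₀ ^ 2 + r.c33 * n₁₀ ^ 2 + r.c23 * (n₀₀ * n₁₀),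
    r.c22 * n₀₁ ^ 2 + r.c33 * n₁₁ ^ 2 + r.c23 * (n₀₁ * n₁₁),
    2 * r.c00 * m₀₀ * m₀₁ + 2 * r.c11 * m₁₀ * m₁₁ + r.c01 * (m₀₀ * m₁₁ + m₀₁ * m₁₀)
      + (2 * r.c22 * n₀₀ * n₀₁ + 2 * r.c33 * n₁₀ * n₁₁ + r.c23 * (n₀₀ * n₁₁ + n₀₁ * n₁₀))]
    with hℓ
  set x : (Fin 4 → ℂ) → ℂ → Fin 5 → ℂ := fun p y =>
    ![m₀₀ * (p 0 * p 2) + m₀₁ * (p 1 * p 3), m₁₀ * (p 0 * p 2) + m₁₁ * (p 1 * p 3),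
      n₀₀ * (p 0 * p 3) + n₀₁ * (p 1 * p 2), n₁₀ * (p 0 * p 3) + n₁₁ * (p 1 * p 2), y] with hx
  have hR : ∀ p y, eval (firstFour (x p y)) r.poly = segreForm ℓ p := by
    intro p y
    rw [BlockQuadric.eval_poly]
    simp [firstFour, hx, segreForm, hℓ]
    ring
  have hphi : ∀ p y, phi8 r (x p y) = L (normalMap ℓ p y) := by
    intro p y
    simp only [phi8, hR]
    simp only [hL, LinearMap.coe_mk, AddHom.coe_mk]
    ext i
    fin_cases i <;> simp [hx, normalMap] <;> ring
  refine ⟨ℓ, L, ?_, ?_, ?_, ?_⟩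
  · rw [injective_iff_map_eq_zero]
    intro z hz
    have g : ∀ i, L z i = 0 := fun i => congrFun hz i
    have g0 := g 0
    have g1 := g 1
    have g2 := g 2
    have g3 := g 3
    have g4 := g 4
    have g5 := g 5
    have g6 := g 6
    have g7 := g 7
    have g8 := g 8
    have g9 := g 9
    simp [hL] at g0 g1 g2 g3 g4 g5 g6 g7 g8 g9
    obtain ⟨z4, z5, z8⟩ := eq_zero_of_symmetricSquare_eq_zero (z 4) (z 5) (z 8) a1 a2 a3 a4 g4 g5 g8
    obtain ⟨z6, z7, -⟩ := eq_zero_of_symmetricSquare_eq_zero (z 6) (z 7) (z 8) d1 d2 d3 d4 g6 g7 g9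
    have z0 : z 0 = 0 := by linear_combination k₀₀ * g0 + k₀₁ * g1 - z 0 * a1 - z 1 * a2
    have z1 : z 1 = 0 := by linear_combination k₁₀ * g0 + k₁₁ * g1 - z 0 * a3 - z 1 * a4
    have z2 : z 2 = 0 := by linear_combination l₀₀ * g2 + l₀₁ * g3 - z 2 * d1 - z 3 * d2
    have z3 : z 3 = 0 := by linear_combination l₁₀ * g2 + l₁₁ * g3 - z 2 * d3 - z 3 * d4
    ext i
    fin_cases i <;> assumption
  · intro z
    simp [hyperplaneForm, hL]
    linear_combination z 4 * c1 + z 5 * c2 + z 8 * c3 - z 6 * f1 - z 7 * f2 - z 8 * f3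
  · intro p y
    refine ⟨x p y, ?_, hphi p y⟩
    rw [BlockQuadric.eval_poly]
    simp [firstFour, hx]
    linear_combination (p 0 * p 2) ^ 2 * c1 + (p 1 * p 3) ^ 2 * c2
      + (p 0 * p 1 * p 2 * p 3) * c3 - (p 0 * p 3) ^ 2 * f1 - (p 1 * p 2) ^ 2 * f2
      - (p 0 * p 1 * p 2 * p 3) * f3
  · intro v hv
    rw [BlockQuadric.eval_poly] at hv
    simp [firstFour] at hv
    have v0 : v 0 = m₀₀ * (k₀₀ * v 0 + k₀₁ * v 1) + m₀₁ * (k₁₀ * v 0 + k₁₁ * v 1) := by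
      linear_combination -(v 0 * b1) - v 1 * b2
    have v1 : v 1 = m₁₀ * (k₀₀ * v 0 + k₀₁ * v 1) + m₁₁ * (k₁₀ * v 0 + k₁₁ * v 1) := by
      linear_combination -(v 0 * b3) - v 1 * b4
    have v2 : v 2 = n₀₀ * (l₀₀ * v 2 + l₀₁ * v 3) + n₀₁ * (l₁₀ * v 2 + l₁₁ * v 3) := by
      linear_combination -(v 2 * e1) - v 3 * e2
    have v3 : v 3 = n₁₀ * (l₀₀ * v 2 + l₀₁ * v 3) + n₁₁ * (l₁₀ * v 2 + l₁₁ * v 3) := by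
      linear_combination -(v 2 * e3) - v 3 * e4
    generalize k₀₀ * v 0 + k₀₁ * v 1 = w0 at v0 v1
    generalize k₁₀ * v 0 + k₁₁ * v 1 = w1 at v0 v1
    generalize l₀₀ * v 2 + l₀₁ * v 3 = w2 at v2 v3
    generalize l₁₀ * v 2 + l₁₁ * v 3 = w3 at v2 v3
    obtain ⟨p, p0, p1, p2, p3⟩ : ∃ p : Fin 4 → ℂ, p 0 * p 2 = w0 ∧ p 1 * p 3 = w1 ∧
        p 0 * p 3 = w2 ∧ p 1 * p 2 = w3 := by
      refine exists_segre ?_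
      have e : (Fin.castSucc 2 : Fin 5) = 2 := rfl
      rw [v0, v1, v2, v3] at hv
      linear_combination hv - w0 ^ 2 * c1 - w1 ^ 2 * c2 - w0 * w1 * c3 + w2 ^ 2 * f1
        + w3 ^ 2 * f2 + w2 * w3 * f3
    refine ⟨p, v 4, ?_⟩
    rw [← hphi]
    congr 1
    ext i
    fin_cases i
    · simpa [hx, p0, p1] using v0
    · simpa [hx, p0, p1] using v1
    · simpa [hx, p2, p3] using v2
    · simpa [hx, p2, p3] using v3
    · simp [hx]

theorem phi8_zero (r : BlockQuadric) (x : Fin 5 → ℂ) (hx : phi8 r x ≠ 0) : x ≠ 0 := by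
  rintro rfl
  refine hx ?_
  ext i
  fin_cases i <;> simp [phi8]

theorem phi8_smul (r : BlockQuadric) (x : Fin 5 → ℂ) (c : ℂ) :
    phi8 r (c • x) = c ^ 3 • phi8 r x := by
  have : eval (firstFour (c • x)) r.poly = c ^ 2 * eval (firstFour x) r.poly := by
    rw [BlockQuadric.eval_poly, BlockQuadric.eval_poly]
    simp [firstFour]
    ring
  simp only [phi8, this]
  ext i
  fin_cases i <;> simp <;> ring

theorem quadricCone_smul (q r : BlockQuadric) : ∀ v ∈ quadricCone q, ∀ c : ℂ, c ≠ 0 →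
    ∃ w ∈ quadricCone q, phi8 r w = c • phi8 r v := by
  rintro v ⟨hv, hq⟩ c hc
  obtain ⟨d, rfl⟩ := IsAlgClosed.exists_pow_nat_eq c (n := 3) (by norm_num)
  have hd : d ≠ 0 := by
    rintro rfl
    exact hc (by norm_num)
  refine ⟨d • v, ⟨smul_ne_zero hd hv, ?_⟩, phi8_smul r v d⟩
  have : eval (firstFour (d • v)) q.poly = d ^ 2 * eval (firstFour v) q.poly := by
    rw [BlockQuadric.eval_poly, BlockQuadric.eval_poly]
    simp [firstFour]
    ring
  rw [this, hq, mul_zero]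

/-- The threefold of genus 8 is the image of `normalMap` up to a linear coordinate change of `ℙ⁸`.
-/
theorem generated_W8 (q r : BlockQuadric) (hq : q.Smooth)
    (ι : (Fin 9 → ℂ) →ₗ[ℂ] (Fin 10 → ℂ)) (hι : Function.Injective ι)
    (hrange : ∀ Z, Z ∈ LinearMap.range ι ↔ hyperplaneForm q Z = 0) :
    GeneratedByQuadricsAndCubics (projIdeal (W8 q r ι hι)) := by
  obtain ⟨ℓ, L, hL, hLH, hsurj, hparam⟩ := exists_normal_coordinates q r hq
  obtain ⟨ρ, hρ⟩ := ι.exists_leftInverse_of_injective (LinearMap.ker_eq_bot.2 hι)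
  have hιρ : ∀ z, ι (ρ (L z)) = L z := by
    intro z
    obtain ⟨w, hw⟩ := (hrange (L z)).2 (hLH z)
    rw [← hw]
    congr 1
    exact LinearMap.congr_fun hρ w
  -- The coordinate change of `ℙ⁸` between the given and the normal coordinates.
  have hg : Function.Injective (ρ ∘ₗ L) := by
    intro a b hab
    refine hL ?_
    rw [← hιρ, ← hιρ b]
    exact congrArg ι hab
  set g : (Fin 9 → ℂ) ≃ₗ[ℂ] (Fin 9 → ℂ) := LinearEquiv.ofInjectiveEndo (ρ ∘ₗ L) hg with hgdef
  have hgL : ∀ z, g z = ρ (L z) := fun z => rfl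
  set J : Ideal (MvPolynomial (Fin 9) ℂ) :=
    vanishingIdeal ℂ {z | z ≠ 0 ∧ ∃ p y, z = normalMap ℓ p y} with hJ
  have hJ' : ∀ F, F ∈ J ↔ ∀ p y, normalMap ℓ p y ≠ 0 → eval (normalMap ℓ p y) F = 0 := by
    intro F
    rw [hJ, mem_vanishingIdeal_iff]
    constructor
    · exact fun h p y h0 => h _ ⟨h0, p, y, rfl⟩
    · rintro h _ ⟨h0, p, y, rfl⟩
      exact h p y h0
  have hcomap : projIdeal (W8 q r ι hι) = J.comap (substLin (g : (Fin 9 → ℂ) →ₗ[ℂ] _)) := by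
    ext F
    rw [Ideal.mem_comap, hJ', mem_projIdeal]
    simp only [eval_substLin, LinearEquiv.coe_coe]
    constructor
    · intro hF p y h0
      have hg0 : g (normalMap ℓ p y) ≠ 0 := by simpa using h0
      refine hF _ hg0 ?_
      obtain ⟨x, hx, hphi⟩ := hsurj p y
      have hmem : ι (g (normalMap ℓ p y)) = phi8 r x := by rw [hgL, hιρ, hphi]
      have hphi0 : phi8 r x ≠ 0 := by
        rw [hphi]
        exact fun h => h0 (hL (by rw [h, map_zero]))
      have key : phi8 r x ∈ affineCone (W8InP9 q r) := by
        refine (mem_affineCone_zariskiClosure hphi0).2 fun G hG => ?_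
        exact (mem_projIdeal_projImage (quadricCone_smul q r)).1 hG x
          ⟨phi8_zero r x hphi0, hx⟩ hphi0
      rw [← hmem] at key
      obtain ⟨h', hW⟩ := key
      change Projectivization.map ι hι (Projectivization.mk ℂ _ hg0) ∈ W8InP9 q r
      rw [Projectivization.map_mk]
      exact hW
    · intro hF z hz hzW
      change Projectivization.map ι hι (Projectivization.mk ℂ _ hz) ∈ W8InP9 q r at hzW
      rw [Projectivization.map_mk] at hzW
      have h1 := (mk_mem_zariskiClosure _).1 hzW (substLin ρ F) (by
        refine (mem_projIdeal_projImage (quadricCone_smul q r)).2 fun x hx hx0 => ?_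
        rw [eval_substLin]
        obtain ⟨p, y, hpy⟩ := hparam x hx.2
        rw [hpy, ← hgL]
        refine hF p y fun h0 => hx0 ?_
        rw [hpy, h0, map_zero])
      rw [eval_substLin] at h1
      have h2 : ρ (ι z) = z := LinearMap.congr_fun hρ z
      rwa [h2] at h1
  rw [hcomap]
  refine GeneratedByQuadricsAndCubics.comap (n := 8) (generated_normal8 ℓ J hJ') _
    (substLin (g.symm : (Fin 9 → ℂ) →ₗ[ℂ] _)) ?_ ?_ (substLin_X_isHomogeneous _)
  · intro F
    rw [substLin_comp]
    convert substLin_id F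
    ext z
    simp
  · intro F
    rw [substLin_comp]
    convert substLin_id F
    ext z
    simp

/-! ### The sextic Del Pezzo surface -/

/-- The nine quadratic equations of the sextic Del Pezzo surface. In the cyclic order
`x₀, x₁, x₃, x₂, x₄, x₅` the first six variables form a hexagon with center `x₆`: the product of
two opposite vertices is the square of the center, and the product of two vertices at distance two
is the product of the vertex between them and the center. -/
structure DelPezzoEqs (x : Fin 7 → ℂ) : Prop where
  e02 : x 0 * x 2 = x 6 ^ 2
  e14 : x 1 * x 4 = x 6 ^ 2
  e35 : x 3 * x 5 = x 6 ^ 2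
  e03 : x 0 * x 3 = x 1 * x 6
  e12 : x 1 * x 2 = x 3 * x 6
  e34 : x 3 * x 4 = x 2 * x 6
  e25 : x 2 * x 5 = x 4 * x 6
  e40 : x 4 * x 0 = x 5 * x 6
  e51 : x 5 * x 1 = x 0 * x 6

theorem cubicMap_smul (u : Fin 3 → ℂ) (c : ℂ) : cubicMap (c • u) = c ^ 3 • cubicMap u := by
  ext i
  fin_cases i <;> simp [cubicMap] <;> ring

theorem cubicMap_univ_smul : ∀ v ∈ (Set.univ : Set (Fin 3 → ℂ)), ∀ c : ℂ, c ≠ 0 →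
    ∃ w ∈ (Set.univ : Set (Fin 3 → ℂ)), cubicMap w = c • cubicMap v := by
  intro v _ c _
  obtain ⟨d, rfl⟩ := IsAlgClosed.exists_pow_nat_eq c (n := 3) (by norm_num)
  exact ⟨d • v, trivial, cubicMap_smul v d⟩

theorem delPezzoEqs_of_mem {x : Fin 7 → ℂ} (hx : x ∈ affineCone delPezzo6) : DelPezzoEqs x := by
  have hx0 : x ≠ 0 := hx.1
  have h := (mem_affineCone_zariskiClosure hx0).1 hx
  have key : ∀ i j k l : Fin 7, (∀ u, cubicMap u i * cubicMap u j = cubicMap u k * cubicMap u l) →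
      x i * x j = x k * x l := by
    intro i j k l hu
    have := h (X i * X j - X k * X l) ((mem_projIdeal_projImage cubicMap_univ_smul).2
      fun u _ _ => by simp [hu])
    simpa [sub_eq_zero] using this
  constructor
  · rw [sq]
    exact key _ _ _ _ fun u => by simp [cubicMap]; ring
  · rw [sq]
    exact key _ _ _ _ fun u => by simp [cubicMap]; ring
  · rw [sq]
    exact key _ _ _ _ fun u => by simp [cubicMap]; ring
  all_goals exact key _ _ _ _ fun u => by simp [cubicMap]; ring

/-- A solution of the equations in the torus `x₆ ≠ 0` lies in the image of the plane. -/
theorem DelPezzoEqs.exists_cubicMap {x : Fin 7 → ℂ} (h : DelPezzoEqs x) (h6 : x 6 ≠ 0) :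
    ∃ u, cubicMap u = x := by
  obtain ⟨d, hd⟩ := IsAlgClosed.exists_pow_nat_eq (x 6 ^ 3 / (x 0 * x 1)) (n := 3) (by norm_num)
  have h0 : x 0 ≠ 0 := fun h0 => h6 (by simpa [h0] using h.e02.symm)
  have h1 : x 1 ≠ 0 := fun h1 => h6 (by simpa [h1] using h.e14.symm)
  have h2 : x 2 = x 6 ^ 2 / x 0 := by
    field_simp
    linear_combination h.e02
  have h4 : x 4 = x 6 ^ 2 / x 1 := by
    field_simp
    linear_combination h.e14
  have h3 : x 3 = x 1 * x 6 / x 0 := by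
    field_simp
    linear_combination h.e03
  have h5 : x 5 = x 0 * x 6 / x 1 := by
    field_simp
    linear_combination h.e51
  refine ⟨d • ![1, x 0 / x 6, x 1 / x 6], ?_⟩
  rw [cubicMap_smul, hd]
  ext i
  fin_cases i
  · simp [cubicMap]
    field_simp
  · simp [cubicMap]
    field_simp
  · simp [cubicMap, h2]
    field_simp
  · simp [cubicMap, h3]
    field_simp
  · simp [cubicMap, h4]
    field_simp
  · simp [cubicMap, h5]
    field_simp
  · simp [cubicMap]
    field_simp

/-- The rotation of the hexagon. -/
def hexagonRotation : Fin 7 → Fin 7 := ![1, 3, 4, 2, 5, 0, 6]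

/-- The inverse rotation of the hexagon. -/
def hexagonRotationInv : Fin 7 → Fin 7 := ![5, 0, 3, 1, 2, 4, 6]

theorem DelPezzoEqs.rotate {x : Fin 7 → ℂ} (h : DelPezzoEqs x) :
    DelPezzoEqs (x ∘ hexagonRotation) := by
  obtain ⟨e02, e14, e35, e03, e12, e34, e25, e40, e51⟩ := h
  exact ⟨e14, e35, (mul_comm _ _).trans e02, e12, e34, e25, e40, e51, e03⟩

/-- Every point lies, up to a rotation of the hexagon, in the chart at the first vertex. -/
theorem DelPezzoEqs.exists_vertex {x : Fin 7 → ℂ} (h : DelPezzoEqs x) (hx : x ≠ 0) :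
    ∃ k : Fin 6, (x ∘ hexagonRotation^[k]) 0 ≠ 0 := by
  by_contra hcon
  push Not at hcon
  refine hx ?_
  have h6 : x 6 = 0 := by
    have := h.e02
    rw [show x 0 = 0 from hcon 0, zero_mul] at this
    exact pow_eq_zero_iff (two_ne_zero) |>.1 this.symm
  ext i
  fin_cases i
  exacts [hcon 0, hcon 1, hcon 3, hcon 2, hcon 4, hcon 5, h6]

/-- A polynomial which vanishes on the torus part of the Del Pezzo surface vanishes on the charts
at the vertices of the hexagon. -/
theorem DelPezzoEqs.eval_eq_zero_of_vertex {x : Fin 7 → ℂ} (h : DelPezzoEqs x) (h0 : x 0 ≠ 0)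
    {F : MvPolynomial (Fin 7) ℂ} (hF : ∀ z, DelPezzoEqs z → z 6 ≠ 0 → eval z F = 0) :
    eval x F = 0 := by
  -- A curve through `x` on the surface which meets the torus.
  set f : ℂ → Fin 7 → ℂ := fun ε =>
    ![x 0, x 1 + ε, (x 1 + ε) ^ 2 * (x 5 + ε) ^ 2 / x 0 ^ 3, (x 1 + ε) ^ 2 * (x 5 + ε) / x 0 ^ 2,
      (x 1 + ε) * (x 5 + ε) ^ 2 / x 0 ^ 2, x 5 + ε, (x 1 + ε) * (x 5 + ε) / x 0] with hf
  have hfc : Continuous fun ε => eval (f ε) F := by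
    refine (MvPolynomial.continuous_eval F).comp (continuous_pi fun i => ?_)
    fin_cases i <;> simp [hf] <;> fun_prop
  have hf0 : f 0 = x := by
    have e6 : x 6 = x 1 * x 5 / x 0 := by
      field_simp
      linear_combination -h.e51
    have e3 : x 3 = x 1 ^ 2 * x 5 / x 0 ^ 2 := by
      field_simp
      linear_combination x 0 * h.e03 - x 1 * h.e51
    have e4 : x 4 = x 1 * x 5 ^ 2 / x 0 ^ 2 := by
      field_simp
      linear_combination x 0 * h.e40 - x 5 * h.e51
    have e2 : x 2 = x 1 ^ 2 * x 5 ^ 2 / x 0 ^ 3 := by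
      field_simp
      linear_combination x 0 ^ 2 * h.e02 - (x 0 * x 6 + x 1 * x 5) * h.e51
    ext i
    fin_cases i <;> simp [hf, e6, e3, e4, e2]
  have hdense : Dense ({-x 1, -x 5}ᶜ : Set ℂ) :=
    (Set.toFinite {-x 1, -x 5}).countable.dense_compl ℂ
  have hzero := Continuous.ext_on hdense hfc continuous_const (g := fun _ => (0 : ℂ)) (by
    intro ε hε
    simp only [Set.mem_compl_iff, Set.mem_insert_iff, Set.mem_singleton_iff, not_or] at hε
    have n1 : x 1 + ε ≠ 0 := fun h => hε.1 (by linear_combination h)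
    have n5 : x 5 + ε ≠ 0 := fun h => hε.2 (by linear_combination h)
    refine hF _ ?_ ?_
    · constructor <;> simp [hf] <;> field_simp
    · simp [hf, n1, n5, h0])
  have := congrFun hzero 0
  simpa [hf0] using this

/-- The Del Pezzo surface is defined by the equations `DelPezzoEqs`: a point outside the torus lies
in the chart at a vertex, where it is a limit of points of the torus. -/
theorem mem_delPezzo6_iff {x : Fin 7 → ℂ} :
    x ∈ affineCone delPezzo6 ↔ x ≠ 0 ∧ DelPezzoEqs x := by
  refine ⟨fun h => ⟨h.1, delPezzoEqs_of_mem h⟩, fun ⟨hx, h⟩ => ?_⟩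
  refine (mem_affineCone_zariskiClosure hx).2 fun F hF => ?_
  rw [mem_projIdeal_projImage cubicMap_univ_smul] at hF
  -- The equations are invariant under rotations of the hexagon, so that one vertex is enough.
  have step : ∀ y : Fin 7 → ℂ, (∀ F : MvPolynomial (Fin 7) ℂ,
      (∀ z, DelPezzoEqs z → z 6 ≠ 0 → eval z F = 0) → eval (y ∘ hexagonRotation) F = 0) →
      ∀ F : MvPolynomial (Fin 7) ℂ,
      (∀ z, DelPezzoEqs z → z 6 ≠ 0 → eval z F = 0) → eval y F = 0 := by
    intro y hy F hF
    have h1 := hy (rename hexagonRotationInv F) (by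
      intro z hz hz6
      rw [eval_rename]
      have e : z ∘ hexagonRotationInv = z ∘ hexagonRotation ∘ hexagonRotation ∘ hexagonRotation ∘
          hexagonRotation ∘ hexagonRotation := by
        ext i
        fin_cases i <;> rfl
      rw [e]
      exact hF _ hz.rotate.rotate.rotate.rotate.rotate hz6)
    rw [eval_rename] at h1
    have e : (y ∘ hexagonRotation) ∘ hexagonRotationInv = y := by
      ext i
      fin_cases i <;> rfl
    rwa [e] at h1
  have torus : ∀ z, DelPezzoEqs z → z 6 ≠ 0 → eval z F = 0 := by
    intro z hz hz6
    obtain ⟨u, rfl⟩ := hz.exists_cubicMap hz6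
    refine hF u trivial fun h0 => hz6 ?_
    rw [h0]
    rfl
  obtain ⟨k, hk⟩ := h.exists_vertex hx
  have main : ∀ (k : ℕ) (y : Fin 7 → ℂ), DelPezzoEqs y → (y ∘ hexagonRotation^[k]) 0 ≠ 0 →
      ∀ F : MvPolynomial (Fin 7) ℂ,
      (∀ z, DelPezzoEqs z → z 6 ≠ 0 → eval z F = 0) → eval y F = 0 := by
    intro k
    induction k with
    | zero => exact fun y hy h0 F hF => hy.eval_eq_zero_of_vertex h0 hF
    | succ k ih => exact fun y hy h0 F hF => step y (ih _ hy.rotate (by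
        simpa only [Function.iterate_succ', Function.comp] using h0)) F hF
  exact main k x h hk F torus

/-! ### Even and odd coordinates -/

/-- The equations of the sextic Del Pezzo surface in the coordinates adapted to the involution:
the invariant coordinates `A = (x₆, x₀ + x₂, x₁ + x₄, x₃ + x₅)` and the anti-invariant coordinates
`O = (x₀ - x₂, x₁ - x₄, x₃ - x₅)`. -/
structure EvenOddEqs (A : Fin 4 → ℂ) (O : Fin 3 → ℂ) : Prop where
  s00 : O 0 * O 0 = A 1 ^ 2 - 4 * A 0 ^ 2
  s11 : O 1 * O 1 = A 2 ^ 2 - 4 * A 0 ^ 2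
  s22 : O 2 * O 2 = A 3 ^ 2 - 4 * A 0 ^ 2
  s01 : O 0 * O 1 = A 1 * A 2 - 2 * A 0 * A 3
  s02 : O 0 * O 2 = 2 * A 0 * A 2 - A 1 * A 3
  s12 : O 1 * O 2 = A 2 * A 3 - 2 * A 0 * A 1
  l0 : A 3 * O 1 - A 2 * O 2 = 2 * A 0 * O 0
  l1 : A 3 * O 0 + A 1 * O 2 = 2 * A 0 * O 1
  l2 : A 1 * O 1 - A 2 * O 0 = 2 * A 0 * O 2

/-- The Cayley cubic, the quotient of the sextic Del Pezzo surface by the involution. -/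
def cayleyCubic (A : Fin 4 → ℂ) : ℂ :=
  A 0 * (A 1 ^ 2 + A 2 ^ 2 + A 3 ^ 2) - A 1 * A 2 * A 3 - 4 * A 0 ^ 3

/-- The point with given even and odd coordinates. -/
def ofEvenOdd (A : Fin 4 → ℂ) (O : Fin 3 → ℂ) : Fin 7 → ℂ :=
  ![(A 1 + O 0) / 2, (A 2 + O 1) / 2, (A 1 - O 0) / 2, (A 3 + O 2) / 2, (A 2 - O 1) / 2,
    (A 3 - O 2) / 2, A 0]

theorem EvenOddEqs.delPezzoEqs {A : Fin 4 → ℂ} {O : Fin 3 → ℂ} (h : EvenOddEqs A O) :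
    DelPezzoEqs (ofEvenOdd A O) := by
  obtain ⟨s00, s11, s22, s01, s02, s12, l0, l1, l2⟩ := h
  constructor <;> simp [ofEvenOdd]
  · linear_combination -s00 / 4
  · linear_combination -s11 / 4
  · linear_combination -s22 / 4
  · linear_combination s02 / 4 + l1 / 4
  · linear_combination -s01 / 4 + l2 / 4
  · linear_combination -s12 / 4 - l0 / 4
  · linear_combination s02 / 4 - l1 / 4
  · linear_combination -s01 / 4 - l2 / 4
  · linear_combination -s12 / 4 + l0 / 4

theorem DelPezzoEqs.evenOddEqs {x : Fin 7 → ℂ} (h : DelPezzoEqs x) :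
    EvenOddEqs ![x 6, x 0 + x 2, x 1 + x 4, x 3 + x 5] ![x 0 - x 2, x 1 - x 4, x 3 - x 5] := by
  obtain ⟨e02, e14, e35, e03, e12, e34, e25, e40, e51⟩ := h
  constructor <;> simp
  · linear_combination -4 * e02
  · linear_combination -4 * e14
  · linear_combination -4 * e35
  · linear_combination -2 * e12 - 2 * e40
  · linear_combination 2 * e03 + 2 * e25
  · linear_combination -2 * e34 - 2 * e51
  · linear_combination 2 * e51 - 2 * e34
  · linear_combination 2 * e03 - 2 * e25
  · linear_combination 2 * e12 - 2 * e40

theorem EvenOddEqs.cayleyCubic_eq_zero {A : Fin 4 → ℂ} {O : Fin 3 → ℂ} (h : EvenOddEqs A O) :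
    cayleyCubic A = 0 := by
  have key : ∀ x : Fin 7 → ℂ, DelPezzoEqs x →
      cayleyCubic ![x 6, x 0 + x 2, x 1 + x 4, x 3 + x 5] = 0 := by
    rintro x ⟨e02, e14, e35, e03, e12, e34, e25, e40, e51⟩
    simp [cayleyCubic]
    linear_combination 2 * x 6 * (e02 + e14) - x 1 * e03 - x 0 * e51 - (x 3 + x 5) * e40
      - (x 3 + x 5) * e12 - x 2 * e34 - x 4 * e25
  have := key _ h.delPezzoEqs
  simp [cayleyCubic, ofEvenOdd] at this
  rw [cayleyCubic]
  linear_combination this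

/-- Every point of the Cayley cubic is the image of a point of the Del Pezzo surface. -/
theorem exists_evenOddEqs {A : Fin 4 → ℂ} (h : cayleyCubic A = 0) : ∃ O, EvenOddEqs A O := by
  simp only [cayleyCubic] at h
  by_cases h0 : A 0 = 0
  · rw [h0] at h
    have h' : (A 1 = 0 ∨ A 2 = 0) ∨ A 3 = 0 := by
      rw [← mul_eq_zero, ← mul_eq_zero]
      linear_combination -h
    rcases h' with (h' | h') | h'
    · exact ⟨![0, A 2, A 3], by constructor <;> simp [h0, h'] <;> ring⟩
    · exact ⟨![A 1, 0, -A 3], by constructor <;> simp [h0, h'] <;> ring⟩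
    · exact ⟨![A 1, A 2, 0], by constructor <;> simp [h0, h'] <;> ring⟩
  · obtain ⟨p, hp⟩ := IsAlgClosed.exists_pow_nat_eq (A 1 ^ 2 - 4 * A 0 ^ 2) (n := 2) (by norm_num)
    obtain ⟨q, hq, hpq⟩ : ∃ q, q ^ 2 = A 3 ^ 2 - 4 * A 0 ^ 2 ∧
        p * q = 2 * A 0 * A 2 - A 1 * A 3 := by
      obtain ⟨q, hq⟩ := IsAlgClosed.exists_pow_nat_eq (A 3 ^ 2 - 4 * A 0 ^ 2) (n := 2) (by norm_num)
      have hsq : (p * q) ^ 2 = (2 * A 0 * A 2 - A 1 * A 3) ^ 2 := by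
        rw [mul_pow, hp, hq]
        linear_combination -4 * A 0 * h
      rcases sq_eq_sq_iff_eq_or_eq_neg.1 hsq with h1 | h1
      · exact ⟨q, hq, h1⟩
      · exact ⟨-q, by rw [neg_sq, hq], by linear_combination -h1⟩
    refine ⟨![p, (A 3 * p + A 1 * q) / (2 * A 0), q], ?_⟩
    constructor
    · simp
      linear_combination hp
    · simp
      field_simp
      linear_combination A 3 ^ 2 * hp + A 1 ^ 2 * hq + 2 * A 1 * A 3 * hpq - 4 * A 0 * h
    · simp
      linear_combination hq
    · simp
      field_simp
      linear_combination A 3 * hp + A 1 * hpq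
    · simpa using hpq
    · simp
      field_simp
      linear_combination A 3 * hpq + A 1 * hq
    · simp
      field_simp
      linear_combination -p * hq + q * hpq
    · simp
      field_simp
    · simp
      field_simp
      linear_combination -q * hp + p * hpq

theorem EvenOddEqs.neg {A : Fin 4 → ℂ} {O : Fin 3 → ℂ} (h : EvenOddEqs A O) :
    EvenOddEqs A (-O) := by
  obtain ⟨s00, s11, s22, s01, s02, s12, l0, l1, l2⟩ := h
  constructor <;> simp only [Pi.neg_apply]
  · linear_combination s00
  · linear_combination s11
  · linear_combination s22
  · linear_combination s01
  · linear_combination s02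
  · linear_combination s12
  · linear_combination -l0
  · linear_combination -l1
  · linear_combination -l2

theorem EvenOddEqs.smul {A : Fin 4 → ℂ} {O : Fin 3 → ℂ} (h : EvenOddEqs A O) (c : ℂ) :
    EvenOddEqs (c • A) (c • O) := by
  obtain ⟨s00, s11, s22, s01, s02, s12, l0, l1, l2⟩ := h
  constructor <;> simp only [Pi.smul_apply, smul_eq_mul]
  · linear_combination c ^ 2 * s00
  · linear_combination c ^ 2 * s11
  · linear_combination c ^ 2 * s22
  · linear_combination c ^ 2 * s01
  · linear_combination c ^ 2 * s02
  · linear_combination c ^ 2 * s12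
  · linear_combination c ^ 2 * l0
  · linear_combination c ^ 2 * l1
  · linear_combination c ^ 2 * l2

/-! ### The points of the threefold of genus 10 -/

/-- The map `phi10` in the even coordinates `A` and the odd coordinates `O`. -/
def param10 (y : Fin 2 → ℂ) (A : Fin 4 → ℂ) (O : Fin 3 → ℂ) : Fin 11 → ℂ :=
  ![y 0 ^ 2 * A 0, y 0 ^ 2 * A 1, y 0 ^ 2 * A 2, y 0 ^ 2 * A 3,
    y 1 ^ 2 * A 0, y 1 ^ 2 * A 1, y 1 ^ 2 * A 2, y 1 ^ 2 * A 3,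
    y 0 * y 1 * O 0, y 0 * y 1 * O 1, y 0 * y 1 * O 2]

theorem phi10_eq_param10 (y : Fin 2 → ℂ) (x : Fin 7 → ℂ) : phi10 (y, x) =
    param10 y ![x 6, x 0 + x 2, x 1 + x 4, x 3 + x 5] ![x 0 - x 2, x 1 - x 4, x 3 - x 5] := rfl

theorem param10_eq_phi10 (y : Fin 2 → ℂ) (A : Fin 4 → ℂ) (O : Fin 3 → ℂ) :
    param10 y A O = phi10 (y, ofEvenOdd A O) := by
  rw [phi10_eq_param10]
  congr 1 <;> ext i <;> fin_cases i <;> simp [ofEvenOdd] <;> ring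

theorem phi10_smul : ∀ v ∈ {v : (Fin 2 → ℂ) × (Fin 7 → ℂ) | v.1 ≠ 0 ∧ v.2 ∈ affineCone delPezzo6},
    ∀ c : ℂ, c ≠ 0 →
    ∃ w ∈ {v : (Fin 2 → ℂ) × (Fin 7 → ℂ) | v.1 ≠ 0 ∧ v.2 ∈ affineCone delPezzo6},
      phi10 w = c • phi10 v := by
  rintro ⟨y, x⟩ ⟨hy, hx⟩ c hc
  refine ⟨(y, c • x), ⟨hy, smul_mem_affineCone hx hc⟩, ?_⟩
  ext i
  fin_cases i <;> simp [phi10] <;> ring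

theorem mem_W10_iff {z : Fin 11 → ℂ} : z ∈ affineCone W10 ↔
    z ≠ 0 ∧ ∃ y A O, y ≠ 0 ∧ EvenOddEqs A O ∧ param10 y A O = z := by
  rw [W10, mem_affineCone_projImage phi10_smul]
  refine and_congr_right fun hz => ⟨?_, ?_⟩
  · rintro ⟨⟨y, x⟩, ⟨hy, hx⟩, rfl⟩
    exact ⟨y, _, _, hy, (mem_delPezzo6_iff.1 hx).2.evenOddEqs, rfl⟩
  · rintro ⟨y, A, O, hy, h, rfl⟩
    rw [param10_eq_phi10] at hz ⊢
    refine ⟨_, ⟨hy, mem_delPezzo6_iff.2 ⟨?_, h.delPezzoEqs⟩⟩, rfl⟩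
    intro h0
    simp only at h0
    refine hz ?_
    rw [h0]
    ext i
    fin_cases i <;> simp [phi10]

/-! ### The ideal of the threefold of genus 10 -/

/-- The rewriting rules for the ideal of the threefold of genus 10. With `A` and `O` the even and
odd coordinates of the Del Pezzo surface, the variables `0, …, 3` stand for `y₀² A`, the variables
`4, …, 7` for `y₁² A`, and the variables `8, 9, 10` for `y₀ y₁ O`. -/
def rules10 : List (Rule 11) :=
  [⟨[0, 5], [(1, [1, 4])]⟩, ⟨[0, 6], [(1, [2, 4])]⟩, ⟨[0, 7], [(1, [3, 4])]⟩,
    ⟨[1, 6], [(1, [2, 5])]⟩, ⟨[1, 7], [(1, [3, 5])]⟩, ⟨[2, 7], [(1, [3, 6])]⟩,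
    ⟨[8, 8], [(1, [1, 5]), (-4, [0, 4])]⟩, ⟨[9, 9], [(1, [2, 6]), (-4, [0, 4])]⟩,
    ⟨[10, 10], [(1, [3, 7]), (-4, [0, 4])]⟩, ⟨[8, 9], [(1, [1, 6]), (-2, [0, 7])]⟩,
    ⟨[8, 10], [(2, [0, 6]), (-1, [1, 7])]⟩, ⟨[9, 10], [(1, [2, 7]), (-2, [0, 5])]⟩,
    ⟨[0, 8], [(1 / 2, [3, 9]), (-1 / 2, [2, 10])]⟩, ⟨[4, 8], [(1 / 2, [7, 9]), (-1 / 2, [6, 10])]⟩,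
    ⟨[0, 9], [(1 / 2, [3, 8]), (1 / 2, [1, 10])]⟩, ⟨[4, 9], [(1 / 2, [7, 8]), (1 / 2, [5, 10])]⟩,
    ⟨[0, 10], [(1 / 2, [1, 9]), (-1 / 2, [2, 8])]⟩, ⟨[4, 10], [(1 / 2, [5, 9]), (-1 / 2, [6, 8])]⟩,
    ⟨[0, 0, 0], [(1 / 4, [0, 1, 1]), (1 / 4, [0, 2, 2]), (1 / 4, [0, 3, 3]),
      (-1 / 4, [1, 2, 3])]⟩,
    ⟨[0, 0, 4], [(1 / 4, [4, 1, 1]), (1 / 4, [4, 2, 2]), (1 / 4, [4, 3, 3]),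
      (-1 / 4, [5, 2, 3])]⟩,
    ⟨[0, 4, 4], [(1 / 4, [0, 5, 5]), (1 / 4, [0, 6, 6]), (1 / 4, [0, 7, 7]),
      (-1 / 4, [1, 6, 7])]⟩,
    ⟨[4, 4, 4], [(1 / 4, [4, 5, 5]), (1 / 4, [4, 6, 6]), (1 / 4, [4, 7, 7]),
      (-1 / 4, [5, 6, 7])]⟩]

/-- A weight which is decreased by the rules for genus 10; any such weight would do. -/
def weight10 : Fin 11 → ℕ := ![13, 2, 1, 0, 10, 0, 0, 0, 30, 30, 30]

theorem rules10_weight : ∀ ρ ∈ rules10, ∀ t ∈ ρ.tail,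
    (t.2.map weight10).sum < (ρ.lead.map weight10).sum := by
  simp only [rules10, List.forall_mem_cons]
  simp [weight10]

theorem rules10_length : ∀ ρ ∈ rules10, ∀ t ∈ ρ.tail, t.2.length = ρ.lead.length := by
  simp only [rules10, List.forall_mem_cons]
  simp

theorem rules10_length' : ∀ ρ ∈ rules10, ρ.lead.length = 2 ∨ ρ.lead.length = 3 := by
  simp [rules10]

theorem eval_rules10 (y : Fin 2 → ℂ) {A : Fin 4 → ℂ} {O : Fin 3 → ℂ} (h : EvenOddEqs A O) :
    ∀ ρ ∈ rules10, eval (param10 y A O) ρ.poly = 0 := by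
  have hc := h.cayleyCubic_eq_zero
  rw [cayleyCubic] at hc
  obtain ⟨s00, s11, s22, s01, s02, s12, l0, l1, l2⟩ := h
  simp only [Rule.eval_poly, rules10, List.forall_mem_cons]
  simp [param10]
  refine ⟨by ring, by ring, by ring, by ring, by ring, by ring, ?_, ?_, ?_, ?_, ?_, ?_, ?_, ?_, ?_,
    ?_, ?_, ?_, ?_, ?_, ?_, ?_⟩
  · linear_combination y 0 ^ 2 * y 1 ^ 2 * s00
  · linear_combination y 0 ^ 2 * y 1 ^ 2 * s11
  · linear_combination y 0 ^ 2 * y 1 ^ 2 * s22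
  · linear_combination y 0 ^ 2 * y 1 ^ 2 * s01
  · linear_combination y 0 ^ 2 * y 1 ^ 2 * s02
  · linear_combination y 0 ^ 2 * y 1 ^ 2 * s12
  · linear_combination -y 0 ^ 3 * y 1 / 2 * l0
  · linear_combination -y 0 * y 1 ^ 3 / 2 * l0
  · linear_combination -y 0 ^ 3 * y 1 / 2 * l1
  · linear_combination -y 0 * y 1 ^ 3 / 2 * l1
  · linear_combination -y 0 ^ 3 * y 1 / 2 * l2
  · linear_combination -y 0 * y 1 ^ 3 / 2 * l2
  · linear_combination -y 0 ^ 6 / 4 * hc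
  · linear_combination -y 0 ^ 4 * y 1 ^ 2 / 4 * hc
  · linear_combination -y 0 ^ 2 * y 1 ^ 4 / 4 * hc
  · linear_combination -y 1 ^ 6 / 4 * hc

/-- The conditions on the exponents of a reduced monomial. -/
theorem reduced10_conditions {m : Fin 11 →₀ ℕ} (hm : Reduced rules10 m) :
    ((m 0 = 0 ∨ m 5 = 0) ∧ (m 0 = 0 ∨ m 6 = 0) ∧ (m 0 = 0 ∨ m 7 = 0) ∧ (m 1 = 0 ∨ m 6 = 0) ∧
      (m 1 = 0 ∨ m 7 = 0) ∧ (m 2 = 0 ∨ m 7 = 0)) ∧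
    m 8 + m 9 + m 10 ≤ 1 ∧ (m 8 + m 9 + m 10 = 0 ∨ m 0 + m 4 = 0) ∧ m 0 + m 4 ≤ 2 := by
  have h : ∀ ρ ∈ rules10, ∃ i, m i < ρ.lead.count i := fun ρ hρ => hm.exists_lt hρ
  simp only [rules10, List.forall_mem_cons, Fin.exists_fin_succ] at h
  simp [List.count_cons] at h
  obtain ⟨r05, r06, r07, r16, r17, r27, r8, r9, r10, r89, r810, r910, r08, r48, r09, r49, r010,
    r410, r000, r004, r044, r444⟩ := h
  refine ⟨⟨r05, r06, r07, r16, r17, r27⟩, ?_, ?_, ?_⟩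
  · clear r05 r06 r07 r16 r17 r27 r08 r48 r09 r49 r010 r410 r000 r004 r044 r444
    omega
  · clear r05 r06 r07 r16 r17 r27 r8 r9 r10 r89 r810 r910 r000 r004 r044 r444
    rcases Nat.eq_zero_or_pos (m 0 + m 4) with h0 | h0
    · exact Or.inr h0
    · left
      rcases Nat.eq_zero_or_pos (m 0) with h1 | h1 <;> omega
  · clear r05 r06 r07 r16 r17 r27 r8 r9 r10 r89 r810 r910 r08 r48 r09 r49 r010 r410
    omega

/-- The basis element `1, c, c², O₀, O₁, O₂` of the coordinate ring of the Del Pezzo surface over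
the polynomial ring in `A₁, A₂, A₃` which belongs to a reduced monomial; here `c = A₀`. -/
def basisIndex (m : Fin 11 →₀ ℕ) : Fin 6 :=
  if m 8 = 1 then 3 else if m 9 = 1 then 4 else if m 10 = 1 then 5 else
    if m 0 + m 4 = 0 then 0 else if m 0 + m 4 = 1 then 1 else 2

/-- The values of the basis elements at the point with even coordinates `A` and odd coordinates
`O`. -/
def basisValue (A : Fin 4 → ℂ) (O : Fin 3 → ℂ) : Fin 6 → ℂ :=
  ![1, A 0, A 0 ^ 2, O 0, O 1, O 2]

/-- The exponents of `y₀, y₁, A₁, A₂, A₃` in the image of a monomial. -/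
def imageExponent (m : Fin 11 →₀ ℕ) : Fin 5 → ℕ :=
  ![2 * (m 0 + m 1 + m 2 + m 3) + (m 8 + m 9 + m 10),
    2 * (m 4 + m 5 + m 6 + m 7) + (m 8 + m 9 + m 10), m 1 + m 5, m 2 + m 6, m 3 + m 7]

theorem basisIndex_spec {m : Fin 11 →₀ ℕ} (hm : Reduced rules10 m) :
    m 0 + m 4 = ![0, 1, 2, 0, 0, 0] (basisIndex m) ∧ m 8 = ![0, 0, 0, 1, 0, 0] (basisIndex m) ∧
      m 9 = ![0, 0, 0, 0, 1, 0] (basisIndex m) ∧ m 10 = ![0, 0, 0, 0, 0, 1] (basisIndex m) := by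
  obtain ⟨-, h1, h2, h3⟩ := reduced10_conditions hm
  simp only [basisIndex]
  split_ifs <;> simp <;> omega

/-- Sorted distributions of given multiplicities into two blocks of given sizes are equal: the
first block consists of the last elements. -/
theorem sorted_blocks_unique {a₀ a₁ a₂ a₃ b₀ b₁ b₂ b₃ a₀' a₁' a₂' a₃' b₀' b₁' b₂' b₃' : ℕ}
    (h : (a₀ = 0 ∨ b₁ = 0) ∧ (a₀ = 0 ∨ b₂ = 0) ∧ (a₀ = 0 ∨ b₃ = 0) ∧ (a₁ = 0 ∨ b₂ = 0) ∧
      (a₁ = 0 ∨ b₃ = 0) ∧ (a₂ = 0 ∨ b₃ = 0))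
    (h' : (a₀' = 0 ∨ b₁' = 0) ∧ (a₀' = 0 ∨ b₂' = 0) ∧ (a₀' = 0 ∨ b₃' = 0) ∧
      (a₁' = 0 ∨ b₂' = 0) ∧ (a₁' = 0 ∨ b₃' = 0) ∧ (a₂' = 0 ∨ b₃' = 0))
    (e : a₀ + a₁ + a₂ + a₃ = a₀' + a₁' + a₂' + a₃') (e₀ : a₀ + b₀ = a₀' + b₀')
    (e₁ : a₁ + b₁ = a₁' + b₁') (e₂ : a₂ + b₂ = a₂' + b₂') (e₃ : a₃ + b₃ = a₃' + b₃') :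
    a₀ = a₀' ∧ a₁ = a₁' ∧ a₂ = a₂' ∧ a₃ = a₃' ∧ b₀ = b₀' ∧ b₁ = b₁' ∧ b₂ = b₂' ∧ b₃ = b₃' := by
  obtain ⟨h01, h02, h03, h12, h13, h23⟩ := h
  obtain ⟨g01, g02, g03, g12, g13, g23⟩ := h'
  have f3 : b₃ = 0 ∨ a₀ + a₁ + a₂ = 0 := by
    clear h01 h02 h12 g01 g02 g03 g12 g13 g23
    omega
  have f2 : b₂ = 0 ∨ a₀ + a₁ = 0 := by
    clear h01 h03 h13 h23 g01 g02 g03 g12 g13 g23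
    omega
  have f3' : b₃' = 0 ∨ a₀' + a₁' + a₂' = 0 := by
    clear h01 h02 h03 h12 h13 h23 g01 g02 g12
    omega
  have f2' : b₂' = 0 ∨ a₀' + a₁' = 0 := by
    clear h01 h02 h03 h12 h13 h23 g01 g03 g13 g23
    omega
  clear h02 h03 h12 h13 h23 g02 g03 g12 g13 g23
  have k3 : a₃ = a₃' := by
    clear h01 g01 f2 f2'
    omega
  have k2 : a₂ = a₂' := by
    clear h01 g01 f3 f3'
    omega
  have k1 : a₁ = a₁' := by
    clear f2 f2' f3 f3'
    omega
  omega

theorem reduced10_injective {m m' : Fin 11 →₀ ℕ} (hm : Reduced rules10 m)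
    (hm' : Reduced rules10 m') (hb : basisIndex m = basisIndex m')
    (he : imageExponent m = imageExponent m') : m = m' := by
  obtain ⟨kc, k8, k9, k10⟩ := basisIndex_spec hm
  obtain ⟨kc', k8', k9', k10'⟩ := basisIndex_spec hm'
  rw [hb] at kc k8 k9 k10
  have e0 := congrFun he 0
  have e2 := congrFun he 2
  have e3 := congrFun he 3
  have e4 := congrFun he 4
  simp [imageExponent, k8, k8', k9, k9', k10, k10'] at e0 e2 e3 e4
  obtain ⟨j0, j1, j2, j3, j4, j5, j6, j7⟩ := sorted_blocks_unique (reduced10_conditions hm).1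
    (reduced10_conditions hm').1 e0 (kc.trans kc'.symm) e2 e3 e4
  ext i
  fin_cases i
  exacts [j0, j1, j2, j3, j4, j5, j6, j7, k8.trans k8'.symm, k9.trans k9'.symm,
    k10.trans k10'.symm]

/-- The coefficient of a basis element in the image of a combination of reduced monomials. -/
def basisCoeff (G : MvPolynomial (Fin 11) ℂ) (k : Fin 6) : MvPolynomial (Fin 5) ℂ :=
  ∑ m ∈ G.support with basisIndex m = k,
    monomial (Finsupp.equivFunOnFinite.symm (imageExponent m)) (coeff m G)

theorem eval_eq_sum_basisCoeff {G : MvPolynomial (Fin 11) ℂ}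
    (hG : ∀ m ∈ G.support, Reduced rules10 m) (y : Fin 2 → ℂ) (A : Fin 4 → ℂ) (O : Fin 3 → ℂ) :
    eval (param10 y A O) G =
      ∑ k, basisValue A O k * eval ![y 0, y 1, A 1, A 2, A 3] (basisCoeff G k) := by
  simp only [basisCoeff, map_sum, Finset.mul_sum]
  have h : ∀ m ∈ G.support, coeff m G * ∏ i, param10 y A O i ^ m i =
      basisValue A O (basisIndex m) * eval ![y 0, y 1, A 1, A 2, A 3]
        (monomial (Finsupp.equivFunOnFinite.symm (imageExponent m)) (coeff m G)) := by
    intro m hm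
    rw [eval_monomial, Finsupp.prod_fintype _ _ (by simp)]
    have hb : basisValue A O (basisIndex m) =
        A 0 ^ (m 0 + m 4) * O 0 ^ m 8 * O 1 ^ m 9 * O 2 ^ m 10 := by
      obtain ⟨kc, k8, k9, k10⟩ := basisIndex_spec (hG m hm)
      rw [kc, k8, k9, k10]
      generalize basisIndex m = k
      fin_cases k <;> simp [basisValue]
    rw [hb]
    simp [Fin.prod_univ_succ, param10, imageExponent]
    ring
  rw [eval_eq']
  rw [Finset.sum_congr rfl h]
  simp only [Finset.sum_filter]
  rw [Finset.sum_comm]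
  refine Finset.sum_congr rfl fun m _ => ?_
  simp

theorem quadratic_eq_zero {α β γ c₁ c₂ c₃ : ℂ} (h₁₂ : c₁ ≠ c₂) (h₁₃ : c₁ ≠ c₃) (h₂₃ : c₂ ≠ c₃)
    (e₁ : α + β * c₁ + γ * c₁ ^ 2 = 0) (e₂ : α + β * c₂ + γ * c₂ ^ 2 = 0)
    (e₃ : α + β * c₃ + γ * c₃ ^ 2 = 0) : α = 0 ∧ β = 0 ∧ γ = 0 := by
  have f₁ : β + γ * (c₁ + c₂) = 0 := by
    have : (c₁ - c₂) * (β + γ * (c₁ + c₂)) = 0 := by linear_combination e₁ - e₂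
    exact (mul_eq_zero.1 this).resolve_left (sub_ne_zero.2 h₁₂)
  have f₂ : β + γ * (c₁ + c₃) = 0 := by
    have : (c₁ - c₃) * (β + γ * (c₁ + c₃)) = 0 := by linear_combination e₁ - e₃
    exact (mul_eq_zero.1 this).resolve_left (sub_ne_zero.2 h₁₃)
  have hγ : γ = 0 := by
    have : (c₂ - c₃) * γ = 0 := by linear_combination f₁ - f₂
    exact (mul_eq_zero.1 this).resolve_left (sub_ne_zero.2 h₂₃)
  subst hγ
  have hβ : β = 0 := by linear_combination f₁
  subst hβ
  exact ⟨by linear_combination e₁, rfl, rfl⟩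

/-- Outside the discriminant the cubic equation for `c = A₀` has three distinct roots. -/
theorem exists_three_roots {σ π : ℂ} (h : σ ^ 3 - 27 * π ^ 2 ≠ 0) :
    ∃ c : Fin 3 → ℂ, Function.Injective c ∧ ∀ i, c i * σ - π - 4 * c i ^ 3 = 0 := by
  obtain ⟨c₁, h₁⟩ := IsAlgClosed.exists_root
    (Polynomial.C 4 * Polynomial.X ^ 3 + Polynomial.C 0 * Polynomial.X ^ 2
      + Polynomial.C (-σ) * Polynomial.X + Polynomial.C π) (by
        rw [Polynomial.degree_cubic (by norm_num)]
        norm_num)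
  simp [Polynomial.IsRoot] at h₁
  obtain ⟨d, hd⟩ := IsAlgClosed.exists_pow_nat_eq (σ - 3 * c₁ ^ 2) (n := 2) (by norm_num)
  have hπ : π = σ * c₁ - 4 * c₁ ^ 3 := by linear_combination h₁
  -- The other two roots are `(-c₁ ± d) / 2`.
  have g₁ : c₁ ≠ (-c₁ + d) / 2 := by
    intro e
    have hd' : d = 3 * c₁ := by linear_combination -2 * e
    have hσ : σ = 12 * c₁ ^ 2 := by rw [hd'] at hd; linear_combination -hd
    refine h ?_
    rw [hπ, hσ]
    ring
  have g₂ : c₁ ≠ (-c₁ - d) / 2 := by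
    intro e
    have hd' : d = -3 * c₁ := by linear_combination 2 * e
    have hσ : σ = 12 * c₁ ^ 2 := by rw [hd'] at hd; linear_combination -hd
    refine h ?_
    rw [hπ, hσ]
    ring
  have g₃ : (-c₁ + d) / 2 ≠ (-c₁ - d) / 2 := by
    intro e
    have hd' : d = 0 := by linear_combination e
    have hσ : σ = 3 * c₁ ^ 2 := by rw [hd'] at hd; linear_combination -hd
    refine h ?_
    rw [hπ, hσ]
    ring
  refine ⟨![c₁, (-c₁ + d) / 2, (-c₁ - d) / 2], ?_, ?_⟩
  · intro i j hij
    fin_cases i <;> fin_cases j <;> simp at hij ⊢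
    exacts [g₁ hij, g₂ hij, g₁ hij.symm, g₃ (by rw [hij]), g₂ hij.symm, g₃ (by rw [hij])]
  · intro i
    fin_cases i
    · simp
      linear_combination -h₁
    · change (-c₁ + d) / 2 * σ - π - 4 * ((-c₁ + d) / 2) ^ 3 = 0
      rw [hπ]
      linear_combination -((-c₁ + d) / 2 - c₁) * hd
    · change (-c₁ - d) / 2 * σ - π - 4 * ((-c₁ - d) / 2) ^ 3 = 0
      rw [hπ]
      linear_combination -((-c₁ - d) / 2 - c₁) * hd

/-- The values of the basis elements at the six points of the Del Pezzo surface over a general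
point of the plane are independent. -/
theorem basisCoeff_eval_eq_zero {A : Fin 4 → ℂ} (hπ : A 1 * A 2 * A 3 ≠ 0)
    (hD : (A 1 ^ 2 + A 2 ^ 2 + A 3 ^ 2) ^ 3 - 27 * (A 1 * A 2 * A 3) ^ 2 ≠ 0) {h : Fin 6 → ℂ}
    (hh : ∀ c O, c ≠ 0 → EvenOddEqs ![c, A 1, A 2, A 3] O →
      ∑ k, basisValue ![c, A 1, A 2, A 3] O k * h k = 0) (k : Fin 6) : h k = 0 := by
  obtain ⟨c, hinj, hc⟩ := exists_three_roots hD
  have hc0 : ∀ i, c i ≠ 0 := by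
    intro i h0
    have := hc i
    rw [h0] at this
    exact hπ (by linear_combination -this)
  have hO : ∀ i, ∃ O, EvenOddEqs ![c i, A 1, A 2, A 3] O := by
    intro i
    refine exists_evenOddEqs ?_
    simp [cayleyCubic]
    linear_combination hc i
  choose O hO using hO
  have key : ∀ i, h 0 + h 1 * c i + h 2 * c i ^ 2 = 0 ∧
      O i 0 * h 3 + O i 1 * h 4 + O i 2 * h 5 = 0 := by
    intro i
    have p := hh (c i) (O i) (hc0 i) (hO i)
    have n := hh (c i) (-O i) (hc0 i) (hO i).neg
    simp [Fin.sum_univ_succ, basisValue] at p n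
    exact ⟨by linear_combination (p + n) / 2, by linear_combination (p - n) / 2⟩
  have n01 : c 0 ≠ c 1 := fun e => absurd (hinj e) (by decide)
  have n02 : c 0 ≠ c 2 := fun e => absurd (hinj e) (by decide)
  have n12 : c 1 ≠ c 2 := fun e => absurd (hinj e) (by decide)
  have quad : ∀ α β γ : ℂ, (∀ i, α + β * c i + γ * c i ^ 2 = 0) → α = 0 ∧ β = 0 ∧ γ = 0 :=
    fun α β γ e => quadratic_eq_zero n01 n02 n12 (e 0) (e 1) (e 2)
  obtain ⟨h0, h1, h2⟩ := quad _ _ _ fun i => (key i).1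
  -- Multiplication by an odd basis element makes the odd part even.
  obtain ⟨-, -, h3⟩ := quad (A 1 ^ 2 * h 3 + A 1 * A 2 * h 4 - A 1 * A 3 * h 5)
    (-2 * A 3 * h 4 + 2 * A 2 * h 5) (-4 * h 3) fun i => by
      obtain ⟨s00, s11, s22, s01, s02, s12, l0, l1, l2⟩ := hO i
      simp at s00 s11 s22 s01 s02 s12
      linear_combination O i 0 * (key i).2 - h 3 * s00 - h 4 * s01 - h 5 * s02
  obtain ⟨-, -, h4⟩ := quad (A 1 * A 2 * h 3 + A 2 ^ 2 * h 4 + A 2 * A 3 * h 5)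
    (-2 * A 3 * h 3 - 2 * A 1 * h 5) (-4 * h 4) fun i => by
      obtain ⟨s00, s11, s22, s01, s02, s12, l0, l1, l2⟩ := hO i
      simp at s00 s11 s22 s01 s02 s12
      linear_combination O i 1 * (key i).2 - h 3 * s01 - h 4 * s11 - h 5 * s12
  obtain ⟨-, -, h5⟩ := quad (-A 1 * A 3 * h 3 + A 2 * A 3 * h 4 + A 3 ^ 2 * h 5)
    (2 * A 2 * h 3 - 2 * A 1 * h 4) (-4 * h 5) fun i => by
      obtain ⟨s00, s11, s22, s01, s02, s12, l0, l1, l2⟩ := hO i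
      simp at s00 s11 s22 s01 s02 s12
      linear_combination O i 2 * (key i).2 - h 3 * s02 - h 4 * s12 - h 5 * s22
  simp at h3 h4 h5
  fin_cases k <;> assumption

theorem mem_projIdeal_W10 {F : MvPolynomial (Fin 11) ℂ} : F ∈ projIdeal W10 ↔
    ∀ y A O, EvenOddEqs A O → param10 y A O ≠ 0 → eval (param10 y A O) F = 0 := by
  rw [mem_projIdeal]
  constructor
  · intro hF y A O h h0
    refine hF _ h0 ((mk_mem_iff h0).2 (mem_W10_iff.2 ⟨h0, y, A, O, ?_, h, rfl⟩))
    rintro rfl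
    refine h0 ?_
    ext i
    fin_cases i <;> simp [param10]
  · intro hF x h0 hx
    obtain ⟨-, y, A, O, -, h, rfl⟩ := mem_W10_iff.1 ((mk_mem_iff h0).1 hx)
    exact hF y A O h h0

/-- The ideal contains no nonzero combination of reduced monomials, since the coordinate ring of the
Del Pezzo surface is free over the polynomial ring in `A₁, A₂, A₃` and reduced monomials with the
same basis element have distinct images. -/
theorem eq_zero_of_mem_projIdeal_W10 {G : MvPolynomial (Fin 11) ℂ} (hG : G ∈ projIdeal W10)
    (hred : ∀ m ∈ G.support, Reduced rules10 m) : G = 0 := by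
  have hcoeff : ∀ k, basisCoeff G k = 0 := by
    intro k
    -- The coefficient vanishes where this polynomial does not vanish.
    set D : MvPolynomial (Fin 5) ℂ := X 0 * (X 2 * X 3 * X 4) *
      ((X 2 ^ 2 + X 3 ^ 2 + X 4 ^ 2) ^ 3 - C 27 * (X 2 * X 3 * X 4) ^ 2) with hD
    have hD0 : D ≠ 0 := by
      intro h0
      have := congrArg (eval ![1, 1, 1, 1, 2]) h0
      simp [hD] at this
      norm_num at this
    have hmul : basisCoeff G k * D = 0 := by
      refine MvPolynomial.funext fun w => ?_
      rw [map_mul, map_zero]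
      by_cases hw : eval w D = 0
      · rw [hw, mul_zero]
      · simp only [hD, map_mul, map_sub, map_add, map_pow, eval_X, eval_C, mul_eq_zero, not_or,
          ← ne_eq] at hw
        obtain ⟨⟨w0, ⟨w2, w3⟩, w4⟩, hdisc⟩ := hw
        have hw' : ![w 0, w 1, w 2, w 3, w 4] = w := by
          ext i
          fin_cases i <;> rfl
        rw [basisCoeff_eval_eq_zero (A := ![0, w 2, w 3, w 4])
          (h := fun k => eval w (basisCoeff G k)) (by simp [w2, w3, w4]) (by simpa using hdisc)
          (fun c O hc h => ?_), zero_mul]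
        change EvenOddEqs ![c, w 2, w 3, w 4] O at h
        have h1 := eval_eq_sum_basisCoeff hred ![w 0, w 1] ![c, w 2, w 3, w 4] O
        rw [mem_projIdeal_W10.1 hG _ _ _ h] at h1
        · simp [hw'] at h1
          simpa using h1.symm
        · intro h0
          have := congrFun h0 0
          simp [param10, w0, hc] at this
    exact (mul_eq_zero.1 hmul).resolve_right hD0
  ext m
  rw [coeff_zero]
  by_contra hm
  have hm' : m ∈ G.support := mem_support_iff.2 hm
  have h1 := congrArg (coeff (Finsupp.equivFunOnFinite.symm (imageExponent m)))
    (hcoeff (basisIndex m))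
  rw [basisCoeff, coeff_sum, Finset.sum_eq_single m ?_ ?_] at h1
  · rw [coeff_monomial, if_pos rfl, coeff_zero] at h1
    exact hm h1
  · intro m₁ hm₁ hne
    rw [Finset.mem_filter] at hm₁
    rw [coeff_monomial, if_neg]
    intro he
    exact hne (reduced10_injective (hred _ hm₁.1) (hred _ hm') hm₁.2
      (Finsupp.equivFunOnFinite.symm.injective he))
  · intro h
    refine absurd ?_ h
    rw [Finset.mem_filter]
    exact ⟨hm', rfl⟩

/-- The quadrics and cubics of the rewriting rules generate the ideal. -/
theorem projIdeal_W10 : projIdeal W10 = Ideal.span {F | ∃ ρ ∈ rules10, F = ρ.poly} :=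
  eq_span_rules rules10 weight10 rules10_weight _
    (fun ρ hρ => mem_projIdeal_W10.2 fun y _ _ h _ => eval_rules10 y h ρ hρ)
    (fun _ hG hred => eq_zero_of_mem_projIdeal_W10 hG hred)

theorem generated_W10 : GeneratedByQuadricsAndCubics (projIdeal W10) :=
  generatedByQuadricsAndCubics_of_eq_span_rules projIdeal_W10 rules10_length rules10_length'

/-! ### The dimension of the threefold of genus 10 -/

theorem isIntegral_of_cubic {R B : Type*} [CommRing R] [CommRing B] [Algebra R B] {z a b c : B}
    (ha : IsIntegral R a) (hb : IsIntegral R b) (hc : IsIntegral R c)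
    (h : z ^ 3 + a * z ^ 2 + b * z + c = 0) : IsIntegral R z := by
  have hz : IsIntegral (integralClosure R B) z := by
    refine ⟨Polynomial.X ^ 3 + Polynomial.C ⟨a, ha⟩ * Polynomial.X ^ 2
      + Polynomial.C ⟨b, hb⟩ * Polynomial.X + Polynomial.C ⟨c, hc⟩, ?_, ?_⟩
    · monicity!
    · simpa [Polynomial.eval₂_add, Polynomial.eval₂_mul] using h
  exact isIntegral_trans z hz

theorem exists_cayleyCubic_eq_zero (P S Q : ℂ) : ∃ c, cayleyCubic ![c, P, S, Q] = 0 := by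
  obtain ⟨c, hc⟩ := IsAlgClosed.exists_root
    (Polynomial.C 4 * Polynomial.X ^ 3 + Polynomial.C 0 * Polynomial.X ^ 2
      + Polynomial.C (-(P ^ 2 + S ^ 2 + Q ^ 2)) * Polynomial.X + Polynomial.C (P * S * Q)) (by
        rw [Polynomial.degree_cubic (by norm_num)]
        norm_num)
  refine ⟨c, ?_⟩
  simp [Polynomial.IsRoot] at hc
  simp [cayleyCubic]
  linear_combination -hc

/-- Four linear forms which are a homogeneous system of parameters of the coordinate ring. They
come from the Segre embedding `ℙ¹ × ℙ² ⊂ ℙ⁵`. -/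
def parameterHom : MvPolynomial (Fin 4) ℂ →ₐ[ℂ] MvPolynomial (Fin 11) ℂ :=
  aeval ![X 1, X 2 - X 5, X 3 - X 6, X 7]

/-- The coordinate ring is integral over the ring of the parameters: the two coefficients of the
product of a linear and a quadratic polynomial are integral over the coefficients of the product,
the coordinates `0` and `4` are roots of the cubic equation, and the odd coordinates are square
roots. -/
theorem isIntegral_parameterHom :
    ((Ideal.Quotient.mk (projIdeal W10)).comp parameterHom.toRingHom).IsIntegral := by
  set f := (Ideal.Quotient.mk (projIdeal W10)).comp parameterHom.toRingHom with hf
  let _ : Algebra (MvPolynomial (Fin 4) ℂ) (MvPolynomial (Fin 11) ℂ ⧸ projIdeal W10) := f.toAlgebra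
  set π := Ideal.Quotient.mk (projIdeal W10) with hπ
  have hC : ∀ c : ℂ, IsIntegral (MvPolynomial (Fin 4) ℂ) (π (C c)) := by
    intro c
    have : π (C c) = algebraMap (MvPolynomial (Fin 4) ℂ) _ (C c) := by
      rw [RingHom.algebraMap_toAlgebra, hf, RingHom.comp_apply]
      simp
    rw [this]
    exact isIntegral_algebraMap
  have hparam : ∀ i, IsIntegral (MvPolynomial (Fin 4) ℂ)
      (π ((![X 1, X 2 - X 5, X 3 - X 6, X 7] : Fin 4 → MvPolynomial (Fin 11) ℂ) i)) := by
    intro i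
    have : π ((![X 1, X 2 - X 5, X 3 - X 6, X 7] : Fin 4 → MvPolynomial (Fin 11) ℂ) i) =
        algebraMap (MvPolynomial (Fin 4) ℂ) _ (X i) := by
      rw [RingHom.algebraMap_toAlgebra, hf, RingHom.comp_apply]
      simp [parameterHom]
    rw [this]
    exact isIntegral_algebraMap
  have hrel : ∀ F : MvPolynomial (Fin 11) ℂ,
      (∀ y A O, EvenOddEqs A O → eval (param10 y A O) F = 0) → π F = 0 := fun F hF =>
    Ideal.Quotient.eq_zero_iff_mem.2 (mem_projIdeal_W10.2 fun y A O h _ => hF y A O h)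
  have h1 : IsIntegral (MvPolynomial (Fin 4) ℂ) (π (X 1)) := hparam 0
  have h25 : IsIntegral (MvPolynomial (Fin 4) ℂ) (π (X 2 - X 5)) := hparam 1
  have h36 : IsIntegral (MvPolynomial (Fin 4) ℂ) (π (X 3 - X 6)) := hparam 2
  have h7 : IsIntegral (MvPolynomial (Fin 4) ℂ) (π (X 7)) := hparam 3
  -- The product of `y₀² T - y₁²` and `A₁ T² + A₂ T + A₃` has the parameters as coefficients.
  have h5 : IsIntegral (MvPolynomial (Fin 4) ℂ) (π (X 5)) := by
    refine isIntegral_of_cubic h25 (h36.mul h1) (h7.mul (h1.pow 2)).neg ?_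
    rw [← map_pow, ← map_pow, ← map_pow, ← map_mul, ← map_mul, ← map_mul, ← map_mul, ← map_add,
      ← map_add, ← map_neg, ← map_add]
    refine hrel _ fun y A O _ => ?_
    simp [param10]
    ring
  have h3 : IsIntegral (MvPolynomial (Fin 4) ℂ) (π (X 3)) := by
    refine isIntegral_of_cubic h36.neg (h25.mul h7).neg (h1.mul (h7.pow 2)).neg ?_
    rw [← map_pow, ← map_pow, ← map_pow, ← map_mul, ← map_mul, ← map_neg, ← map_neg, ← map_neg,
      ← map_mul, ← map_mul, ← map_add, ← map_add, ← map_add]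
    refine hrel _ fun y A O _ => ?_
    simp [param10]
    ring
  have h2 : IsIntegral (MvPolynomial (Fin 4) ℂ) (π (X 2)) := by
    have := h25.add h5
    rwa [← map_add, sub_add_cancel] at this
  have h6 : IsIntegral (MvPolynomial (Fin 4) ℂ) (π (X 6)) := by
    have := h3.sub h36
    rwa [← map_sub, sub_sub_cancel] at this
  have h0 : IsIntegral (MvPolynomial (Fin 4) ℂ) (π (X 0)) := by
    refine isIntegral_of_cubic (hC 0)
      ((hC (-1 / 4)).mul (((h1.pow 2).add (h2.pow 2)).add (h3.pow 2)))
      ((hC (1 / 4)).mul ((h1.mul h2).mul h3)) ?_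
    simp only [← map_pow, ← map_mul, ← map_add]
    refine hrel _ fun y A O h => ?_
    have hc := h.cayleyCubic_eq_zero
    rw [cayleyCubic] at hc
    simp [param10]
    linear_combination -y 0 ^ 6 / 4 * hc
  have h4 : IsIntegral (MvPolynomial (Fin 4) ℂ) (π (X 4)) := by
    refine isIntegral_of_cubic (hC 0)
      ((hC (-1 / 4)).mul (((h5.pow 2).add (h6.pow 2)).add (h7.pow 2)))
      ((hC (1 / 4)).mul ((h5.mul h6).mul h7)) ?_
    simp only [← map_pow, ← map_mul, ← map_add]
    refine hrel _ fun y A O h => ?_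
    have hc := h.cayleyCubic_eq_zero
    rw [cayleyCubic] at hc
    simp [param10]
    linear_combination -y 1 ^ 6 / 4 * hc
  have hodd : ∀ i j k : Fin 11, (∀ y A O, EvenOddEqs A O → param10 y A O i ^ 2 =
      param10 y A O j * param10 y A O k - 4 * param10 y A O 0 * param10 y A O 4) →
      IsIntegral (MvPolynomial (Fin 4) ℂ) (π (X j)) →
      IsIntegral (MvPolynomial (Fin 4) ℂ) (π (X k)) →
      IsIntegral (MvPolynomial (Fin 4) ℂ) (π (X i)) := by
    intro i j k h hj hk
    refine IsIntegral.of_pow (n := 2) (by norm_num) ?_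
    have e : π (X i) ^ 2 = π (X j) * π (X k) - π (C 4) * π (X 0) * π (X 4) := by
      rw [← sub_eq_zero, ← map_pow, ← map_mul, ← map_mul, ← map_mul, ← map_sub, ← map_sub]
      refine hrel _ fun y A O hAO => ?_
      simp [h y A O hAO]
    rw [e]
    exact (hj.mul hk).sub (((hC 4).mul h0).mul h4)
  have h8 := hodd 8 1 5 (fun y A O h => by
    simp [param10]
    linear_combination y 0 ^ 2 * y 1 ^ 2 * h.s00) h1 h5
  have h9 := hodd 9 2 6 (fun y A O h => by
    simp [param10]
    linear_combination y 0 ^ 2 * y 1 ^ 2 * h.s11) h2 h6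
  have h10 := hodd 10 3 7 (fun y A O h => by
    simp [param10]
    linear_combination y 0 ^ 2 * y 1 ^ 2 * h.s22) h3 h7
  have hX : ∀ i, IsIntegral (MvPolynomial (Fin 4) ℂ) (π (X i)) := by
    intro i
    fin_cases i
    exacts [h0, h1, h2, h3, h4, h5, h6, h7, h8, h9, h10]
  intro b
  obtain ⟨F, rfl⟩ := Ideal.Quotient.mk_surjective b
  change IsIntegral (MvPolynomial (Fin 4) ℂ) (π F)
  induction F using MvPolynomial.induction_on with
  | C c => exact hC c
  | add p q hp hq =>
    rw [map_add]
    exact hp.add hq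
  | mul_X p i hp =>
    rw [map_mul]
    exact hp.mul (hX i)

theorem injective_parameterHom : Function.Injective
    ((Ideal.Quotient.mk (projIdeal W10)).comp parameterHom.toRingHom) := by
  rw [injective_iff_map_eq_zero]
  intro F hF
  rw [RingHom.comp_apply, Ideal.Quotient.eq_zero_iff_mem, mem_projIdeal_W10] at hF
  have h : F * X 0 = 0 := by
    refine MvPolynomial.funext fun w => ?_
    rw [map_mul, eval_X, map_zero]
    by_cases hw : w 0 = 0
    · rw [hw, mul_zero]
    -- A root of the cubic polynomial with coefficients `w` gives a point with parameters `w`.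
    obtain ⟨τ, hτ⟩ := IsAlgClosed.exists_root
      (Polynomial.C (w 0) * Polynomial.X ^ 3 + Polynomial.C (w 1) * Polynomial.X ^ 2
        + Polynomial.C (w 2) * Polynomial.X + Polynomial.C (-w 3)) (by
          rw [Polynomial.degree_cubic hw]
          norm_num)
    simp [Polynomial.IsRoot] at hτ
    obtain ⟨t, rfl⟩ := IsAlgClosed.exists_pow_nat_eq τ (n := 2) (by norm_num)
    obtain ⟨c, hc⟩ := exists_cayleyCubic_eq_zero (w 0) (w 1 + t ^ 2 * w 0)
      (w 2 + t ^ 2 * (w 1 + t ^ 2 * w 0))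
    obtain ⟨O, hO⟩ := exists_evenOddEqs hc
    have := hF ![1, t] _ _ hO (fun h0 => hw (by simpa [param10] using congrFun h0 1))
    have e : eval w F = 0 := by
      rw [← this, AlgHom.toRingHom_eq_coe, RingHom.coe_coe, parameterHom,
        ← MvPolynomial.coe_aeval_eq_eval, ← MvPolynomial.coe_aeval_eq_eval, RingHom.coe_coe,
        RingHom.coe_coe, comp_aeval_apply]
      congr 2
      funext i
      fin_cases i
      · simp [param10]
      · simp [param10]
      · simp [param10]
      · simp [param10]
        linear_combination -hτ
    rw [e, zero_mul]
  exact (mul_eq_zero.1 h).resolve_right (X_ne_zero 0)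

theorem projDim_W10 : projDim W10 = 3 := by
  have h : ringKrullDim (MvPolynomial (Fin 11) ℂ ⧸ projIdeal W10) = 4 := by
    let _ : Algebra (MvPolynomial (Fin 4) ℂ) (MvPolynomial (Fin 11) ℂ ⧸ projIdeal W10) :=
      ((Ideal.Quotient.mk (projIdeal W10)).comp parameterHom.toRingHom).toAlgebra
    have : Algebra.IsIntegral (MvPolynomial (Fin 4) ℂ)
        (MvPolynomial (Fin 11) ℂ ⧸ projIdeal W10) := ⟨isIntegral_parameterHom⟩
    rw [ringKrullDim_eq_of_isIntegral (R := MvPolynomial (Fin 4) ℂ) injective_parameterHom,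
      MvPolynomial.ringKrullDim_of_isNoetherianRing, ringKrullDim_eq_zero_of_field]
    simp
  rw [projDim, h]
  rfl

/-! ### Tangent spaces -/

/-- The derivative of a polynomial at the point `x` in the direction of `v`. -/
def dirDeriv {n : ℕ} (x v : Fin n → ℂ) (F : MvPolynomial (Fin n) ℂ) : ℂ :=
  ∑ i, eval x (pderiv i F) * v i

theorem dirDeriv_add {n : ℕ} (x v : Fin n → ℂ) (F G : MvPolynomial (Fin n) ℂ) :
    dirDeriv x v (F + G) = dirDeriv x v F + dirDeriv x v G := by
  simp [dirDeriv, add_mul, Finset.sum_add_distrib]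

theorem dirDeriv_mul {n : ℕ} (x v : Fin n → ℂ) (F G : MvPolynomial (Fin n) ℂ) :
    dirDeriv x v (F * G) = dirDeriv x v F * eval x G + eval x F * dirDeriv x v G := by
  simp only [dirDeriv, Derivation.leibniz, smul_eq_mul, map_add, map_mul, Finset.sum_mul,
    Finset.mul_sum, ← Finset.sum_add_distrib]
  exact Finset.sum_congr rfl fun i _ => by ring

theorem dirDeriv_X {n : ℕ} (x v : Fin n → ℂ) (i : Fin n) : dirDeriv x v (X i) = v i := by
  rw [dirDeriv, Finset.sum_eq_single i]
  · simp
  · intro j _ hj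
    rw [pderiv_X_of_ne hj.symm]
    simp
  · simp

theorem dirDeriv_C {n : ℕ} (x v : Fin n → ℂ) (c : ℂ) : dirDeriv x v (C c) = 0 := by
  simp [dirDeriv]

/-- The derivative of the product of a list of coordinates. -/
def listDeriv {n : ℕ} (x v : Fin n → ℂ) : List (Fin n) → ℂ
  | [] => 0
  | i :: l => v i * (l.map x).prod + x i * listDeriv x v l

theorem dirDeriv_listMonomial {n : ℕ} (x v : Fin n → ℂ) (l : List (Fin n)) :
    dirDeriv x v (listMonomial l) = listDeriv x v l := by
  induction l with
  | nil => simpa [listMonomial, listDeriv] using dirDeriv_C x v 1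
  | cons i l ih =>
    have : listMonomial (i :: l) = X i * listMonomial l := rfl
    rw [this, dirDeriv_mul, dirDeriv_X, eval_listMonomial, eval_X, ih, listDeriv]

theorem Rule.dirDeriv_poly {n : ℕ} (ρ : Rule n) (x v : Fin n → ℂ) : dirDeriv x v ρ.poly =
    listDeriv x v ρ.lead - (ρ.tail.map fun t => t.1 * listDeriv x v t.2).sum := by
  have h : ∀ L : List (ℂ × List (Fin n)),
      dirDeriv x v (L.map fun t => C t.1 * listMonomial t.2).sum =
        (L.map fun t => t.1 * listDeriv x v t.2).sum := by
    intro L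
    induction L with
    | nil => simpa using dirDeriv_C x v 0
    | cons t L ih =>
      simp only [List.map_cons, List.sum_cons]
      rw [dirDeriv_add, ih, dirDeriv_mul, dirDeriv_C, dirDeriv_listMonomial, eval_C, zero_mul,
        zero_add]
  have e : listMonomial ρ.lead = ρ.poly + (ρ.tail.map fun t => C t.1 * listMonomial t.2).sum := by
    rw [Rule.poly, sub_add_cancel]
  rw [← h, ← dirDeriv_listMonomial, e, dirDeriv_add, add_sub_cancel_right]

/-- The tangent space is defined by the differentials of the generators of the ideal. -/
theorem mem_tangentSpace_W10 {P : ProjSpace 10} (hP : P ∈ W10) {v : Fin 11 → ℂ} :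
    v ∈ tangentSpace W10 P ↔ ∀ ρ ∈ rules10,
      listDeriv P.rep v ρ.lead - (ρ.tail.map fun t => t.1 * listDeriv P.rep v t.2).sum = 0 := by
  have hmem : v ∈ tangentSpace W10 P ↔ ∀ F ∈ projIdeal W10, dirDeriv P.rep v F = 0 := Iff.rfl
  rw [hmem]
  constructor
  · intro h ρ hρ
    rw [← Rule.dirDeriv_poly]
    refine h _ ?_
    rw [projIdeal_W10]
    exact Ideal.subset_span ⟨ρ, hρ, rfl⟩
  · intro h F hF
    have hF' := hF
    rw [projIdeal_W10] at hF'
    refine Submodule.span_induction ?_ ?_ ?_ ?_ hF'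
    · rintro _ ⟨ρ, hρ, rfl⟩
      rw [Rule.dirDeriv_poly]
      exact h ρ hρ
    · simpa using dirDeriv_C P.rep v 0
    · intro G H _ _ hG hH
      rw [dirDeriv_add, hG, hH, add_zero]
    · intro G H hH hd
      have hH' : H ∈ projIdeal W10 := by
        rw [projIdeal_W10]
        exact hH
      have hP0 := mem_projIdeal.1 hH' P.rep P.rep_nonzero (by rwa [P.mk_rep])
      rw [smul_eq_mul, dirDeriv_mul, hd, hP0]
      ring

/-- The equations of the tangent space of the affine cone over the Del Pezzo surface. -/
structure DelPezzoTangent (x d : Fin 7 → ℂ) : Prop where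
  e02 : d 0 * x 2 + x 0 * d 2 = 2 * x 6 * d 6
  e14 : d 1 * x 4 + x 1 * d 4 = 2 * x 6 * d 6
  e35 : d 3 * x 5 + x 3 * d 5 = 2 * x 6 * d 6
  e03 : d 0 * x 3 + x 0 * d 3 = d 1 * x 6 + x 1 * d 6
  e12 : d 1 * x 2 + x 1 * d 2 = d 3 * x 6 + x 3 * d 6
  e34 : d 3 * x 4 + x 3 * d 4 = d 2 * x 6 + x 2 * d 6
  e25 : d 2 * x 5 + x 2 * d 5 = d 4 * x 6 + x 4 * d 6
  e40 : d 4 * x 0 + x 4 * d 0 = d 5 * x 6 + x 5 * d 6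
  e51 : d 5 * x 1 + x 5 * d 1 = d 0 * x 6 + x 0 * d 6

theorem DelPezzoTangent.rotate {x d : Fin 7 → ℂ} (h : DelPezzoTangent x d) :
    DelPezzoTangent (x ∘ hexagonRotation) (d ∘ hexagonRotation) := by
  obtain ⟨e02, e14, e35, e03, e12, e34, e25, e40, e51⟩ := h
  exact ⟨e14, e35, (show d 2 * x 0 + x 2 * d 0 = 2 * x 6 * d 6 by linear_combination e02),
    e12, e34, e25, e40, e51, e03⟩

/-- The sextic Del Pezzo surface is smooth: the tangent space of its cone has dimension at most
three. -/
theorem DelPezzoEqs.exists_tangent_coordinates {x : Fin 7 → ℂ} (h : DelPezzoEqs x) (hx : x ≠ 0) :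
    ∃ j : Fin 3 → Fin 7, ∀ d, DelPezzoTangent x d → (∀ k, d (j k) = 0) → d = 0 := by
  have vertex : ∀ x d : Fin 7 → ℂ, x 0 ≠ 0 → DelPezzoTangent x d → d 0 = 0 → d 1 = 0 → d 5 = 0 →
      d = 0 := by
    intro x d h0 ⟨e02, e14, e35, e03, e12, e34, e25, e40, e51⟩ d0 d1 d5
    simp only [d0, d1, d5] at e02 e03 e40 e51
    have d6 : d 6 = 0 := (mul_eq_zero.1
      (show x 0 * d 6 = 0 by linear_combination -e51)).resolve_left h0
    simp only [d6] at e02 e03 e40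
    have d3 : d 3 = 0 := (mul_eq_zero.1
      (show x 0 * d 3 = 0 by linear_combination e03)).resolve_left h0
    have d4 : d 4 = 0 := (mul_eq_zero.1
      (show x 0 * d 4 = 0 by linear_combination e40)).resolve_left h0
    have d2 : d 2 = 0 := (mul_eq_zero.1
      (show x 0 * d 2 = 0 by linear_combination e02)).resolve_left h0
    ext i
    fin_cases i <;> assumption
  have main : ∀ (k : ℕ) (x : Fin 7 → ℂ), (x ∘ hexagonRotation^[k]) 0 ≠ 0 →
      ∃ j : Fin 3 → Fin 7, ∀ d, DelPezzoTangent x d → (∀ k, d (j k) = 0) → d = 0 := by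
    intro k
    induction k with
    | zero =>
      exact fun x h0 => ⟨![0, 1, 5], fun d hd hj => vertex x d h0 hd (hj 0) (hj 1) (hj 2)⟩
    | succ k ih =>
      intro x h0
      obtain ⟨j, hj⟩ := ih (x ∘ hexagonRotation) (by
        simpa only [Function.iterate_succ', Function.comp] using h0)
      refine ⟨hexagonRotation ∘ j, fun d hd hd0 => ?_⟩
      have := hj _ hd.rotate hd0
      have e : (d ∘ hexagonRotation) ∘ hexagonRotationInv = d := by
        ext i
        fin_cases i <;> rfl
      rw [← e, this]
      rfl
  obtain ⟨k, hk⟩ := h.exists_vertex hx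
  exact main k x hk

/-- At a point of the Cayley cubic which is not a node the tangent space of the threefold has
dimension at most four. Here `d`, `e` and `f` are the components of a tangent vector along the block
of the nonzero coordinates `A`, the other block and the odd coordinates: `d` lies in the kernel of
the gradient of the cubic, `e` vanishes, and `f` is a multiple of `O`. -/
theorem EvenOddEqs.exists_tangent_coordinates {A : Fin 4 → ℂ} {O : Fin 3 → ℂ}
    (h : EvenOddEqs A O) (hO : O ≠ 0) : ∃ (i : Fin 4) (j : Fin 3),
    ∀ (d e : Fin 4 → ℂ) (f : Fin 3 → ℂ), (∀ k l, A k * e l = A l * e k) →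
      A 1 * e 1 - 4 * A 0 * e 0 = 0 → A 2 * e 2 - 4 * A 0 * e 0 = 0 →
      A 3 * e 3 - 4 * A 0 * e 0 = 0 →
      A 3 * f 1 - A 2 * f 2 = 2 * A 0 * f 0 → A 3 * f 0 + A 1 * f 2 = 2 * A 0 * f 1 →
      A 1 * f 1 - A 2 * f 0 = 2 * A 0 * f 2 →
      (A 1 ^ 2 + A 2 ^ 2 + A 3 ^ 2 - 12 * A 0 ^ 2) * d 0 + (2 * A 0 * A 1 - A 2 * A 3) * d 1
        + (2 * A 0 * A 2 - A 1 * A 3) * d 2 + (2 * A 0 * A 3 - A 1 * A 2) * d 3 = 0 →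
      (∀ k, d (i.succAbove k) = 0) → f j = 0 → d = 0 ∧ e = 0 ∧ f = 0 := by
  obtain ⟨j, hj⟩ : ∃ j, O j ≠ 0 := by
    by_contra hcon
    push Not at hcon
    exact hO (funext hcon)
  obtain ⟨k, hk⟩ : ∃ k, A k ≠ 0 := by
    by_contra hcon
    push Not at hcon
    refine hj ?_
    have s00 := h.s00
    have s11 := h.s11
    have s22 := h.s22
    simp [hcon] at s00 s11 s22
    fin_cases j <;> assumption
  -- The gradient of the cubic is given by the products of the odd coordinates.
  obtain ⟨i, hi⟩ : ∃ i, (![A 1 ^ 2 + A 2 ^ 2 + A 3 ^ 2 - 12 * A 0 ^ 2, 2 * A 0 * A 1 - A 2 * A 3,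
      2 * A 0 * A 2 - A 1 * A 3, 2 * A 0 * A 3 - A 1 * A 2] : Fin 4 → ℂ) i ≠ 0 := by
    by_contra hcon
    push Not at hcon
    have g0 := hcon 0
    have g1 := hcon 1
    have g2 := hcon 2
    have g3 := hcon 3
    simp at g0 g1 g2 g3
    have p12 : O 1 * O 2 = 0 := by linear_combination h.s12 - g1
    have p02 : O 0 * O 2 = 0 := by linear_combination h.s02 + g2
    have p01 : O 0 * O 1 = 0 := by linear_combination h.s01 - g3
    have sq : O 0 ^ 2 + O 1 ^ 2 + O 2 ^ 2 = 0 := by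
      linear_combination h.s00 + h.s11 + h.s22 + g0
    have c0 : O 0 = 0 := by
      have : O 0 ^ 4 = 0 := by
        linear_combination O 0 ^ 2 * sq - O 0 * O 1 * p01 - O 0 * O 2 * p02
      simpa using this
    have c1 : O 1 = 0 := by
      have : O 1 ^ 4 = 0 := by
        linear_combination O 1 ^ 2 * sq - O 0 * O 1 * p01 - O 1 * O 2 * p12
      simpa using this
    have c2 : O 2 = 0 := by
      have : O 2 ^ 4 = 0 := by
        linear_combination O 2 ^ 2 * sq - O 0 * O 2 * p02 - O 1 * O 2 * p12
      simpa using this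
    refine hj ?_
    fin_cases j <;> assumption
  refine ⟨i, j, fun d e f hAe q1 q2 q3 l0 l1 l2 hgrad hd hf => ⟨?_, ?_, ?_⟩⟩
  · have hdi : d i = 0 := by
      have := (mul_eq_zero.1 (show (![A 1 ^ 2 + A 2 ^ 2 + A 3 ^ 2 - 12 * A 0 ^ 2,
        2 * A 0 * A 1 - A 2 * A 3, 2 * A 0 * A 2 - A 1 * A 3,
        2 * A 0 * A 3 - A 1 * A 2] : Fin 4 → ℂ) i * d i = 0 from ?_)).resolve_left hi
      · exact this
      · have d0 : ∀ k, k ≠ i → d k = 0 := by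
          intro k hk
          obtain ⟨l, rfl⟩ := Fin.exists_succAbove_eq hk
          exact hd l
        rw [← hgrad]
        fin_cases i
        · simp [d0 1 (by decide), d0 2 (by decide), d0 3 (by decide)]
        · simp [d0 0 (by decide), d0 2 (by decide), d0 3 (by decide)]
        · simp [d0 0 (by decide), d0 1 (by decide), d0 3 (by decide)]
        · simp [d0 0 (by decide), d0 1 (by decide), d0 2 (by decide)]
    ext k
    by_cases hk : k = i
    · rw [hk, hdi]
      rfl
    · obtain ⟨l, rfl⟩ := Fin.exists_succAbove_eq hk
      exact hd l
  · obtain ⟨μ, rfl⟩ : ∃ μ : ℂ, e = μ • A := by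
      refine ⟨e k / A k, ?_⟩
      ext l
      simp only [Pi.smul_apply, smul_eq_mul]
      field_simp
      linear_combination hAe k l
    have hμ : μ = 0 := by
      have : μ * (O j * O j) = 0 := by
        simp only [Pi.smul_apply, smul_eq_mul] at q1 q2 q3
        fin_cases j
        · simp only [Fin.zero_eta]
          linear_combination q1 + μ * h.s00
        · simp only [Fin.mk_one]
          linear_combination q2 + μ * h.s11
        · simp only [Fin.reduceFinMk]
          linear_combination q3 + μ * h.s22
      exact (mul_eq_zero.1 this).resolve_right (mul_ne_zero hj hj)
    rw [hμ, zero_smul]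
  · have hjj := mul_ne_zero hj hj
    fin_cases j
    · simp only [Fin.zero_eta] at hf hjj
      rw [hf] at l0 l1 l2
      have f1 : f 1 = 0 := (mul_eq_zero.1 (show O 0 * O 0 * f 1 = 0 by
        linear_combination f 1 * h.s00 + A 1 * l2 + 2 * A 0 * l1)).resolve_left hjj
      have f2 : f 2 = 0 := (mul_eq_zero.1 (show O 0 * O 0 * f 2 = 0 by
        linear_combination f 2 * h.s00 + A 1 * l1 + 2 * A 0 * l2)).resolve_left hjj
      ext k
      fin_cases k <;> assumption
    · simp only [Fin.mk_one] at hf hjj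
      rw [hf] at l0 l1 l2
      have f0 : f 0 = 0 := (mul_eq_zero.1 (show O 1 * O 1 * f 0 = 0 by
        linear_combination f 0 * h.s11 - A 2 * l2 + 2 * A 0 * l0)).resolve_left hjj
      have f2 : f 2 = 0 := (mul_eq_zero.1 (show O 1 * O 1 * f 2 = 0 by
        linear_combination f 2 * h.s11 - A 2 * l0 + 2 * A 0 * l2)).resolve_left hjj
      ext k
      fin_cases k <;> assumption
    · simp only [Fin.reduceFinMk] at hf hjj
      rw [hf] at l0 l1 l2
      have f0 : f 0 = 0 := (mul_eq_zero.1 (show O 2 * O 2 * f 0 = 0 by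
        linear_combination f 0 * h.s22 + A 3 * l1 + 2 * A 0 * l0)).resolve_left hjj
      have f1 : f 1 = 0 := (mul_eq_zero.1 (show O 2 * O 2 * f 1 = 0 by
        linear_combination f 1 * h.s22 + A 3 * l0 + 2 * A 0 * l1)).resolve_left hjj
      ext k
      fin_cases k <;> assumption

/-- The vector of `ℂ¹¹` with the given blocks of even coordinates, with factors `y₀²` and `y₁²`,
and of odd coordinates. -/
def join10 (a b : Fin 4 → ℂ) (o : Fin 3 → ℂ) : Fin 11 → ℂ :=
  ![a 0, a 1, a 2, a 3, b 0, b 1, b 2, b 3, o 0, o 1, o 2]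

theorem exists_eq_join10 (z : Fin 11 → ℂ) : ∃ a b o, join10 a b o = z := by
  refine ⟨![z 0, z 1, z 2, z 3], ![z 4, z 5, z 6, z 7], ![z 8, z 9, z 10], ?_⟩
  ext i
  fin_cases i <;> rfl

theorem join10_injective {a b a' b' : Fin 4 → ℂ} {o o' : Fin 3 → ℂ}
    (h : join10 a b o = join10 a' b' o') : a = a' ∧ b = b' ∧ o = o' := by
  refine ⟨funext fun k => ?_, funext fun k => ?_, funext fun k => ?_⟩
  · fin_cases k
    exacts [congrFun h 0, congrFun h 1, congrFun h 2, congrFun h 3]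
  · fin_cases k
    exacts [congrFun h 4, congrFun h 5, congrFun h 6, congrFun h 7]
  · fin_cases k
    exacts [congrFun h 8, congrFun h 9, congrFun h 10]

theorem join10_zero : join10 0 0 0 = 0 := by
  ext i
  fin_cases i <;> rfl

theorem join10_add (a b a' b' : Fin 4 → ℂ) (o o' : Fin 3 → ℂ) :
    join10 (a + a') (b + b') (o + o') = join10 a b o + join10 a' b' o' := by
  ext i
  fin_cases i <;> rfl

theorem join10_smul (c : ℂ) (a b : Fin 4 → ℂ) (o : Fin 3 → ℂ) :
    join10 (c • a) (c • b) (c • o) = c • join10 a b o := by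
  ext i
  fin_cases i <;> rfl

theorem param10_eq_join10 (y : Fin 2 → ℂ) (A : Fin 4 → ℂ) (O : Fin 3 → ℂ) :
    param10 y A O = join10 (y 0 ^ 2 • A) (y 1 ^ 2 • A) ((y 0 * y 1) • O) := rfl

/-- Equations satisfied by the tangent vectors `(d, e, f)` at the point `(a, b, o)` of the cone
over the threefold. -/
structure Tangent10 (a b : Fin 4 → ℂ) (o : Fin 3 → ℂ) (d e : Fin 4 → ℂ) (f : Fin 3 → ℂ) :
    Prop where
  minor : ∀ k l, a k * e l + d k * b l = a l * e k + d l * b k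
  s00 : 2 * (o 0 * f 0) = a 1 * e 1 + d 1 * b 1 - 4 * (a 0 * e 0 + d 0 * b 0)
  s11 : 2 * (o 1 * f 1) = a 2 * e 2 + d 2 * b 2 - 4 * (a 0 * e 0 + d 0 * b 0)
  s22 : 2 * (o 2 * f 2) = a 3 * e 3 + d 3 * b 3 - 4 * (a 0 * e 0 + d 0 * b 0)
  s01 : o 0 * f 1 + f 0 * o 1 = a 1 * e 2 + d 1 * b 2 - 2 * (a 0 * e 3 + d 0 * b 3)
  s02 : o 0 * f 2 + f 0 * o 2 = 2 * (a 0 * e 2 + d 0 * b 2) - (a 1 * e 3 + d 1 * b 3)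
  s12 : o 1 * f 2 + f 1 * o 2 = a 2 * e 3 + d 2 * b 3 - 2 * (a 0 * e 1 + d 0 * b 1)
  la0 : d 3 * o 1 + a 3 * f 1 - (d 2 * o 2 + a 2 * f 2) = 2 * (d 0 * o 0 + a 0 * f 0)
  la1 : d 3 * o 0 + a 3 * f 0 + (d 1 * o 2 + a 1 * f 2) = 2 * (d 0 * o 1 + a 0 * f 1)
  la2 : d 1 * o 1 + a 1 * f 1 - (d 2 * o 0 + a 2 * f 0) = 2 * (d 0 * o 2 + a 0 * f 2)
  lb0 : e 3 * o 1 + b 3 * f 1 - (e 2 * o 2 + b 2 * f 2) = 2 * (e 0 * o 0 + b 0 * f 0)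
  lb1 : e 3 * o 0 + b 3 * f 0 + (e 1 * o 2 + b 1 * f 2) = 2 * (e 0 * o 1 + b 0 * f 1)
  lb2 : e 1 * o 1 + b 1 * f 1 - (e 2 * o 0 + b 2 * f 0) = 2 * (e 0 * o 2 + b 0 * f 2)
  ca : (a 1 ^ 2 + a 2 ^ 2 + a 3 ^ 2 - 12 * a 0 ^ 2) * d 0 + (2 * a 0 * a 1 - a 2 * a 3) * d 1
    + (2 * a 0 * a 2 - a 1 * a 3) * d 2 + (2 * a 0 * a 3 - a 1 * a 2) * d 3 = 0
  cb : (b 1 ^ 2 + b 2 ^ 2 + b 3 ^ 2 - 12 * b 0 ^ 2) * e 0 + (2 * b 0 * b 1 - b 2 * b 3) * e 1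
    + (2 * b 0 * b 2 - b 1 * b 3) * e 2 + (2 * b 0 * b 3 - b 1 * b 2) * e 3 = 0

theorem tangent10_of_listDeriv {a b d e : Fin 4 → ℂ} {o f : Fin 3 → ℂ}
    (h : ∀ ρ ∈ rules10, listDeriv (join10 a b o) (join10 d e f) ρ.lead -
      (ρ.tail.map fun t => t.1 * listDeriv (join10 a b o) (join10 d e f) t.2).sum = 0) :
    Tangent10 a b o d e f := by
  simp only [rules10, List.forall_mem_cons] at h
  simp [listDeriv, join10] at h
  obtain ⟨m01, m02, m03, m12, m13, m23, s00, s11, s22, s01, s02, s12, la0, lb0, la1, lb1, la2,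
    lb2, ca, -, -, cb⟩ := h
  constructor
  · intro k l
    fin_cases k <;> fin_cases l
    · rfl
    · simp only [Fin.zero_eta, Fin.mk_one]
      linear_combination m01
    · simp only [Fin.zero_eta, Fin.reduceFinMk]
      linear_combination m02
    · simp only [Fin.zero_eta, Fin.reduceFinMk]
      linear_combination m03
    · simp only [Fin.zero_eta, Fin.mk_one]
      linear_combination -m01
    · rfl
    · simp only [Fin.mk_one, Fin.reduceFinMk]
      linear_combination m12
    · simp only [Fin.mk_one, Fin.reduceFinMk]
      linear_combination m13
    · simp only [Fin.zero_eta, Fin.reduceFinMk]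
      linear_combination -m02
    · simp only [Fin.mk_one, Fin.reduceFinMk]
      linear_combination -m12
    · rfl
    · simp only [Fin.reduceFinMk]
      linear_combination m23
    · simp only [Fin.zero_eta, Fin.reduceFinMk]
      linear_combination -m03
    · simp only [Fin.mk_one, Fin.reduceFinMk]
      linear_combination -m13
    · simp only [Fin.reduceFinMk]
      linear_combination -m23
    · rfl
  · linear_combination s00
  · linear_combination s11
  · linear_combination s22
  · linear_combination s01
  · linear_combination s02
  · linear_combination s12
  · linear_combination -2 * la0
  · linear_combination -2 * la1
  · linear_combination -2 * la2
  · linear_combination -2 * lb0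
  · linear_combination -2 * lb1
  · linear_combination -2 * lb2
  · linear_combination -4 * ca
  · linear_combination -4 * cb

theorem Tangent10.swap {a b d e : Fin 4 → ℂ} {o f : Fin 3 → ℂ} (h : Tangent10 a b o d e f) :
    Tangent10 b a o e d f where
  minor k l := by linear_combination -h.minor k l
  s00 := by linear_combination h.s00
  s11 := by linear_combination h.s11
  s22 := by linear_combination h.s22
  s01 := by linear_combination h.s01 + h.minor 1 2 - 2 * h.minor 0 3
  s02 := by linear_combination h.s02 + 2 * h.minor 0 2 - h.minor 1 3
  s12 := by linear_combination h.s12 + h.minor 2 3 - 2 * h.minor 0 1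
  la0 := h.lb0
  la1 := h.lb1
  la2 := h.lb2
  lb0 := h.la0
  lb1 := h.la1
  lb2 := h.la2
  ca := h.cb
  cb := h.ca

theorem finrank_tangentSpace_le {n r : ℕ} {W : Set (ProjSpace n)} {P : ProjSpace n}
    (f : (Fin (n + 1) → ℂ) →ₗ[ℂ] (Fin r → ℂ)) (hf : ∀ v ∈ tangentSpace W P, f v = 0 → v = 0) :
    Module.finrank ℂ (tangentSpace W P) ≤ r := by
  have h : Function.Injective (f ∘ₗ (tangentSpace W P).subtype) := by
    rw [← LinearMap.ker_eq_bot, LinearMap.ker_eq_bot']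
    exact fun v hv => Subtype.ext (hf v v.2 hv)
  simpa using LinearMap.finrank_le_finrank_of_injective h

theorem eq_zero_of_ofEvenOdd_eq_zero {A : Fin 4 → ℂ} {O : Fin 3 → ℂ} (h : ofEvenOdd A O = 0) :
    A = 0 ∧ O = 0 := by
  have p := fun i => congrFun h i
  have p0 := p 0
  have p1 := p 1
  have p2 := p 2
  have p3 := p 3
  have p4 := p 4
  have p5 := p 5
  have p6 := p 6
  simp only [ofEvenOdd, Matrix.cons_val, Pi.zero_apply] at p0 p1 p2 p3 p4 p5 p6
  constructor <;> ext k <;> fin_cases k <;>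
    simp only [Fin.zero_eta, Fin.mk_one, Fin.reduceFinMk, Pi.zero_apply]
  · exact p6
  · linear_combination p0 + p2
  · linear_combination p1 + p4
  · linear_combination p3 + p5
  · linear_combination p0 - p2
  · linear_combination p1 - p4
  · linear_combination p3 - p5

theorem ofEvenOdd_add (A A' : Fin 4 → ℂ) (O O' : Fin 3 → ℂ) :
    ofEvenOdd (A + A') (O + O') = ofEvenOdd A O + ofEvenOdd A' O' := by
  ext i
  fin_cases i <;> simp [ofEvenOdd] <;> ring

theorem ofEvenOdd_smul (c : ℂ) (A : Fin 4 → ℂ) (O : Fin 3 → ℂ) :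
    ofEvenOdd (c • A) (c • O) = c • ofEvenOdd A O := by
  ext i
  fin_cases i <;> simp [ofEvenOdd] <;> ring

/-- Four linear forms without a common zero on the tangent space at `(A, t²A, tO)`, `t ≠ 0`. Since
the quotient map is étale there, a tangent vector is determined by the derivative of `t` and a
tangent vector of the cone over the Del Pezzo surface. -/
theorem EvenOddEqs.exists_tangent_coordinates_of_ne_zero {A : Fin 4 → ℂ} {O : Fin 3 → ℂ}
    (h : EvenOddEqs A O) (hA : A ≠ 0) {t : ℂ} (ht : t ≠ 0) :
    ∃ (i : Fin 4) (j : Fin 3 → Fin 7), ∀ (d e : Fin 4 → ℂ) (f : Fin 3 → ℂ),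
      Tangent10 A (t ^ 2 • A) (t • O) d e f → e i - t ^ 2 * d i = 0 →
      (∀ k, ofEvenOdd (t • d) f (j k) = 0) → d = 0 ∧ e = 0 ∧ f = 0 := by
  obtain ⟨i, hi⟩ : ∃ i, A i ≠ 0 := by
    by_contra hcon
    push Not at hcon
    exact hA (funext hcon)
  have hx : ofEvenOdd A O ≠ 0 := fun h0 => hA (eq_zero_of_ofEvenOdd_eq_zero h0).1
  obtain ⟨j, hj⟩ := h.delPezzoEqs.exists_tangent_coordinates hx
  refine ⟨i, j, fun d e f T hei hjf => ?_⟩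
  have he : e = t ^ 2 • d := by
    ext l
    have := T.minor i l
    simp only [Pi.smul_apply, smul_eq_mul] at this ⊢
    refine mul_left_cancel₀ hi ?_
    linear_combination this + A l * hei
  subst he
  obtain ⟨-, s00, s11, s22, s01, s02, s12, l0, l1, l2, -, -, -, -, -⟩ := T
  simp only [Pi.smul_apply, smul_eq_mul] at s00 s11 s22 s01 s02 s12 l0 l1 l2
  have ht2 := mul_ne_zero two_ne_zero ht
  have hzero : ofEvenOdd (t • d) f = 0 := by
    refine hj _ ?_ hjf
    have s00' : O 0 * f 0 = A 1 * (t * d 1) - 4 * (A 0 * (t * d 0)) :=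
      mul_left_cancel₀ ht2 (by linear_combination s00)
    have s11' : O 1 * f 1 = A 2 * (t * d 2) - 4 * (A 0 * (t * d 0)) :=
      mul_left_cancel₀ ht2 (by linear_combination s11)
    have s22' : O 2 * f 2 = A 3 * (t * d 3) - 4 * (A 0 * (t * d 0)) :=
      mul_left_cancel₀ ht2 (by linear_combination s22)
    have s01' : O 0 * f 1 + f 0 * O 1 = A 1 * (t * d 2) + (t * d 1) * A 2
        - 2 * (A 0 * (t * d 3) + t * d 0 * A 3) :=
      mul_left_cancel₀ ht (by linear_combination s01)
    have s02' : O 0 * f 2 + f 0 * O 2 = 2 * (A 0 * (t * d 2) + (t * d 0) * A 2)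
        - (A 1 * (t * d 3) + t * d 1 * A 3) :=
      mul_left_cancel₀ ht (by linear_combination s02)
    have s12' : O 1 * f 2 + f 1 * O 2 = A 2 * (t * d 3) + (t * d 2) * A 3
        - 2 * (A 0 * (t * d 1) + t * d 0 * A 1) :=
      mul_left_cancel₀ ht (by linear_combination s12)
    clear s00 s11 s22 s01 s02 s12
    constructor <;> simp [ofEvenOdd]
    · linear_combination -s00' / 2
    · linear_combination -s11' / 2
    · linear_combination -s22' / 2
    · linear_combination s02' / 4 + l1 / 4
    · linear_combination -s01' / 4 + l2 / 4
    · linear_combination -s12' / 4 - l0 / 4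
    · linear_combination s02' / 4 - l1 / 4
    · linear_combination -s01' / 4 - l2 / 4
    · linear_combination -s12' / 4 + l0 / 4
  obtain ⟨hd, hf⟩ := eq_zero_of_ofEvenOdd_eq_zero hzero
  have hd0 : d = 0 := (smul_eq_zero.1 hd).resolve_left ht
  exact ⟨hd0, by rw [hd0, smul_zero], hf⟩

theorem finrank_tangentSpace_W10_le {P : ProjSpace 10} (hP : P ∈ W10) {a b : Fin 4 → ℂ}
    {o : Fin 3 → ℂ} (hz : join10 a b o = P.rep) (ℓ : (Fin 11 → ℂ) →ₗ[ℂ] (Fin 4 → ℂ))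
    (h : ∀ d e f, Tangent10 a b o d e f → ℓ (join10 d e f) = 0 → d = 0 ∧ e = 0 ∧ f = 0) :
    Module.finrank ℂ (tangentSpace W10 P) ≤ 4 := by
  refine finrank_tangentSpace_le ℓ fun v hv hv0 => ?_
  rw [mem_tangentSpace_W10 hP, ← hz] at hv
  obtain ⟨d, e, f, rfl⟩ := exists_eq_join10 v
  obtain ⟨rfl, rfl, rfl⟩ := h d e f (tangent10_of_listDeriv hv) hv0
  exact join10_zero

theorem join10_comp_a (a b : Fin 4 → ℂ) (o : Fin 3 → ℂ) :
    ∀ k, join10 a b o (![0, 1, 2, 3] k) = a k := by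
  intro k
  fin_cases k <;> rfl

theorem join10_comp_b (a b : Fin 4 → ℂ) (o : Fin 3 → ℂ) :
    ∀ k, join10 a b o (![4, 5, 6, 7] k) = b k := by
  intro k
  fin_cases k <;> rfl

theorem join10_comp_o (a b : Fin 4 → ℂ) (o : Fin 3 → ℂ) :
    ∀ k, join10 a b o (![8, 9, 10] k) = o k := by
  intro k
  fin_cases k <;> rfl

/-- A point of the threefold is smooth if it is not the image of a fixed point of the involution. -/
theorem finrank_tangentSpace_W10_le_four {P : ProjSpace 10} (hP : P ∈ W10) {y : Fin 2 → ℂ}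
    {A : Fin 4 → ℂ} {O : Fin 3 → ℂ} (h : EvenOddEqs A O) (hz : param10 y A O = P.rep)
    (hns : O ≠ 0 ∨ y 0 * y 1 ≠ 0) : Module.finrank ℂ (tangentSpace W10 P) ≤ 4 := by
  rw [param10_eq_join10] at hz
  by_cases hy : y 0 * y 1 = 0
  · have hO := hns.resolve_right (not_not.2 hy)
    have hne : ∀ k, y k ≠ 0 → y k ^ 2 • O ≠ 0 := fun k hk => smul_ne_zero (pow_ne_zero 2 hk) hO
    rw [hy, zero_smul] at hz
    rcases mul_eq_zero.1 hy with h0 | h1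
    · rw [h0, zero_pow two_ne_zero, zero_smul] at hz
      have h1 : y 1 ≠ 0 := by
        intro h1
        rw [h1, zero_pow two_ne_zero, zero_smul, join10_zero] at hz
        exact P.rep_nonzero hz.symm
      obtain ⟨i, j, hij⟩ := (h.smul (y 1 ^ 2)).exists_tangent_coordinates (hne 1 h1)
      refine finrank_tangentSpace_W10_le hP hz (LinearMap.funLeft ℂ ℂ
        ![![4, 5, 6, 7] (i.succAbove 0), ![4, 5, 6, 7] (i.succAbove 1),
          ![4, 5, 6, 7] (i.succAbove 2), ![8, 9, 10] j]) fun d e f T hℓ => ?_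
      have T' := T.swap
      have v0 := congrFun hℓ 0
      have v1 := congrFun hℓ 1
      have v2 := congrFun hℓ 2
      have v3 := congrFun hℓ 3
      simp only [LinearMap.funLeft_apply, Matrix.cons_val, join10_comp_b, join10_comp_o,
        Pi.zero_apply] at v0 v1 v2 v3
      obtain ⟨h1, h2, h3⟩ := hij e d f (fun k l => by simpa using T'.minor k l)
        (by simpa [mul_assoc] using T'.s00.symm) (by simpa [mul_assoc] using T'.s11.symm)
        (by simpa [mul_assoc] using T'.s22.symm)
        (by simpa [mul_assoc] using T'.la0) (by simpa [mul_assoc] using T'.la1)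
        (by simpa [mul_assoc] using T'.la2) T'.ca
        (fun k => by fin_cases k; exacts [v0, v1, v2]) v3
      exact ⟨h2, h1, h3⟩
    · rw [h1, zero_pow two_ne_zero, zero_smul] at hz
      have h0 : y 0 ≠ 0 := by
        intro h0
        rw [h0, zero_pow two_ne_zero, zero_smul, join10_zero] at hz
        exact P.rep_nonzero hz.symm
      obtain ⟨i, j, hij⟩ := (h.smul (y 0 ^ 2)).exists_tangent_coordinates (hne 0 h0)
      refine finrank_tangentSpace_W10_le hP hz (LinearMap.funLeft ℂ ℂ
        ![![0, 1, 2, 3] (i.succAbove 0), ![0, 1, 2, 3] (i.succAbove 1),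
          ![0, 1, 2, 3] (i.succAbove 2), ![8, 9, 10] j]) fun d e f T hℓ => ?_
      have v0 := congrFun hℓ 0
      have v1 := congrFun hℓ 1
      have v2 := congrFun hℓ 2
      have v3 := congrFun hℓ 3
      simp only [LinearMap.funLeft_apply, Matrix.cons_val, join10_comp_a, join10_comp_o,
        Pi.zero_apply] at v0 v1 v2 v3
      exact hij d e f (fun k l => by simpa using T.minor k l)
        (by simpa [mul_assoc] using T.s00.symm) (by simpa [mul_assoc] using T.s11.symm)
        (by simpa [mul_assoc] using T.s22.symm)
        (by simpa [mul_assoc] using T.la0) (by simpa [mul_assoc] using T.la1)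
        (by simpa [mul_assoc] using T.la2) T.ca
        (fun k => by fin_cases k; exacts [v0, v1, v2]) v3
  · have h0 := left_ne_zero_of_mul hy
    have h1 := right_ne_zero_of_mul hy
    have hz' : join10 (y 0 ^ 2 • A) ((y 1 / y 0) ^ 2 • y 0 ^ 2 • A) ((y 1 / y 0) • y 0 ^ 2 • O)
        = P.rep := by
      rw [← hz, smul_smul, smul_smul]
      congr 2 <;> field_simp
    have hA : y 0 ^ 2 • A ≠ 0 := by
      intro hA
      have s := (h.smul (y 0 ^ 2))
      have hO : y 0 ^ 2 • O = 0 := by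
        have s00 := s.s00
        have s11 := s.s11
        have s22 := s.s22
        simp only [hA] at s00 s11 s22
        ext k
        fin_cases k
        · simpa using s00
        · simpa using s11
        · simpa using s22
      rw [hA, hO, smul_zero, smul_zero, join10_zero] at hz'
      exact P.rep_nonzero hz'.symm
    obtain ⟨i, j, hij⟩ := (h.smul (y 0 ^ 2)).exists_tangent_coordinates_of_ne_zero hA
      (div_ne_zero h1 h0)
    let w : (Fin 11 → ℂ) → Fin 7 → ℂ := fun v =>
      ofEvenOdd ((y 1 / y 0) • v ∘ ![0, 1, 2, 3]) (v ∘ ![8, 9, 10])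
    have w_add : ∀ v v', w (v + v') = w v + w v' := by
      intro v v'
      rw [← ofEvenOdd_add, ← smul_add]
      rfl
    have w_smul : ∀ (c : ℂ) v, w (c • v) = c • w v := by
      intro c v
      rw [← ofEvenOdd_smul, smul_comm c]
      rfl
    let ℓ : (Fin 11 → ℂ) →ₗ[ℂ] (Fin 4 → ℂ) :=
      { toFun := fun v => ![v (![4, 5, 6, 7] i) - (y 1 / y 0) ^ 2 * v (![0, 1, 2, 3] i),
          w v (j 0), w v (j 1), w v (j 2)]
        map_add' := fun v v' => by
          rw [w_add]
          ext k
          fin_cases k <;> simp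
          ring
        map_smul' := fun c v => by
          rw [w_smul]
          ext k
          fin_cases k <;> simp
          ring }
    refine finrank_tangentSpace_W10_le hP hz' ℓ fun d e f T hℓ => ?_
    have v0 := congrFun hℓ 0
    have v1 := congrFun hℓ 1
    have v2 := congrFun hℓ 2
    have v3 := congrFun hℓ 3
    have hw : w (join10 d e f) = ofEvenOdd ((y 1 / y 0) • d) f := by
      simp only [w]
      congr 1
      · congr 1
        funext k
        exact join10_comp_a d e f k
      · funext k
        exact join10_comp_o d e f k
    simp only [ℓ, LinearMap.coe_mk, AddHom.coe_mk, hw, Matrix.cons_val, join10_comp_a,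
      join10_comp_b, Pi.zero_apply] at v0 v1 v2 v3
    exact hij d e f T v0 fun k => by fin_cases k; exacts [v1, v2, v3]

/-! ### The singular points -/

/-- The nodes of the Cayley cubic. -/
def nodeEven : Fin 4 → Fin 4 → ℂ :=
  ![![1, 2, 2, 2], ![1, 2, -2, -2], ![1, -2, -2, 2], ![1, -2, 2, -2]]

/-- The coordinate vectors of the eight singular points of the threefold: the nodes of the two
Cayley cubics `y₁ = 0` and `y₀ = 0`. -/
def nodeVec (b : Fin 2) (i : Fin 4) : Fin 11 → ℂ :=
  ![join10 (nodeEven i) 0 0, join10 0 (nodeEven i) 0] b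

theorem nodeEven_zero (i : Fin 4) : nodeEven i 0 = 1 := by
  fin_cases i <;> rfl

theorem nodeVec_ne_zero (b : Fin 2) (i : Fin 4) : nodeVec b i ≠ 0 := by
  intro h
  fin_cases b
  · have := congrFun h 0
    simp [nodeVec, join10, nodeEven_zero] at this
  · have := congrFun h 4
    simp [nodeVec, join10, nodeEven_zero] at this

/-- The eight singular points of the threefold of genus 10. -/
def node (b : Fin 2) (i : Fin 4) : ProjSpace 10 :=
  Projectivization.mk ℂ (nodeVec b i) (nodeVec_ne_zero b i)

theorem evenOddEqs_nodeEven (i : Fin 4) : EvenOddEqs (nodeEven i) 0 := by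
  constructor <;> fin_cases i <;> simp [nodeEven] <;> norm_num

theorem EvenOddEqs.exists_eq_smul_nodeEven {A : Fin 4 → ℂ} (h : EvenOddEqs A 0) :
    ∃ i, A = A 0 • nodeEven i := by
  have s00 := h.s00
  have s11 := h.s11
  have s22 := h.s22
  have s01 := h.s01
  simp only [Pi.zero_apply, mul_zero] at s00 s11 s22 s01
  have h1 : A 1 = 2 * A 0 ∨ A 1 = -(2 * A 0) :=
    sq_eq_sq_iff_eq_or_eq_neg.1 (by linear_combination -s00)
  have h2 : A 2 = 2 * A 0 ∨ A 2 = -(2 * A 0) :=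
    sq_eq_sq_iff_eq_or_eq_neg.1 (by linear_combination -s11)
  have h3 : A 0 = 0 → A 3 = 0 := fun h0 => by simpa [h0] using s22.symm
  have h3' : ∀ c, A 1 * A 2 = 2 * A 0 * (A 0 * c) → A 3 = A 0 * c := by
    intro c hc
    by_cases h0 : A 0 = 0
    · rw [h3 h0, h0, zero_mul]
    · exact mul_left_cancel₀ (mul_ne_zero two_ne_zero h0) (by linear_combination hc + s01)
  have key : ∀ i, A 1 = A 0 * nodeEven i 1 → A 2 = A 0 * nodeEven i 2 →
      A 3 = A 0 * nodeEven i 3 → A = A 0 • nodeEven i := by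
    intro i k1 k2 k3
    ext k
    fin_cases k
    · simp [nodeEven_zero]
    · exact k1
    · exact k2
    · exact k3
  rcases h1 with h1 | h1 <;> rcases h2 with h2 | h2
  · exact ⟨0, key 0 (by simp [nodeEven, h1]; ring) (by simp [nodeEven, h2]; ring)
      (h3' _ (by simp only [nodeEven, Matrix.cons_val, h1, h2]; ring))⟩
  · exact ⟨1, key 1 (by simp [nodeEven, h1]; ring) (by simp [nodeEven, h2]; ring)
      (h3' _ (by simp only [nodeEven, Matrix.cons_val, h1, h2]; ring))⟩
  · exact ⟨3, key 3 (by simp [nodeEven, h1]; ring) (by simp [nodeEven, h2]; ring)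
      (h3' _ (by simp only [nodeEven, Matrix.cons_val, h1, h2]; ring))⟩
  · exact ⟨2, key 2 (by simp [nodeEven, h1]; ring) (by simp [nodeEven, h2]; ring)
      (h3' _ (by simp only [nodeEven, Matrix.cons_val, h1, h2]; ring))⟩

/-- At the nodes `(A, 0, 0)` and `(0, A, 0)` the differentials of the generators of the ideal vanish
on all vectors whose odd part is zero and whose component in the zero block is a multiple of `A`. -/
theorem listDeriv_eq_zero_of_node {A : Fin 4 → ℂ} (h : EvenOddEqs A 0) (d : Fin 4 → ℂ) (μ : ℂ) :
    (∀ ρ ∈ rules10, listDeriv (join10 A 0 0) (join10 d (μ • A) 0) ρ.lead -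
      (ρ.tail.map fun t => t.1 * listDeriv (join10 A 0 0) (join10 d (μ • A) 0) t.2).sum = 0) ∧
    (∀ ρ ∈ rules10, listDeriv (join10 0 A 0) (join10 (μ • A) d 0) ρ.lead -
      (ρ.tail.map fun t => t.1 * listDeriv (join10 0 A 0) (join10 (μ • A) d 0) t.2).sum = 0) := by
  have hc := h.cayleyCubic_eq_zero
  rw [cayleyCubic] at hc
  obtain ⟨s00, s11, s22, s01, s02, s12, -, -, -⟩ := h
  simp only [Pi.zero_apply, mul_zero] at s00 s11 s22 s01 s02 s12
  simp only [rules10, List.forall_mem_cons]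
  constructor
  · simp [listDeriv, join10]
    refine ⟨by ring, by ring, by ring, by ring, by ring, by ring, ?_, ?_, ?_, ?_, ?_, ?_, ?_, ?_⟩
    · linear_combination μ * s00
    · linear_combination μ * s11
    · linear_combination μ * s22
    · linear_combination μ * s01
    · linear_combination μ * s02
    · linear_combination μ * s12
    · linear_combination d 0 / 4 * (s00 + s11 + s22) - d 1 / 4 * s12 + d 2 / 4 * s02
        - d 3 / 4 * s01
    · linear_combination -μ / 4 * hc
  · simp [listDeriv, join10]
    refine ⟨by ring, by ring, by ring, by ring, by ring, by ring, ?_, ?_, ?_, ?_, ?_, ?_, ?_, ?_⟩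
    · linear_combination μ * s00
    · linear_combination μ * s11
    · linear_combination μ * s22
    · linear_combination μ * s01
    · linear_combination μ * s02
    · linear_combination μ * s12
    · linear_combination -μ / 4 * hc
    · linear_combination d 0 / 4 * (s00 + s11 + s22) - d 1 / 4 * s12 + d 2 / 4 * s02
        - d 3 / 4 * s01

/-- The tangent space at a node contains the cone over the span of one Cayley cubic and a point of
the other. -/
theorem join10_mem_tangentSpace_node {P : ProjSpace 10} {b : Fin 2} {i : Fin 4} (hP : P ∈ W10)
    {c : ℂ} (hz : P.rep = c • nodeVec b i) (d : Fin 4 → ℂ) (μ : ℂ) :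
    (![join10 d (μ • c • nodeEven i) 0, join10 (μ • c • nodeEven i) d 0] : Fin 2 → Fin 11 → ℂ) b ∈
      tangentSpace W10 P := by
  have h : EvenOddEqs (c • nodeEven i) 0 := by
    simpa using (evenOddEqs_nodeEven i).smul c
  obtain ⟨h0, h1⟩ := listDeriv_eq_zero_of_node h d μ
  rw [mem_tangentSpace_W10 hP, hz]
  fin_cases b
  · simpa [nodeVec, ← join10_smul] using h0
  · simpa [nodeVec, ← join10_smul] using h1

theorem five_le_finrank_tangentSpace_node {P : ProjSpace 10} {b : Fin 2} {i : Fin 4} (hP : P ∈ W10)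
    {c : ℂ} (hc : c ≠ 0) (hz : P.rep = c • nodeVec b i) :
    5 ≤ Module.finrank ℂ (tangentSpace W10 P) := by
  let g : (Fin 5 → ℂ) →ₗ[ℂ] (Fin 11 → ℂ) :=
    { toFun := fun x => (![join10 (x ∘ Fin.castSucc) (x 4 • c • nodeEven i) 0,
        join10 (x 4 • c • nodeEven i) (x ∘ Fin.castSucc) 0] : Fin 2 → Fin 11 → ℂ) b
      map_add' := fun x x' => by
        ext k
        fin_cases b <;> fin_cases k <;> simp [join10] <;> ring
      map_smul' := fun r x => by
        ext k
        fin_cases b <;> fin_cases k <;> simp [join10] <;> ring }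
  have hg : ∀ x, g x ∈ tangentSpace W10 P := fun x =>
    join10_mem_tangentSpace_node hP hz (x ∘ Fin.castSucc) (x 4)
  have hinj : Function.Injective (g.codRestrict _ hg) := by
    rw [← LinearMap.ker_eq_bot, LinearMap.ker_eq_bot']
    intro x hx
    have hx0 : g x = 0 := congrArg Subtype.val hx
    have key : x ∘ Fin.castSucc = 0 ∧ x 4 • c • nodeEven i = 0 := by
      fin_cases b
      · obtain ⟨h1, h2, -⟩ := join10_injective (hx0.trans join10_zero.symm)
        exact ⟨h1, h2⟩
      · obtain ⟨h1, h2, -⟩ := join10_injective (hx0.trans join10_zero.symm)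
        exact ⟨h2, h1⟩
    have h4 : x 4 = 0 := by
      have := congrFun key.2 0
      simpa [nodeEven_zero, hc] using this
    ext k
    refine Fin.lastCases h4 (fun l => ?_) k
    exact congrFun key.1 l
  simpa using LinearMap.finrank_le_finrank_of_injective hinj

theorem nodeVec_zero_eq_param10 (i : Fin 4) : nodeVec 0 i = param10 ![1, 0] (nodeEven i) 0 := by
  rw [param10_eq_join10]
  simp [nodeVec]

theorem nodeVec_one_eq_param10 (i : Fin 4) : nodeVec 1 i = param10 ![0, 1] (nodeEven i) 0 := by
  rw [param10_eq_join10]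
  simp [nodeVec]

theorem node_mem_W10 (b : Fin 2) (i : Fin 4) : node b i ∈ W10 := by
  rw [node, mk_mem_iff, mem_W10_iff]
  refine ⟨nodeVec_ne_zero b i, ?_⟩
  fin_cases b
  · exact ⟨_, _, _, by simp, evenOddEqs_nodeEven i, (nodeVec_zero_eq_param10 i).symm⟩
  · exact ⟨_, _, _, by simp, evenOddEqs_nodeEven i, (nodeVec_one_eq_param10 i).symm⟩

theorem mem_singularPoints_W10 {P : ProjSpace 10} :
    P ∈ singularPoints W10 ↔ ∃ b i, P = node b i := by
  rw [singularPoints, Set.mem_ofPred_eq, projDim_W10]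
  constructor
  · rintro ⟨hP, hdim⟩
    obtain ⟨-, y, A, O, hy, h, hz⟩ := mem_W10_iff.1 (rep_mem_affineCone.2 hP)
    have hns : ¬(O ≠ 0 ∨ y 0 * y 1 ≠ 0) := fun hns =>
      absurd (finrank_tangentSpace_W10_le_four hP h hz hns) (not_le.2 hdim)
    push Not at hns
    obtain ⟨rfl, hyy⟩ := hns
    obtain ⟨i, hA⟩ := h.exists_eq_smul_nodeEven
    have hrep : ∀ b (c : ℂ), c • nodeVec b i = P.rep → P = node b i := by
      intro b c hc
      rw [← P.mk_rep, node, Projectivization.mk_eq_mk_iff']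
      exact ⟨c, hc⟩
    rw [param10_eq_join10, hA, smul_zero] at hz
    rcases mul_eq_zero.1 hyy with h0 | h1
    · refine ⟨1, i, hrep 1 (y 1 ^ 2 * A 0) ?_⟩
      rw [← hz, h0]
      simp [nodeVec, ← join10_smul, mul_smul]
    · refine ⟨0, i, hrep 0 (y 0 ^ 2 * A 0) ?_⟩
      rw [← hz, h1]
      simp [nodeVec, ← join10_smul, mul_smul]
  · rintro ⟨b, i, rfl⟩
    obtain ⟨a, ha⟩ := Projectivization.exists_smul_eq_mk_rep ℂ (nodeVec b i) (nodeVec_ne_zero b i)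
    exact ⟨node_mem_W10 b i,
      five_le_finrank_tangentSpace_node (node_mem_W10 b i) a.ne_zero ha.symm⟩

theorem nodeEven_injective : Function.Injective nodeEven := by
  intro i j h
  have c1 := congrFun h 1
  have c2 := congrFun h 2
  fin_cases i <;> fin_cases j <;>
    first | rfl | (exfalso; revert c1 c2; simp [nodeEven]; try norm_num)

theorem node_injective {b b' : Fin 2} {i i' : Fin 4} (h : node b i = node b' i') :
    b = b' ∧ i = i' := by
  obtain ⟨c, hc⟩ := (Projectivization.mk_eq_mk_iff' ℂ _ _ _ _).1 h
  have hinj : ∀ j j', c • nodeEven j = nodeEven j' → j' = j := by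
    intro j j' hj
    have c0 := congrFun hj 0
    simp only [Pi.smul_apply, nodeEven_zero, smul_eq_mul, mul_one] at c0
    rw [c0, one_smul] at hj
    exact (nodeEven_injective hj).symm
  have hzero : ∀ j, nodeEven j ≠ 0 := by
    intro j hj
    have := congrFun hj 0
    simp [nodeEven_zero] at this
  fin_cases b <;> fin_cases b' <;> simp only [nodeVec, Fin.zero_eta, Fin.mk_one, Fin.isValue,
    Matrix.cons_val] at hc <;> rw [← join10_smul] at hc
  · exact ⟨rfl, hinj _ _ (join10_injective hc).1⟩
  · exact absurd ((join10_injective hc).1.symm.trans (smul_zero c)) (hzero i)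
  · exact absurd ((join10_injective hc).2.1.symm.trans (smul_zero c)) (hzero i)
  · exact ⟨rfl, hinj _ _ (join10_injective hc).2.1⟩

/-- The singular points are labelled by the vertices of the configuration. -/
def nodeEquiv : Fin 2 × Fin 4 ≃ singularPoints W10 :=
  Equiv.ofBijective (fun p => ⟨node p.1 p.2, mem_singularPoints_W10.2 ⟨p.1, p.2, rfl⟩⟩) <| by
    constructor
    · rintro ⟨b, i⟩ ⟨b', i'⟩ h
      obtain ⟨rfl, rfl⟩ := node_injective (congrArg Subtype.val h)
      rfl
    · rintro ⟨P, hP⟩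
      obtain ⟨b, i, rfl⟩ := mem_singularPoints_W10.1 hP
      exact ⟨(b, i), rfl⟩

theorem ncard_singularPoints_W10 : (singularPoints W10).ncard = 8 := by
  rw [← Nat.card_coe_set_eq, ← Nat.card_congr nodeEquiv]
  simp

/-! ### The configuration of the singular points -/

theorem associatedPoints_mk_iff {n : ℕ} {W : Set (ProjSpace n)} {u v : Fin (n + 1) → ℂ}
    (hu : u ≠ 0) (hv : v ≠ 0) :
    AssociatedPoints W (Projectivization.mk ℂ u hu) (Projectivization.mk ℂ v hv) ↔
      Projectivization.mk ℂ u hu ≠ Projectivization.mk ℂ v hv ∧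
        ∀ α β : ℂ, α • u + β • v ≠ 0 → α • u + β • v ∈ affineCone W := by
  rw [AssociatedPoints, Projectivization.submodule_mk, Projectivization.submodule_mk]
  refine and_congr_right fun _ => ⟨fun h α β h0 => ?_, fun h R hR => ?_⟩
  · rw [← mk_mem_iff h0]
    refine h _ ?_
    rw [Projectivization.submodule_mk, Submodule.span_singleton_le_iff_mem, Submodule.mem_sup]
    exact ⟨_, Submodule.smul_mem _ α (Submodule.mem_span_singleton_self u), _,
      Submodule.smul_mem _ β (Submodule.mem_span_singleton_self v), rfl⟩
  · rw [Projectivization.submodule_eq, Submodule.span_singleton_le_iff_mem,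
      ← Submodule.span_union, Set.singleton_union, Submodule.mem_span_pair] at hR
    obtain ⟨α, β, hR⟩ := hR
    rw [← rep_mem_affineCone, ← hR]
    exact h α β (hR ▸ R.rep_nonzero)

/-- The line joining two nodes of the Cayley cubic is contained in it. -/
theorem cayleyCubic_nodeEven (α β : ℂ) (i j : Fin 4) :
    cayleyCubic (α • nodeEven i + β • nodeEven j) = 0 := by
  fin_cases i <;> fin_cases j <;> simp [cayleyCubic, nodeEven] <;> ring

theorem join10_mem_affineCone_W10_iff {a b : Fin 4 → ℂ} {o : Fin 3 → ℂ} (h : join10 a b o ≠ 0) :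
    join10 a b o ∈ affineCone W10 ↔ ∃ (y : Fin 2 → ℂ) (A : Fin 4 → ℂ) (O : Fin 3 → ℂ), y ≠ 0 ∧
      EvenOddEqs A O ∧ a = y 0 ^ 2 • A ∧ b = y 1 ^ 2 • A ∧ o = (y 0 * y 1) • O := by
  rw [mem_W10_iff]
  constructor
  · rintro ⟨-, y, A, O, hy, hAO, hz⟩
    rw [param10_eq_join10] at hz
    obtain ⟨h1, h2, h3⟩ := join10_injective hz
    exact ⟨y, A, O, hy, hAO, h1.symm, h2.symm, h3.symm⟩
  · rintro ⟨y, A, O, hy, hAO, rfl, rfl, rfl⟩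
    exact ⟨h, y, A, O, hy, hAO, rfl⟩

/-- Two nodes in the same block are joined by a line in the Cayley cubic. The line which joins the
same node in both blocks is the image of a curve `ℙ¹ × {node}`. The midpoint of two different nodes
in different blocks violates the proportionality of the two blocks. -/
theorem associatedPoints_node_iff {b b' : Fin 2} {i j : Fin 4} :
    AssociatedPoints W10 (node b i) (node b' j) ↔ (b = b' ∧ i ≠ j) ∨ (b ≠ b' ∧ i = j) := by
  have cubic : ∀ (α β : ℂ) (b : Fin 2) (i j : Fin 4), α • nodeVec b i + β • nodeVec b j ≠ 0 →
      α • nodeVec b i + β • nodeVec b j ∈ affineCone W10 := by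
    intro α β b i j h
    obtain ⟨O, hO⟩ := exists_evenOddEqs (cayleyCubic_nodeEven α β i j)
    fin_cases b <;> simp only [nodeVec, Fin.zero_eta, Fin.mk_one, Fin.isValue, Matrix.cons_val,
      ← join10_smul, ← join10_add] at h ⊢ <;> rw [join10_mem_affineCone_W10_iff h]
    · exact ⟨![1, 0], _, O, by simp, hO, by simp⟩
    · exact ⟨![0, 1], _, O, by simp, hO, by simp⟩
  have cross : ∀ (α β : ℂ) (i : Fin 4), α • nodeVec 0 i + β • nodeVec 1 i ≠ 0 →
      α • nodeVec 0 i + β • nodeVec 1 i ∈ affineCone W10 := by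
    intro α β i h
    obtain ⟨s, rfl⟩ := IsAlgClosed.exists_pow_nat_eq α (n := 2) (by norm_num)
    obtain ⟨t, rfl⟩ := IsAlgClosed.exists_pow_nat_eq β (n := 2) (by norm_num)
    have e : s ^ 2 • nodeVec 0 i + t ^ 2 • nodeVec 1 i =
        join10 (s ^ 2 • nodeEven i) (t ^ 2 • nodeEven i) 0 := by
      simp only [nodeVec, Matrix.cons_val, ← join10_smul, ← join10_add]
      simp
    rw [e] at h ⊢
    rw [join10_mem_affineCone_W10_iff h]
    refine ⟨![s, t], nodeEven i, 0, ?_, evenOddEqs_nodeEven i, by simp⟩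
    intro h0
    refine h ?_
    rw [show s = 0 from congrFun h0 0, show t = 0 from congrFun h0 1]
    simp [join10_zero]
  have neg : ∀ i j : Fin 4, nodeVec 0 i + nodeVec 1 j ∈ affineCone W10 → i = j := by
    intro i j h
    have e : nodeVec 0 i + nodeVec 1 j = join10 (nodeEven i) (nodeEven j) 0 := by
      simp [nodeVec, ← join10_add]
    rw [e] at h
    obtain ⟨y, A, O, -, -, h1, h2, -⟩ := (join10_mem_affineCone_W10_iff h.1).1 h
    have p0 := congrFun h1 0
    have q0 := congrFun h2 0
    simp only [nodeEven_zero, Pi.smul_apply, smul_eq_mul] at p0 q0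
    have hA : A 0 ≠ 0 := by
      intro hA
      simp [hA] at p0
    have hy : y 0 ^ 2 = y 1 ^ 2 := mul_right_cancel₀ hA (p0.symm.trans q0)
    exact nodeEven_injective (by rw [h1, h2, hy])
  have hne : ∀ (b b' : Fin 2) (i j : Fin 4), b ≠ b' → nodeVec b i + nodeVec b' j ≠ 0 := by
    intro b b' i j hb h0
    have c0 := congrFun h0 0
    fin_cases b <;> fin_cases b' <;> first | exact hb rfl | skip
    all_goals simp [nodeVec, join10, nodeEven_zero] at c0
  rw [node, node, associatedPoints_mk_iff]
  change node b i ≠ node b' j ∧ _ ↔ _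
  constructor
  · rintro ⟨hn, h⟩
    by_cases hb : b = b'
    · subst hb
      exact Or.inl ⟨rfl, fun hij => hn (by rw [hij])⟩
    · refine Or.inr ⟨hb, ?_⟩
      have h1 := h 1 1
      rw [one_smul, one_smul] at h1
      have h2 := h1 (hne b b' i j hb)
      fin_cases b <;> fin_cases b'
      · exact absurd rfl hb
      · exact neg i j h2
      · exact (neg j i (by rwa [add_comm (nodeVec 0 j)])).symm
      · exact absurd rfl hb
  · rintro (⟨rfl, hij⟩ | ⟨hb, rfl⟩)
    · exact ⟨fun h => hij (node_injective h).2, fun α β => cubic α β b i j⟩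
    · refine ⟨fun h => hb (node_injective h).1, fun α β h => ?_⟩
      fin_cases b <;> fin_cases b'
      · exact absurd rfl hb
      · exact cross α β i h
      · have e : α • nodeVec 1 i + β • nodeVec 0 i = β • nodeVec 0 i + α • nodeVec 1 i :=
          add_comm _ _
        change α • nodeVec 1 i + β • nodeVec 0 i ≠ 0 at h
        change α • nodeVec 1 i + β • nodeVec 0 i ∈ affineCone W10
        rw [e] at h ⊢
        exact cross β α i h
      · exact absurd rfl hb

/-- The configuration: two complete graphs on four points, which correspond to the two blocks of
coordinates, and four edges which join corresponding points. -/
def configurationIso : SimpleGraph.boxProd (⊤ : SimpleGraph (Fin 2)) (⊤ : SimpleGraph (Fin 4)) ≃g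
    configuration W10 where
  toEquiv := nodeEquiv
  map_rel_iff' := by
    rintro ⟨b, i⟩ ⟨b', j⟩
    change AssociatedPoints W10 (node b i) (node b' j) ↔ _
    rw [associatedPoints_node_iff, SimpleGraph.boxProd_adj, SimpleGraph.top_adj,
      SimpleGraph.top_adj]
    tauto

theorem encard_associatedPoints_W10 {P : ProjSpace 10} (hP : P ∈ singularPoints W10) :
    {Q | Q ∈ singularPoints W10 ∧ AssociatedPoints W10 P Q}.encard = 4 := by
  obtain ⟨b, i, rfl⟩ := mem_singularPoints_W10.1 hP
  have e : {Q | Q ∈ singularPoints W10 ∧ AssociatedPoints W10 (node b i) Q} =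
      (fun p : Fin 2 × Fin 4 => node p.1 p.2) ''
        (Finset.univ.filter fun p : Fin 2 × Fin 4 =>
          (b = p.1 ∧ i ≠ p.2) ∨ (b ≠ p.1 ∧ i = p.2)) := by
    ext Q
    simp only [Set.mem_ofPred_eq, mem_singularPoints_W10, Set.mem_image, Finset.coe_filter,
      Finset.mem_univ, true_and, Prod.exists]
    constructor
    · rintro ⟨⟨b', j, rfl⟩, h⟩
      exact ⟨b', j, associatedPoints_node_iff.1 h, rfl⟩
    · rintro ⟨b', j, h, rfl⟩
      exact ⟨⟨b', j, rfl⟩, associatedPoints_node_iff.2 h⟩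
  rw [e, Function.Injective.encard_image, Set.encard_coe_eq_coe_finsetCard]
  · norm_cast
    clear e hP
    revert b i
    decide
  · rintro ⟨b, i⟩ ⟨b', j⟩ h
    obtain ⟨h1, h2⟩ := node_injective h
    exact Prod.ext h1 h2

/-! ### Similarity of singular points -/

/-- The germs of `W` at `P` and at `Q` are related by a linear isomorphism of the affine charts
with origins `P` and `Q`. -/
def ChartEquiv {n : ℕ} (W : Set (ProjSpace n)) (P Q : ProjSpace n) : Prop :=
  ∃ M : (Fin n → ℂ) ≃ₗ[ℂ] (Fin n → ℂ), ∀ x, x ∈ affineChart W Q ↔ M x ∈ affineChart W P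

theorem ChartEquiv.symm {n : ℕ} {W : Set (ProjSpace n)} {P Q : ProjSpace n}
    (h : ChartEquiv W P Q) : ChartEquiv W Q P := by
  obtain ⟨M, hM⟩ := h
  exact ⟨M.symm, fun x => by rw [hM, M.apply_symm_apply]⟩

theorem ChartEquiv.trans {n : ℕ} {W : Set (ProjSpace n)} {P Q R : ProjSpace n}
    (h : ChartEquiv W P Q) (h' : ChartEquiv W Q R) : ChartEquiv W P R := by
  obtain ⟨M, hM⟩ := h
  obtain ⟨N, hN⟩ := h'
  exact ⟨N.trans M, fun x => by rw [hN, hM, LinearEquiv.trans_apply]⟩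

/-- The automorphism of the polynomial ring which corresponds to a linear automorphism of the
affine space. -/
def substEquiv {n : ℕ} (M : (Fin n → ℂ) ≃ₗ[ℂ] (Fin n → ℂ)) :
    MvPolynomial (Fin n) ℂ ≃ₐ[ℂ] MvPolynomial (Fin n) ℂ :=
  AlgEquiv.ofAlgHom (substLin M.toLinearMap) (substLin M.symm.toLinearMap)
    (AlgHom.ext fun F => by
      rw [AlgHom.comp_apply, substLin_comp, LinearEquiv.symm_comp, substLin_id, AlgHom.id_apply])
    (AlgHom.ext fun F => by
      rw [AlgHom.comp_apply, substLin_comp, LinearEquiv.comp_symm, substLin_id, AlgHom.id_apply])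

theorem eval_substEquiv {n : ℕ} (M : (Fin n → ℂ) ≃ₗ[ℂ] (Fin n → ℂ)) (x : Fin n → ℂ)
    (F : MvPolynomial (Fin n) ℂ) : eval x (substEquiv M F) = eval (M x) F :=
  eval_substLin M.toLinearMap x F

theorem substEquiv_symm {n : ℕ} (M : (Fin n → ℂ) ≃ₗ[ℂ] (Fin n → ℂ)) :
    (substEquiv M).symm = substEquiv M.symm := rfl

theorem substEquiv_isHomogeneous {n : ℕ} (M : (Fin n → ℂ) ≃ₗ[ℂ] (Fin n → ℂ))
    {F : MvPolynomial (Fin n) ℂ} {k : ℕ} (hF : F.IsHomogeneous k) :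
    (substEquiv M F).IsHomogeneous k := by
  have := hF.aeval (fun i => substLin M.toLinearMap (X i)) (n := 1)
    fun i => substLin_X_isHomogeneous M.toLinearMap i
  rw [one_mul] at this
  convert this using 1
  change substLin M.toLinearMap F = _
  congr 1
  ext i
  simp

theorem homogeneousComponent_substEquiv {n : ℕ} (M : (Fin n → ℂ) ≃ₗ[ℂ] (Fin n → ℂ)) (k : ℕ)
    (F : MvPolynomial (Fin n) ℂ) : homogeneousComponent k (substEquiv M F) =
      substEquiv M (homogeneousComponent k F) := by
  conv_lhs => rw [← sum_homogeneousComponent F]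
  rw [map_sum, map_sum]
  have h : ∀ i, homogeneousComponent k (substEquiv M (homogeneousComponent i F)) =
      if i = k then substEquiv M (homogeneousComponent i F) else 0 := by
    intro i
    rw [homogeneousComponent_of_mem
      (substEquiv_isHomogeneous M (homogeneousComponent_isHomogeneous i F))]
    simp only [eq_comm]
  simp only [h, Finset.sum_ite_eq', Finset.mem_range]
  split_ifs with hk
  · rfl
  · rw [homogeneousComponent_eq_zero _ _ (by omega), map_zero]

theorem substEquiv_mem_affineIdeal {n : ℕ} {W : Set (ProjSpace n)} {P Q : ProjSpace n}
    {M : (Fin n → ℂ) ≃ₗ[ℂ] (Fin n → ℂ)} (hM : ∀ x, x ∈ affineChart W Q ↔ M x ∈ affineChart W P)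
    (F : MvPolynomial (Fin n) ℂ) : substEquiv M F ∈ affineIdeal W Q ↔ F ∈ affineIdeal W P := by
  have e : ∀ (R : ProjSpace n) (G : MvPolynomial (Fin n) ℂ), G ∈ affineIdeal W R ↔
      ∀ x ∈ affineChart W R, eval x G = 0 := fun R G => Iff.rfl
  rw [e, e]
  constructor
  · intro h x hx
    have := h (M.symm x) ((hM _).2 (by rwa [M.apply_symm_apply]))
    rwa [eval_substEquiv, M.apply_symm_apply] at this
  · intro h x hx
    rw [eval_substEquiv]
    exact h _ ((hM x).1 hx)

theorem map_substEquiv_vars {n : ℕ} (M : (Fin n → ℂ) ≃ₗ[ℂ] (Fin n → ℂ)) :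
    (Ideal.span (Set.range (X : Fin n → MvPolynomial (Fin n) ℂ))).map
      (substEquiv M : MvPolynomial (Fin n) ℂ →+* MvPolynomial (Fin n) ℂ) =
        Ideal.span (Set.range X) := by
  have h : ∀ (M : (Fin n → ℂ) ≃ₗ[ℂ] (Fin n → ℂ)) (i : Fin n),
      substEquiv M (X i) ∈ Ideal.span (Set.range (X : Fin n → MvPolynomial (Fin n) ℂ)) := by
    intro M i
    change substLin M.toLinearMap (X i) ∈ Ideal.span (Set.range X)
    rw [substLin, aeval_X]
    exact Ideal.sum_mem _ fun j _ => Ideal.mul_mem_left _ _ (Ideal.subset_span ⟨j, rfl⟩)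
  refine le_antisymm ?_ ?_
  · rw [Ideal.map_span, Ideal.span_le]
    rintro _ ⟨_, ⟨i, rfl⟩, rfl⟩
    exact h M i
  · rw [Ideal.span_le]
    rintro _ ⟨i, rfl⟩
    have := Ideal.mem_map_of_mem
      (substEquiv M : MvPolynomial (Fin n) ℂ →+* MvPolynomial (Fin n) ℂ) (h M.symm i)
    rw [← substEquiv_symm] at this
    simpa using this

theorem map_substEquiv_affineIdeal {n : ℕ} {W : Set (ProjSpace n)} {P Q : ProjSpace n}
    {M : (Fin n → ℂ) ≃ₗ[ℂ] (Fin n → ℂ)}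
    (hM : ∀ x, x ∈ affineChart W Q ↔ M x ∈ affineChart W P) :
    (affineIdeal W P).map (substEquiv M : MvPolynomial (Fin n) ℂ →+* MvPolynomial (Fin n) ℂ) =
      affineIdeal W Q := by
  ext F
  rw [Ideal.mem_map_iff_of_surjective
    (substEquiv M : MvPolynomial (Fin n) ℂ →+* MvPolynomial (Fin n) ℂ) (substEquiv M).surjective]
  constructor
  · rintro ⟨G, hG, rfl⟩
    exact (substEquiv_mem_affineIdeal hM G).2 hG
  · intro hF
    refine ⟨(substEquiv M).symm F, ?_, (substEquiv M).apply_symm_apply F⟩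
    rw [← substEquiv_mem_affineIdeal hM]
    rwa [(substEquiv M).apply_symm_apply]

theorem ChartEquiv.hilbertSamuel_eq {n : ℕ} {W : Set (ProjSpace n)} {P Q : ProjSpace n}
    (h : ChartEquiv W P Q) (k : ℕ) : hilbertSamuel W P k = hilbertSamuel W Q k := by
  obtain ⟨M, hM⟩ := h
  have e : affineIdeal W Q ⊔ Ideal.span (Set.range (X : Fin n → MvPolynomial (Fin n) ℂ)) ^ k =
      (affineIdeal W P ⊔ Ideal.span (Set.range (X : Fin n → MvPolynomial (Fin n) ℂ)) ^ k).map
        (substEquiv M : MvPolynomial (Fin n) ℂ →+* MvPolynomial (Fin n) ℂ) := by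
    rw [Ideal.map_sup, Ideal.map_pow, map_substEquiv_vars, map_substEquiv_affineIdeal hM]
  exact (Ideal.quotientEquivAlg _ _ (substEquiv M) e).toLinearEquiv.finrank_eq

theorem ChartEquiv.multiplicity_eq {n : ℕ} {W : Set (ProjSpace n)} {P Q : ProjSpace n}
    (h : ChartEquiv W P Q) : multiplicity W P = multiplicity W Q := by
  simp only [multiplicity, h.hilbertSamuel_eq]

theorem ChartEquiv.sameTangentCone {n : ℕ} {W : Set (ProjSpace n)} {P Q : ProjSpace n}
    (h : ChartEquiv W P Q) : SameTangentCone W P Q := by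
  obtain ⟨M, hM⟩ := h
  have hsubst : ∀ F, linearSubst (LinearMap.toMatrix' M.toLinearMap) F = substEquiv M F := by
    intro F
    change _ = substLin M.toLinearMap F
    rw [linearSubst, substLin]
    simp [LinearMap.toMatrix'_apply]
  refine ⟨LinearMap.toMatrix' M.toLinearMap, ?_, ?_⟩
  · rw [LinearMap.det_toMatrix']
    exact LinearEquiv.isUnit_det' M
  · rw [tangentConeIdeal, tangentConeIdeal, Ideal.map_span]
    congr 1
    ext G
    constructor
    · rintro ⟨_, ⟨F, hF, k, hk, rfl⟩, rfl⟩
      refine ⟨substEquiv M F, (substEquiv_mem_affineIdeal hM F).2 hF, k, fun i hi => ?_, ?_⟩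
      · rw [homogeneousComponent_substEquiv, hk i hi, map_zero]
      · rw [homogeneousComponent_substEquiv]
        exact hsubst _
    · rintro ⟨F, hF, k, hk, rfl⟩
      obtain ⟨F, rfl⟩ := (substEquiv M).surjective F
      refine ⟨homogeneousComponent k F, ⟨F, (substEquiv_mem_affineIdeal hM F).1 hF, k,
        fun i hi => ?_, rfl⟩, ?_⟩
      · have := hk i hi
        rwa [homogeneousComponent_substEquiv, EmbeddingLike.map_eq_zero_iff] at this
      · rw [homogeneousComponent_substEquiv]
        exact hsubst _

/-- Membership in the affine chart in terms of the coordinate vector `v` of the point with pivot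
coordinate `1`. -/
theorem mem_affineChart_iff {n : ℕ} {W : Set (ProjSpace n)} {P : ProjSpace n} {c : ℂ}
    {v : Fin (n + 1) → ℂ} {p : Fin (n + 1)} (hp : pivot P = p) (hv : v p = 1) (hP : P.rep = c • v)
    (x : Fin n → ℂ) :
    x ∈ affineChart W P ↔ v + p.insertNth (α := fun _ => ℂ) 0 x ∈ affineCone W := by
  subst hp
  have hc : c ≠ 0 := by
    rintro rfl
    exact P.rep_nonzero (by rw [hP, zero_smul])
  rw [affineChart, Set.mem_ofPred_eq, hP]
  have e : (pivot P).insertNth (α := fun _ => ℂ) 1 (fun i =>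
      (c • v) ((pivot P).succAbove i) / (c • v) (pivot P) + x i) =
        v + (pivot P).insertNth (α := fun _ => ℂ) 0 x := by
    funext k
    refine Fin.succAboveCases (pivot P) ?_ (fun l => ?_) k
    · simp [hv]
    · simp only [Fin.insertNth_apply_succAbove, Pi.add_apply, Pi.smul_apply, smul_eq_mul, hv]
      field_simp
  rw [e]

/-- A linear automorphism of the cone over `W` which maps the coordinate which is the pivot at
one point to the one which is the pivot at the other point identifies the germs. -/
theorem ChartEquiv.of_linearEquiv {n : ℕ} {W : Set (ProjSpace n)} {P Q : ProjSpace n}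
    (g : (Fin (n + 1) → ℂ) ≃ₗ[ℂ] (Fin (n + 1) → ℂ))
    (hg : ∀ z, z ∈ affineCone W ↔ g z ∈ affineCone W)
    {p q : Fin (n + 1)} {u v : Fin (n + 1) → ℂ} (hgp : ∀ z, g z q = z p) (huv : g u = v)
    (hP : ∀ x, x ∈ affineChart W P ↔ v + q.insertNth (α := fun _ => ℂ) 0 x ∈ affineCone W)
    (hQ : ∀ x, x ∈ affineChart W Q ↔ u + p.insertNth (α := fun _ => ℂ) 0 x ∈ affineCone W) :
    ChartEquiv W P Q := by
  have hq : ∀ w : Fin (n + 1) → ℂ, w q = 0 →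
      q.insertNth (α := fun _ => ℂ) 0 (q.removeNth w) = w := by
    intro w hw
    rw [← hw, Fin.insertNth_self_removeNth]
  have hp : ∀ w : Fin (n + 1) → ℂ, w p = 0 →
      p.insertNth (α := fun _ => ℂ) 0 (p.removeNth w) = w := by
    intro w hw
    rw [← hw, Fin.insertNth_self_removeNth]
  have h0 : ∀ x : Fin n → ℂ, g (p.insertNth (α := fun _ => ℂ) 0 x) q = 0 := by
    intro x
    rw [hgp, Fin.insertNth_apply_same]
  have h0' : ∀ y : Fin n → ℂ, g.symm (q.insertNth (α := fun _ => ℂ) 0 y) p = 0 := by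
    intro y
    rw [← hgp (g.symm _), g.apply_symm_apply, Fin.insertNth_apply_same]
  let ins : (Fin n → ℂ) →ₗ[ℂ] (Fin (n + 1) → ℂ) :=
    { toFun := fun x => p.insertNth (α := fun _ => ℂ) 0 x
      map_add' := fun x y => by
        funext k
        refine Fin.succAboveCases p ?_ (fun l => ?_) k <;> simp
      map_smul' := fun c x => by
        funext k
        refine Fin.succAboveCases p ?_ (fun l => ?_) k <;> simp }
  let M : (Fin n → ℂ) ≃ₗ[ℂ] (Fin n → ℂ) :=
    { LinearMap.funLeft ℂ ℂ q.succAbove ∘ₗ g.toLinearMap ∘ₗ ins with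
      invFun := fun y => p.removeNth (g.symm (q.insertNth (α := fun _ => ℂ) 0 y))
      left_inv := fun x => by
        change p.removeNth (g.symm (q.insertNth (α := fun _ => ℂ) 0 (q.removeNth
          (g (p.insertNth (α := fun _ => ℂ) 0 x))))) = x
        rw [hq _ (h0 x), g.symm_apply_apply, Fin.removeNth_insertNth]
      right_inv := fun y => by
        change q.removeNth (g (p.insertNth (α := fun _ => ℂ) 0 (p.removeNth (g.symm _)))) = y
        rw [hp _ (h0' y), g.apply_symm_apply, Fin.removeNth_insertNth] }
  refine ⟨M, fun x => ?_⟩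
  have hM : q.insertNth (α := fun _ => ℂ) 0 (M x) = g (p.insertNth (α := fun _ => ℂ) 0 x) :=
    hq _ (h0 x)
  rw [hP, hQ, hM, ← huv, ← map_add, ← hg]

/-! ### Symmetries of the threefold of genus 10 -/

theorem pivot_node (b : Fin 2) (i : Fin 4) : pivot (node b i) = ![0, 4] b := by
  obtain ⟨a, ha⟩ := Projectivization.exists_smul_eq_mk_rep ℂ (nodeVec b i) (nodeVec_ne_zero b i)
  have hrep : ∀ k, (node b i).rep k = a * nodeVec b i k := fun k => (congrFun ha k).symm
  refine IsLeast.csInf_eq ⟨?_, fun j hj => ?_⟩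
  · rw [Set.mem_ofPred_eq, hrep]
    refine mul_ne_zero a.ne_zero ?_
    fin_cases b <;> simp [nodeVec, join10, nodeEven_zero]
  · rw [Set.mem_ofPred_eq, hrep] at hj
    have hj' := right_ne_zero_of_mul hj
    fin_cases b
    · exact Fin.zero_le j
    · by_contra hcon
      refine hj' ?_
      fin_cases j <;> first | rfl | exact absurd (by decide) hcon

theorem mem_affineChart_node (b : Fin 2) (i : Fin 4) (x : Fin 10 → ℂ) :
    x ∈ affineChart W10 (node b i) ↔
      nodeVec b i + (![0, 4] b : Fin 11).insertNth (α := fun _ => ℂ) 0 x ∈ affineCone W10 := by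
  obtain ⟨a, ha⟩ := Projectivization.exists_smul_eq_mk_rep ℂ (nodeVec b i) (nodeVec_ne_zero b i)
  refine mem_affineChart_iff (pivot_node b i) ?_ ha.symm x
  fin_cases b <;> simp [nodeVec, join10, nodeEven_zero]

/-- The sign changes of the odd coordinates, and of the even coordinates other than the first,
which relate the first node of the Cayley cubic to the others. -/
def nodeSign : Fin 4 → Fin 3 → ℂ := ![![1, 1, 1], ![1, -1, -1], ![-1, -1, 1], ![-1, 1, -1]]

/-- The sign changes of the even coordinates. -/
def evenSign (i : Fin 4) : Fin 4 → ℂ := ![1, nodeSign i 0, nodeSign i 1, nodeSign i 2]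

theorem EvenOddEqs.mul_sign {A : Fin 4 → ℂ} {O : Fin 3 → ℂ} (h : EvenOddEqs A O) (i : Fin 4) :
    EvenOddEqs (evenSign i * A) (nodeSign i * O) := by
  obtain ⟨s00, s11, s22, s01, s02, s12, l0, l1, l2⟩ := h
  have h0 : nodeSign i 0 ^ 2 = 1 := by fin_cases i <;> simp [nodeSign]
  have h1 : nodeSign i 1 ^ 2 = 1 := by fin_cases i <;> simp [nodeSign]
  have h2 : nodeSign i 2 = nodeSign i 0 * nodeSign i 1 := by fin_cases i <;> simp [nodeSign]
  constructor <;> simp only [evenSign, Pi.mul_apply, Matrix.cons_val, h2]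
  · linear_combination nodeSign i 0 ^ 2 * s00 - 4 * A 0 ^ 2 * h0
  · linear_combination nodeSign i 1 ^ 2 * s11 - 4 * A 0 ^ 2 * h1
  · linear_combination nodeSign i 0 ^ 2 * nodeSign i 1 ^ 2 * s22
      - 4 * A 0 ^ 2 * (nodeSign i 1 ^ 2 * h0 + h1)
  · linear_combination nodeSign i 0 * nodeSign i 1 * s01
  · linear_combination nodeSign i 0 ^ 2 * nodeSign i 1 * s02 + 2 * A 0 * A 2 * nodeSign i 1 * h0
  · linear_combination nodeSign i 0 * nodeSign i 1 ^ 2 * s12 - 2 * A 0 * A 1 * nodeSign i 0 * h1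
  · linear_combination nodeSign i 0 * nodeSign i 1 ^ 2 * l0 + 2 * A 0 * O 0 * nodeSign i 0 * h1
  · linear_combination nodeSign i 0 ^ 2 * nodeSign i 1 * l1 + 2 * A 0 * O 1 * nodeSign i 1 * h0
  · linear_combination nodeSign i 0 * nodeSign i 1 * l2

/-- An involution of the coordinate space which maps the cone to itself and one node to another. -/
theorem chartEquiv_node_of_involutive {b b' : Fin 2} {i i' : Fin 4}
    (g : (Fin 11 → ℂ) →ₗ[ℂ] (Fin 11 → ℂ)) (hinv : Function.Involutive g)
    (hg : ∀ z ∈ affineCone W10, g z ∈ affineCone W10) (hz : ∀ z, g z (![0, 4] b') = z (![0, 4] b))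
    (hnode : g (nodeVec b i) = nodeVec b' i') : ChartEquiv W10 (node b' i') (node b i) :=
  ChartEquiv.of_linearEquiv (LinearEquiv.ofInvolutive g hinv)
    (fun z => ⟨hg z, fun h => by simpa [hinv z] using hg _ h⟩) hz hnode
    (mem_affineChart_node b' i') (mem_affineChart_node b i)

theorem chartEquiv_node_sign (i : Fin 4) : ChartEquiv W10 (node 0 i) (node 0 0) := by
  have hsq : ∀ k, nodeSign i k * nodeSign i k = 1 := by
    intro k
    fin_cases i <;> fin_cases k <;> simp [nodeSign]
  have hsq' : ∀ k, evenSign i k * evenSign i k = 1 := by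
    intro k
    fin_cases k
    · exact one_mul 1
    · exact hsq 0
    · exact hsq 1
    · exact hsq 2
  have hmul : ∀ a b o, join10 (evenSign i) (evenSign i) (nodeSign i) * join10 a b o =
      join10 (evenSign i * a) (evenSign i * b) (nodeSign i * o) := by
    intro a b o
    ext k
    fin_cases k <;> rfl
  have hone : join10 (evenSign i) (evenSign i) (nodeSign i) *
      join10 (evenSign i) (evenSign i) (nodeSign i) = 1 := by
    rw [hmul]
    ext k
    fin_cases k
    exacts [hsq' 0, hsq' 1, hsq' 2, hsq' 3, hsq' 0, hsq' 1, hsq' 2, hsq' 3, hsq 0, hsq 1, hsq 2]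
  refine chartEquiv_node_of_involutive
    (LinearMap.mulLeft ℂ (join10 (evenSign i) (evenSign i) (nodeSign i))) ?_ ?_ ?_ ?_
  · intro z
    rw [LinearMap.mulLeft_apply, LinearMap.mulLeft_apply, ← mul_assoc, hone, one_mul]
  · intro z hz
    obtain ⟨z0, y, A, O, hy, h, rfl⟩ := mem_W10_iff.1 hz
    rw [mem_W10_iff, LinearMap.mulLeft_apply]
    refine ⟨fun h0 => z0 ?_, y, _, _, hy, h.mul_sign i, ?_⟩
    · rw [← one_mul (param10 y A O), ← hone, mul_assoc, h0, mul_zero]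
    · rw [param10_eq_join10, param10_eq_join10, hmul, mul_smul_comm, mul_smul_comm, mul_smul_comm]
  · intro z
    simp [join10, evenSign]
  · rw [LinearMap.mulLeft_apply]
    simp only [nodeVec, Matrix.cons_val, hmul, mul_zero]
    congr 1
    ext k
    fin_cases i <;> fin_cases k <;> simp [evenSign, nodeSign, nodeEven]

theorem chartEquiv_node_swap (i : Fin 4) : ChartEquiv W10 (node 1 i) (node 0 i) := by
  have hswap : ∀ a b o, LinearMap.funLeft ℂ ℂ ![4, 5, 6, 7, 0, 1, 2, 3, 8, 9, 10] (join10 a b o) =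
      join10 b a o := by
    intro a b o
    ext k
    fin_cases k <;> rfl
  have hinv : Function.Involutive
      (LinearMap.funLeft ℂ ℂ (![4, 5, 6, 7, 0, 1, 2, 3, 8, 9, 10] : Fin 11 → Fin 11)) := by
    intro z
    obtain ⟨a, b, o, rfl⟩ := exists_eq_join10 z
    rw [hswap, hswap]
  refine chartEquiv_node_of_involutive _ hinv ?_ ?_ ?_
  · intro z hz
    obtain ⟨z0, y, A, O, hy, h, rfl⟩ := mem_W10_iff.1 hz
    rw [mem_W10_iff]
    refine ⟨fun h0 => z0 ?_, ![y 1, y 0], A, O, fun h0 => hy ?_, h, ?_⟩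
    · rw [← hinv (param10 y A O), h0, map_zero]
    · ext k
      fin_cases k
      · exact congrFun h0 1
      · exact congrFun h0 0
    · rw [param10_eq_join10, param10_eq_join10, hswap, mul_comm]
      rfl
  · intro z
    rfl
  · exact hswap _ _ _

theorem chartEquiv_node (b b' : Fin 2) (i i' : Fin 4) :
    ChartEquiv W10 (node b i) (node b' i') := by
  have h : ∀ b i, ChartEquiv W10 (node b i) (node 0 0) := by
    intro b i
    fin_cases b
    · exact chartEquiv_node_sign i
    · exact (chartEquiv_node_swap i).trans (chartEquiv_node_sign i)
  exact (h b i).trans (h b' i').symm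

theorem singularPointsSimilar_W10 : SingularPointsSimilar W10 where
  same_multiplicity P hP Q hQ := by
    obtain ⟨b, i, rfl⟩ := mem_singularPoints_W10.1 hP
    obtain ⟨b', i', rfl⟩ := mem_singularPoints_W10.1 hQ
    exact (chartEquiv_node b b' i i').multiplicity_eq
  same_tangentCone P hP Q hQ := by
    obtain ⟨b, i, rfl⟩ := mem_singularPoints_W10.1 hP
    obtain ⟨b', i', rfl⟩ := mem_singularPoints_W10.1 hQ
    exact (chartEquiv_node b b' i i').sameTangentCone
  same_associated := ⟨4, fun _ hP => encard_associatedPoints_W10 hP⟩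

end EnriquesFano

end

open EnriquesFano in
theorem mainTheorem3 :
    (∀ q r : BlockQuadric, q.Smooth → EightFixedPoints q r →
      ∀ (ι : (Fin 9 → ℂ) →ₗ[ℂ] (Fin 10 → ℂ)) (hι : Function.Injective ι),
        (∀ Z, Z ∈ LinearMap.range ι ↔ hyperplaneForm q Z = 0) →
          GeneratedByQuadricsAndCubics (projIdeal (W8 q r ι hι))) ∧
    GeneratedByQuadricsAndCubics (projIdeal W10) ∧
    (singularPoints W10).ncard = 8 ∧
    SingularPointsSimilar W10 ∧
    (∀ P ∈ singularPoints W10,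
      {Q | Q ∈ singularPoints W10 ∧ AssociatedPoints W10 P Q}.encard = 4) ∧
    Nonempty (configuration W10 ≃g
      SimpleGraph.boxProd (⊤ : SimpleGraph (Fin 2)) (⊤ : SimpleGraph (Fin 4))) ∧
    (∃ P ∈ singularPoints W10, ∃ Q ∈ singularPoints W10, ∃ R ∈ singularPoints W10,
      AssociatedPoints W10 P Q ∧ AssociatedPoints W10 Q R ∧ AssociatedPoints W10 P R) := by
  have hnode : ∀ b i, node b i ∈ singularPoints W10 := fun b i =>
    mem_singularPoints_W10.2 ⟨b, i, rfl⟩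
  exact ⟨fun q r hq _ ι hι hrange => generated_W8 q r hq ι hι hrange, generated_W10,
    ncard_singularPoints_W10, singularPointsSimilar_W10,
    fun P hP => encard_associatedPoints_W10 hP, ⟨configurationIso.symm⟩,
    node 0 0, hnode 0 0, node 0 1, hnode 0 1, node 0 2, hnode 0 2,
    associatedPoints_node_iff.2 (Or.inl ⟨rfl, by decide⟩),
    associatedPoints_node_iff.2 (Or.inl ⟨rfl, by decide⟩),
    associatedPoints_node_iff.2 (Or.inl ⟨rfl, by decide⟩)⟩
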